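/- **Setting.** A Pauli error on $n$ qubits is labelled by $v=(a|b)\in\mathbb Z_2^{2n}$; $E_v$ is the operator $X^aZ^b$ with the phase that makes it self-adjoint, and $B(v,w)=a'\cdot b-a\cdot b'$ (for $w=(a'|b')$) is the symplectic form. A stabilizer code $Q$ encoding $m$ qubits in $n=m+s$ qubits is given by $s$ linearly independent generators $g_1,\dots,g_s\in\mathbb Z_2^{2n}$ with $B(g_i,g_j)=0$; $Q$ also denotes their span, and $Q^\perp$ its orthogonal complement under $B$. For $y\in\{0,1\}^s$ the space with syndrome $y$ is the common eigenspace of the $E_{g_i}$ with eigenvalues $(-1)^{y_i}$; an encoding of $Q$ is a choice, for every $y$, of an isometry of $(\mathbb C^2)^{\otimes m}$ into the space with syndrome $y$. A finite family $\{Q_k\}_{k\in\mathcal K}$, $\mathcal K\neq\emptyset$, of such codes is a stabilizer purity testing code with error $\epsilon\ge 0$ if $\#\{k: x\in Q_k^\perp\setminus Q_k\}\le\epsilon\,\#\mathcal K$ for all $x\ne0$. A (non-interactive) quantum authentication scheme with finite key set consists, for each key $\kappa$, of superoperators $A_\kappa$ from $m$ qubits to $n$ qubits and $B_\kappa$ from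 $n$ qubits to an $m$-qubit message system $M$ and a qubit $V$ with basis $|\mathrm{acc}\rangle,|\mathrm{rej}\rangle$, computed by quantum circuits of polynomial size. Its key length is $\log_2$ of the number of keys. It is secure with soundness error $\epsilon$ if for every pure $m$-qubit state $|\psi\rangle$: (completeness) $B_\kappa(A_\kappa(|\psi\rangle\langle\psi|))=|\psi\rangle\langle\psi|\otimes|\mathrm{acc}\rangle\langle\mathrm{acc}|$ for every $\kappa$; (soundness) for every superoperator $\mathcal O$ on $n$ qubits, $\mathrm{Tr}(P_1^{|\psi\rangle}\rho_{Bob})\ge1-\epsilon$, where $\rho_{Bob}$ is the average of $B_\kappa(\mathcal O(A_\kappa(|\psi\rangle\langle\psi|)))$ over uniformly random $\kappa$ and $P_1^{|\psi\rangle}=|\psi\rangle\langle\psi|\otimes I_V+I_M\otimes|\mathrm{rej}\rangle\langle\mathrm{rej}|-|\psi\rangle\langle\psi|\otimes|\mathrm{rej}\rangle\langle\mathrm{rej}|$. **Protocol.** Given $\{Q_k\}$ and an encoding of each $Q_k$, the key is a uniformly random triple $(k,x,y)$ with $k\in\mathcal K$, $x=(a,b)\in\{0,1\}^{2m}$, $y\in\{0,1\}^s$.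 The sender applies $Z^bX^a$ to the message (quantum one-time pad), encodes the result in $Q_k$ with syndrome $y$, and sends the $n=m+s$ qubits. The receiver measures the syndrome $y'$ of $Q_k$. If $y'\ne y$ he outputs $|0^m\rangle$ and $|\mathrm{rej}\rangle$; otherwise he decodes, undoes the one-time pad, and outputs the result and $|\mathrm{acc}\rangle$. **Theorem.** (i) There are a constant $c$ and a polynomial $p$ such that for all $m,s$ and every nonempty finite family $\{Q_k\}_{k\in\mathcal K}$ of stabilizer codes of $m$ in $n=m+s$ qubits the following holds. For all encodings of the $Q_k$, the maps $A_\kappa,B_\kappa$ of the protocol are superoperators, its key length is at most $c\,(n+\log_2\#\mathcal K)$, and if $\{Q_k\}$ is a purity testing code with error $\epsilon\ge0$, then the protocol is secure with soundness error $\epsilon$. Moreover the encodings can be chosen so that for every key both $A_\kappa$ and $B_\kappa$ are performed by quantum circuits of at most $p(n)$ wires and gates (NOT, Hadamard, phase gate, CNOT, Toffoli; ancillas start in $|0\rangle$; unused outputs are discarded). (ii) Let $s,r\ge1$, $n=rs$ and $m=n-s$. Identify $GF(2^{2n})$ with $GF(2^s)^{2r}$ by a basis over $GF(2^s)$ (for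 an embedding of $GF(2^s)$ in $GF(2^{2n})$), and with $\mathbb Z_2^{2n}$ by a $\mathbb Z_2$-linear isomorphism taking the form $\mathrm{Tr}(xy^{2^{n}})$ to $B$. Let $Q_k$ be the $s$-dimensional binary subspaces given by the $2^s+1$ points (lines over $GF(2^s)$) of the normal rational curve $\{[1:t:\dots:t^{2r-1}]\}_{t\in GF(2^s)}\cup\{[0:\dots:0:1]\}$. Such identifications and codes exist. For every such choice, $\{Q_k\}$ is a stabilizer purity testing code with error $\frac{2n}{s(2^s+1)}$, and for all encodings of the $Q_k$ the protocol, which sends $n=m+s$ qubits, is secure with soundness error $\frac{2n}{s(2^s+1)}$ and has key length $2m+s+\log_2(2^s+1)\le 2n+1$. -/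

import Mathlib

open scoped Matrix Kronecker

noncomputable section

namespace QAuth

/-! ### Registers of qubits, operators and superoperators -/

/-- The computational basis of a register of `n` qubits. -/
abbrev Qubits (n : ℕ) : Type := Fin n → ZMod 2

/-- Operators on the Hilbert space with orthonormal basis `α`. -/
abbrev Op (α : Type*) : Type _ := Matrix α α ℂ

/-- The operator `|ψ⟩⟨ψ|`. -/
def proj {α : Type*} (ψ : α → ℂ) : Op α := Matrix.vecMulVec ψ (star ψ)

/-- A pure state: a vector of unit norm. -/
def IsPureState {α : Type*} [Fintype α] (ψ : α → ℂ) : Prop := ∑ a, ‖ψ a‖ ^ 2 = 1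

/-- Superoperators: completely positive trace-preserving maps, in operator-sum (Kraus) form. -/
def IsSuperoperator {α β : Type*} [Fintype α] [DecidableEq α] [Fintype β]
    (Φ : Op α → Op β) : Prop :=
  ∃ (N : ℕ) (E : Fin N → Matrix β α ℂ),
    ∑ j, (E j)ᴴ * E j = 1 ∧ ∀ ρ, Φ ρ = ∑ j, E j * ρ * (E j)ᴴ

/-! ### Pauli operators and the symplectic form -/

/-- Vectors `(a | b)` labelling the Pauli errors on `n` qubits. -/
abbrev PauliVec (n : ℕ) : Type := Qubits n × Qubits n

/-- The sign `(-1)^c`. -/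
def sgn (c : ZMod 2) : ℂ := (-1) ^ c.val

/-- `X^a`: the operator `|u⟩ ↦ |u + a⟩`. -/
def pauliX {n : ℕ} (a : Qubits n) : Op (Qubits n) :=
  Matrix.of fun v u => if v = u + a then 1 else 0

/-- `Z^b`: the operator `|u⟩ ↦ (-1)^(b·u) |u⟩`. -/
def pauliZ {n : ℕ} (b : Qubits n) : Op (Qubits n) :=
  Matrix.diagonal fun u => sgn (b ⬝ᵥ u)

/-- The Pauli operator labelled by `(a | b)`, with the phase that makes it self-adjoint: a factor
`i` for every qubit on which both `X` and `Z` act. -/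
def pauli {n : ℕ} (v : PauliVec n) : Op (Qubits n) :=
  Complex.I ^ (Finset.univ.filter fun i => v.1 i = 1 ∧ v.2 i = 1).card •
    (pauliX v.1 * pauliZ v.2)

/-- The symplectic inner product `a'·b - a·b'`. -/
def sympl {n : ℕ} (v w : PauliVec n) : ZMod 2 := w.1 ⬝ᵥ v.2 - v.1 ⬝ᵥ w.2

/-! ### Stabilizer codes -/

/-- A stabilizer code encoding `m` qubits in `m + s` qubits, given by `s` independent commuting
Pauli generators. -/
structure StabilizerCode (m s : ℕ) where
  gen : Fin s → PauliVec (m + s)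
  indep : LinearIndependent (ZMod 2) gen
  comm : ∀ i j, sympl (gen i) (gen j) = 0

namespace StabilizerCode

variable {m s : ℕ}

/-- The totally isotropic subspace `Q` of the code. -/
def space (Q : StabilizerCode m s) : Submodule (ZMod 2) (PauliVec (m + s)) :=
  Submodule.span (ZMod 2) (Set.range Q.gen)

/-- `Q^⊥`, the errors which commute with all elements of `Q`. -/
def perp (Q : StabilizerCode m s) : Set (PauliVec (m + s)) :=
  {x | ∀ z ∈ Q.space, sympl z x = 0}

/-- The projector onto the space with syndrome `y`, that is, onto the common eigenvectors of the
generators with eigenvalues `(-1)^(y i)`. -/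
def syndromeProj (Q : StabilizerCode m s) (y : Qubits s) : Op (Qubits (m + s)) :=
  (List.ofFn fun i => (1 / 2 : ℂ) • (1 + sgn (y i) • pauli (Q.gen i))).prod

/-- An encoding of `m` qubits in the code: for every syndrome `y` an isometry of the message space
into the space with syndrome `y`. -/
structure Encoding (Q : StabilizerCode m s) where
  V : Qubits s → Matrix (Qubits (m + s)) (Qubits m) ℂ
  isometry : ∀ y, (V y)ᴴ * V y = 1
  syndrome : ∀ y i, pauli (Q.gen i) * V y = sgn (y i) • V y

end StabilizerCode

/-- Stabilizer purity testing codes with error `ε`. -/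
def IsPurityTestingCode {m s : ℕ} {K : Type*} [Fintype K] (Q : K → StabilizerCode m s)
    (ε : ℝ) : Prop :=
  ∀ x : PauliVec (m + s), x ≠ 0 →
    (({k | x ∈ (Q k).perp ∧ x ∉ (Q k).space} : Set K).ncard : ℝ) ≤ ε * Fintype.card K

/-! ### Quantum circuits -/

/-- Elementary gates on `w` wires: NOT, Hadamard, phase gate, CNOT (control `i`, target `j`) and
Toffoli (controls `i`, `j`, target `l`). -/
inductive Gate (w : ℕ) : Type
  | not (i : Fin w)
  | had (i : Fin w)
  | phase (i : Fin w)
  | cnot (i j : Fin w) (h : i ≠ j)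
  | toffoli (i j l : Fin w) (hij : i ≠ j) (hil : i ≠ l) (hjl : j ≠ l)

/-- The unitary of a gate. -/
def Gate.mat {w : ℕ} : Gate w → Op (Qubits w)
  | .not i => Matrix.of fun v u => if v = Function.update u i (u i + 1) then 1 else 0
  | .had i => Matrix.of fun v u =>
      if ∀ j, j ≠ i → v j = u j then sgn (u i * v i) / (Real.sqrt 2 : ℂ) else 0
  | .phase i => Matrix.diagonal fun u => Complex.I ^ (u i).val
  | .cnot i j _ => Matrix.of fun v u =>
      if v = Function.update u j (u j + u i) then 1 else 0
  | .toffoli i j l _ _ _ => Matrix.of fun v u =>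
      if v = Function.update u l (u l + u i * u j) then 1 else 0

/-- A circuit with `a` input and `b` output qubits: `wires` wires, of which `inp` carry the input
and all others start in `|0⟩`; the gates, in the order in which they are applied; and the wires
`out` which carry the output, all others being discarded at the end. -/
structure Circuit (a b : ℕ) where
  wires : ℕ
  inp : Fin a ↪ Fin wires
  out : Fin b ↪ Fin wires
  gates : List (Gate wires)

namespace Circuit

variable {a b : ℕ}

/-- Number of wires plus number of gates. -/
def size (C : Circuit a b) : ℕ := C.wires + C.gates.length

/-- The unitary performed by the gates. -/
def unitary (C : Circuit a b) : Op (Qubits C.wires) :=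
  C.gates.foldl (fun M g => g.mat * M) 1

/-- `ρ` on the input wires, `|0⟩` on all others. -/
def prepare (C : Circuit a b) (ρ : Op (Qubits a)) : Op (Qubits C.wires) :=
  open scoped Classical in
  Matrix.of fun u v =>
    if ∀ i, i ∉ Set.range C.inp → u i = 0 ∧ v i = 0 then ρ (u ∘ C.inp) (v ∘ C.inp) else 0

/-- Partial trace over all wires that are not output wires. -/
def discard (C : Circuit a b) (σ : Op (Qubits C.wires)) : Op (Qubits b) :=
  open scoped Classical in
  Matrix.of fun p q => ∑ u : Qubits C.wires, ∑ v : Qubits C.wires,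
    if u ∘ C.out = p ∧ v ∘ C.out = q ∧ ∀ i, i ∉ Set.range C.out → u i = v i then σ u v else 0

/-- The superoperator implemented by the circuit. -/
def run (C : Circuit a b) (ρ : Op (Qubits a)) : Op (Qubits b) :=
  C.discard (C.unitary * C.prepare ρ * C.unitaryᴴ)

end Circuit

/-! ### Quantum authentication schemes -/

/-- The basis states `|acc⟩` and `|rej⟩` of the verdict qubit `V`. -/
def acc : ZMod 2 → ℂ := Pi.single 1 1

/-- See `acc`. -/
def rej : ZMod 2 → ℂ := Pi.single 0 1

/-- The data of a non-interactive scheme with key set `Key`: for each key the sender's map `A`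
from `m` to `n` qubits, and the receiver's map `B` from `n` qubits to an `m`-qubit message system
and the verdict qubit. -/
structure Scheme (m n : ℕ) (Key : Type*) where
  A : Key → Op (Qubits m) → Op (Qubits n)
  B : Key → Op (Qubits n) → Op (Qubits m × ZMod 2)

namespace Scheme

variable {m n : ℕ} {Key : Type*}

/-- The maps of sender and receiver are superoperators. -/
def IsPhysical (S : Scheme m n Key) : Prop :=
  ∀ κ, IsSuperoperator (S.A κ) ∧ IsSuperoperator (S.B κ)

/-- For each key, the maps of sender and receiver are performed by circuits of size at most `N`
(in the receiver's circuit the last output wire carries the verdict qubit). -/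
def HasCircuitsOfSize (S : Scheme m n Key) (N : ℕ) : Prop :=
  ∀ κ,
    (∃ C : Circuit m n, C.size ≤ N ∧ ∀ ρ, S.A κ ρ = C.run ρ) ∧
    (∃ C : Circuit n (m + 1), C.size ≤ N ∧ ∀ σ, S.B κ σ =
      (C.run σ).submatrix (fun p => Fin.snoc (α := fun _ => ZMod 2) p.1 p.2)
        (fun p => Fin.snoc (α := fun _ => ZMod 2) p.1 p.2))

/-- The projector for "the message is in state `ψ` or the verdict is `rej`". -/
def testProj (ψ : Qubits m → ℂ) : Op (Qubits m × ZMod 2) :=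
  proj ψ ⊗ₖ (1 : Op (ZMod 2)) + (1 : Op (Qubits m)) ⊗ₖ proj rej - proj ψ ⊗ₖ proj rej

/-- The receiver's output averaged over the keys, for input `ψ` and adversary `O`. -/
def rhoBob [Fintype Key] (S : Scheme m n Key) (O : Op (Qubits n) → Op (Qubits n))
    (ψ : Qubits m → ℂ) : Op (Qubits m × ZMod 2) :=
  (1 / Fintype.card Key : ℂ) • ∑ κ, S.B κ (O (S.A κ (proj ψ)))

/-- Security with error `ε`: completeness and soundness for all pure states. -/
def IsSecure [Fintype Key] (S : Scheme m n Key) (ε : ℝ) : Prop :=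
  ∀ ψ : Qubits m → ℂ, IsPureState ψ →
    (∀ κ, S.B κ (S.A κ (proj ψ)) = proj ψ ⊗ₖ proj acc) ∧
    ∀ O : Op (Qubits n) → Op (Qubits n), IsSuperoperator O →
      1 - ε ≤ (Matrix.trace (testProj ψ * S.rhoBob O ψ)).re

/-- The key length in bits, `log₂` of the number of keys. -/
def keyLength [Fintype Key] (_S : Scheme m n Key) : ℝ := Real.logb 2 (Fintype.card Key)

end Scheme

/-! ### The non-interactive protocol -/

/-- Keys `(k, x, y)`: the code, the `2m` bits of the one-time pad, and the syndrome. -/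
abbrev ProtocolKey (K : Type*) (m s : ℕ) : Type _ := K × PauliVec m × Qubits s

/-- The unitary of the quantum one-time pad with key `x`. -/
def pad {m : ℕ} (x : PauliVec m) : Op (Qubits m) := pauliZ x.2 * pauliX x.1

/-- The sender encrypts with `x` and encodes in `Q k` with syndrome `y`. The receiver measures the
syndrome `y'` of `Q k`. If `y' = y`, he decodes, decrypts with `x` and accepts; otherwise he
rejects, with the message system in `|0…0⟩`. -/
def protocol {K : Type*} {m s : ℕ} (Q : K → StabilizerCode m s) (V : ∀ k, (Q k).Encoding) :
    Scheme m (m + s) (ProtocolKey K m s) where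
  A := fun (k, x, y) ρ => (V k).V y * (pad x * ρ * (pad x)ᴴ) * ((V k).V y)ᴴ
  B := fun (k, x, y) σ =>
    let measured := fun y' => (Q k).syndromeProj y' * σ * (Q k).syndromeProj y'
    ((pad x)ᴴ * (((V k).V y)ᴴ * measured y * (V k).V y) * pad x) ⊗ₖ proj acc +
      (∑ y' ∈ Finset.univ.erase y, (measured y').trace) •
        (proj (Pi.single (0 : Qubits m) 1) ⊗ₖ proj rej)

/-! ### The purity testing code from the normal rational curve -/

/-- Homogeneous coordinates of the points of the normal rational curve in `PG(2r - 1, F)`: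
`[1 : t : ⋯ : t^(2r-1)]` for `t ∈ F`, and `[0 : ⋯ : 0 : 1]`. -/
def curvePoint {F : Type*} [Field F] (r : ℕ) : Option F → Fin (2 * r) → F
  | some t => fun i => t ^ (i : ℕ)
  | none => fun i => if (i : ℕ) + 1 = 2 * r then 1 else 0

/-- `Q` is the family of codes given by the normal rational curve, for `m + s = r s` qubits:
`GF(2^(2(m+s)))` is identified with `GF(2^s)^(2r)` by a basis `ω` over `GF(2^s)`, and with the
binary vectors labelling Pauli errors by a map `φ` which takes the form `Tr (x y^(2^(m+s)))` to the
symplectic inner product; `Q k` is the image of the point `k` of the curve, a line over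
`GF(2^s)`. -/
def IsNormalRationalCurveCode {m s : ℕ} (r : ℕ)
    (Q : Option (GaloisField 2 s) → StabilizerCode m s) : Prop :=
  ∃ (_ : Algebra (GaloisField 2 s) (GaloisField 2 (2 * (m + s))))
    (ω : Module.Basis (Fin (2 * r)) (GaloisField 2 s) (GaloisField 2 (2 * (m + s))))
    (φ : GaloisField 2 (2 * (m + s)) ≃ₗ[ZMod 2] PauliVec (m + s)),
    (∀ x y, sympl (φ x) (φ y) =
      Algebra.trace (ZMod 2) (GaloisField 2 (2 * (m + s))) (x * y ^ 2 ^ (m + s))) ∧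
    ∀ k, ((Q k).space : Set (PauliVec (m + s))) =
      Set.range fun c : GaloisField 2 s => φ (c • ∑ i, curvePoint r k i • ω i)

instance galoisFieldFintype (s : ℕ) : Fintype (GaloisField 2 s) := Fintype.ofFinite _

end QAuth

end

open scoped Matrix Kronecker

noncomputable section

namespace QAuth

/-! ### Signs and characters -/

/-! Soundness. Expand each Kraus operator of the adversary in Pauli operators; trace preservation
says that the squared coefficients, over all Kraus operators, sum to 1. Squeeze a Pauli error
between encoding and decoding with the same syndrome. Outside `Q^⊥` it anticommutes with a generator
and gives 0; in `Q` it gives a scalar; only `Q^⊥ \ Q` can do harm (`Encoding.exists_compress_eq`). A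
scalar cannot move the message, so the probability of accepting a corrupted message is at most the
squared norm of the harmful part applied to it (`trace_one_sub_proj_mul_le`). The sum over the
one-time pad replaces the message by a multiple of the identity, and this norm becomes a
Hilbert-Schmidt norm (`sum_trace_pad_conj`). The sum over syndromes is controlled by the resolution
of the identity, and trace-orthogonality of the Pauli operators removes all cross terms
(`Encoding.sum_corrupt_le`). What remains is a sum of squared coefficients, each weighted by the
number of codes for which that one error is harmful, which purity testing bounds.

Circuits. Clifford gates act on Pauli labels by symplectic maps. Clearing one generator at a time,
as in Gaussian elimination, takes the generators to `±Z` on the last `s` wires with quadratically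
many gates (`reach_zVec`, `exists_clifford_of_le`). The inverse circuit encodes, and pad and
syndrome are set beforehand by NOT and phase gates. The receiver undoes this, shifts the expected
syndrome to `1⋯1`, computes the conjunction of the syndrome bits with Toffoli gates, and moves the
message to the output under control of that bit. The move must clear the original wires on
acceptance, for otherwise discarding them would decohere the message (`recvFun_discarded_eq_iff`).

The curve. `Tr(x y^(2^n))` is alternating because `x x^(2^n)` lies in the fixed field of `x ↦
x^(2^n)`, and nondegenerate because the trace form is; hence it is equivalent to the standard
symplectic form. Lines over `GF(2^s)` are isotropic since `s` divides `n`. The vectors whose whole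
line is orthogonal to a nonzero error form a proper `GF(2^s)`-subspace, contained in a hyperplane. A
hyperplane meets the finite part of the curve in the roots of a nonzero polynomial of degree at most
`2r - 1`, so at most `2r = 2n/s` of the `2^s + 1` codes miss the error. -/

@[simp] theorem sgn_zero : sgn 0 = 1 := by simp [sgn]

@[simp] theorem sgn_one : sgn 1 = -1 := by simp [sgn, ZMod.val_one]

theorem zmod_two_cases (c : ZMod 2) : c = 0 ∨ c = 1 := by
  revert c; decide

theorem sgn_add (a b : ZMod 2) : sgn (a + b) = sgn a * sgn b := by
  have h : (1 + 1 : ZMod 2) = 0 := by decide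
  rcases zmod_two_cases a with rfl | rfl <;> rcases zmod_two_cases b with rfl | rfl <;> simp [h]

theorem sgn_mul_self (a : ZMod 2) : sgn a * sgn a = 1 := by
  rcases zmod_two_cases a with rfl | rfl <;> simp

@[simp] theorem star_sgn (a : ZMod 2) : star (sgn a) = sgn a := by
  rcases zmod_two_cases a with rfl | rfl <;> simp

theorem sgn_ne_zero (a : ZMod 2) : sgn a ≠ 0 := by
  rcases zmod_two_cases a with rfl | rfl <;> simp

theorem sgn_injective {a b : ZMod 2} (h : sgn a = sgn b) : a = b := by
  rcases zmod_two_cases a with rfl | rfl <;> rcases zmod_two_cases b with rfl | rfl <;>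
    simp_all [eq_neg_iff_add_eq_zero, neg_eq_iff_add_eq_zero]

theorem neg_eq_self_zmod_two (a : ZMod 2) : -a = a := by
  revert a; decide

theorem add_self_zmod_two (a : ZMod 2) : a + a = 0 := by
  revert a; decide

theorem Qubits.add_self {n : ℕ} (a : Qubits n) : a + a = 0 :=
  funext fun i => add_self_zmod_two (a i)

theorem Qubits.neg_eq {n : ℕ} (a : Qubits n) : -a = a :=
  funext fun i => neg_eq_self_zmod_two (a i)

theorem Qubits.sub_eq {n : ℕ} (a b : Qubits n) : a - b = a + b := by
  rw [sub_eq_add_neg, Qubits.neg_eq]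

theorem Qubits.eq_add_iff {n : ℕ} (v u a : Qubits n) : v = u + a ↔ v + a = u := by
  rw [← Qubits.sub_eq v a, sub_eq_iff_eq_add]

theorem sum_sgn_dotProduct {n : ℕ} (d : Qubits n) :
    ∑ b : Qubits n, sgn (b ⬝ᵥ d) = if d = 0 then (2 : ℂ) ^ n else 0 := by
  split_ifs with h
  · subst h; simp [ZMod.card]
  · obtain ⟨i, hi⟩ := Function.ne_iff.mp h
    have hi1 : d i = 1 := (zmod_two_cases (d i)).resolve_left hi
    have key : ∑ b : Qubits n, sgn (b ⬝ᵥ d) = -∑ b : Qubits n, sgn (b ⬝ᵥ d) := by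
      rw [← Finset.sum_neg_distrib]
      -- Flipping a bit of `b` at which `d` is 1 changes every sign, so the sum equals its own
      -- negative.
      refine Fintype.sum_equiv (Equiv.addRight (Pi.single i 1 : Qubits n)) _ _ fun b => ?_
      simp [add_dotProduct, sgn_add, hi1]
    linear_combination (1 / 2 : ℂ) * key

/-! ### Pauli operators -/

theorem pauliX_apply {n : ℕ} (a v u : Qubits n) :
    pauliX a v u = if v = u + a then 1 else 0 := rfl

theorem pauliX_mul_apply {n : ℕ} {β : Type*} (a : Qubits n) (M : Matrix (Qubits n) β ℂ)
    (v : Qubits n) (u : β) : (pauliX a * M) v u = M (v + a) u := by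
  simp [Matrix.mul_apply, pauliX_apply, Qubits.eq_add_iff]

theorem mul_pauliX_apply {n : ℕ} {β : Type*} (a : Qubits n) (M : Matrix β (Qubits n) ℂ)
    (v : β) (u : Qubits n) : (M * pauliX a) v u = M v (u + a) := by
  simp [Matrix.mul_apply, pauliX_apply]

theorem pauliZ_mul_apply {n : ℕ} {β : Type*} (b : Qubits n) (M : Matrix (Qubits n) β ℂ)
    (v : Qubits n) (u : β) : (pauliZ b * M) v u = sgn (b ⬝ᵥ v) * M v u := by
  simp [pauliZ, Matrix.diagonal_mul]

theorem mul_pauliZ_apply {n : ℕ} {β : Type*} (b : Qubits n) (M : Matrix β (Qubits n) ℂ)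
    (v : β) (u : Qubits n) : (M * pauliZ b) v u = M v u * sgn (b ⬝ᵥ u) := by
  simp [pauliZ, Matrix.mul_diagonal]

@[simp] theorem pauliX_zero {n : ℕ} : pauliX (0 : Qubits n) = 1 := by
  ext v u; simp [pauliX_apply, Matrix.one_apply]

@[simp] theorem pauliZ_zero {n : ℕ} : pauliZ (0 : Qubits n) = 1 := by
  simp [pauliZ]

theorem pauliX_mul_pauliX {n : ℕ} (a b : Qubits n) :
    pauliX a * pauliX b = pauliX (a + b) := by
  ext v u
  rw [mul_pauliX_apply, pauliX_apply, pauliX_apply, add_assoc, add_comm b a]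

theorem pauliZ_mul_pauliZ {n : ℕ} (a b : Qubits n) :
    pauliZ a * pauliZ b = pauliZ (a + b) := by
  simp [pauliZ, Matrix.diagonal_mul_diagonal, add_dotProduct, sgn_add]

theorem pauliX_conjTranspose {n : ℕ} (a : Qubits n) : (pauliX a)ᴴ = pauliX a := by
  ext v u
  rw [Matrix.conjTranspose_apply, pauliX_apply, pauliX_apply]
  have : u = v + a ↔ v = u + a := by rw [Qubits.eq_add_iff, eq_comm]
  by_cases h : u = v + a
  · rw [if_pos h, if_pos (this.mp h), star_one]
  · rw [if_neg h, if_neg (mt this.mpr h), star_zero]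

theorem pauliZ_conjTranspose {n : ℕ} (b : Qubits n) : (pauliZ b)ᴴ = pauliZ b := by
  rw [pauliZ, Matrix.diagonal_conjTranspose]
  congr 1; ext u; simp

theorem pauliZ_mul_pauliX {n : ℕ} (a b : Qubits n) :
    pauliZ b * pauliX a = sgn (a ⬝ᵥ b) • (pauliX a * pauliZ b) := by
  ext v u
  rw [pauliZ_mul_apply, Matrix.smul_apply, mul_pauliZ_apply, pauliX_apply]
  split_ifs with h
  · rw [h, dotProduct_add, sgn_add, dotProduct_comm a b]; simp [mul_comm]
  · simp

theorem pauliXZ_mul {n : ℕ} (v w : PauliVec n) :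
    (pauliX v.1 * pauliZ v.2) * (pauliX w.1 * pauliZ w.2) =
      sgn (w.1 ⬝ᵥ v.2) • (pauliX (v + w).1 * pauliZ (v + w).2) := by
  rw [Matrix.mul_assoc, ← Matrix.mul_assoc (pauliZ v.2), pauliZ_mul_pauliX, Matrix.smul_mul,
    Matrix.mul_smul, Matrix.mul_assoc (pauliX w.1), pauliZ_mul_pauliZ, ← Matrix.mul_assoc,
    pauliX_mul_pauliX]
  rfl

/-- The phase of `pauli v`. -/
def pauliPhase {n : ℕ} (v : PauliVec n) : ℂ :=
  Complex.I ^ (Finset.univ.filter fun i => v.1 i = 1 ∧ v.2 i = 1).card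

theorem pauli_eq {n : ℕ} (v : PauliVec n) :
    pauli v = pauliPhase v • (pauliX v.1 * pauliZ v.2) := rfl

theorem pauliPhase_ne_zero {n : ℕ} (v : PauliVec n) : pauliPhase v ≠ 0 :=
  pow_ne_zero _ Complex.I_ne_zero

theorem dotProduct_eq_card {n : ℕ} (a b : Qubits n) :
    a ⬝ᵥ b = ((Finset.univ.filter fun i => a i = 1 ∧ b i = 1).card : ZMod 2) := by
  rw [Finset.card_filter, dotProduct]
  push_cast
  refine Finset.sum_congr rfl fun i _ => ?_
  rcases zmod_two_cases (a i) with h | h <;> rcases zmod_two_cases (b i) with h' | h' <;>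
    simp [h, h']

theorem sgn_natCast (k : ℕ) : sgn (k : ZMod 2) = (-1) ^ k := by
  rw [sgn, ZMod.val_natCast, neg_one_pow_eq_pow_mod_two k]

theorem pauliPhase_mul_self {n : ℕ} (v : PauliVec n) :
    pauliPhase v * pauliPhase v = sgn (v.1 ⬝ᵥ v.2) := by
  rw [dotProduct_eq_card, sgn_natCast, pauliPhase, ← mul_pow, Complex.I_mul_I]

theorem star_pauliPhase {n : ℕ} (v : PauliVec n) :
    star (pauliPhase v) = sgn (v.1 ⬝ᵥ v.2) * pauliPhase v := by
  rw [dotProduct_eq_card, sgn_natCast, pauliPhase, ← mul_pow, star_pow]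
  simp

theorem pauli_mul_self {n : ℕ} (v : PauliVec n) : pauli v * pauli v = 1 := by
  rw [pauli_eq, Matrix.smul_mul, Matrix.mul_smul, pauliXZ_mul, smul_smul, smul_smul,
    pauliPhase_mul_self, sgn_mul_self, one_smul, Prod.fst_add, Prod.snd_add, Qubits.add_self,
    Qubits.add_self, pauliX_zero, pauliZ_zero, mul_one]

theorem pauli_conjTranspose {n : ℕ} (v : PauliVec n) : (pauli v)ᴴ = pauli v := by
  rw [pauli_eq, Matrix.conjTranspose_smul, Matrix.conjTranspose_mul, pauliX_conjTranspose,
    pauliZ_conjTranspose, pauliZ_mul_pauliX, smul_smul, star_pauliPhase, mul_right_comm,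
    sgn_mul_self, one_mul]

theorem exists_pauli_mul_pauli {n : ℕ} (v w : PauliVec n) :
    ∃ c : ℂ, c ≠ 0 ∧ pauli v * pauli w = c • pauli (v + w) := by
  refine ⟨pauliPhase v * pauliPhase w * sgn (w.1 ⬝ᵥ v.2) / pauliPhase (v + w),
    div_ne_zero (mul_ne_zero (mul_ne_zero (pauliPhase_ne_zero v) (pauliPhase_ne_zero w))
      (sgn_ne_zero _)) (pauliPhase_ne_zero _), ?_⟩
  rw [pauli_eq, pauli_eq, pauli_eq, Matrix.smul_mul, Matrix.mul_smul, pauliXZ_mul, smul_smul,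
    smul_smul, smul_smul, div_mul_cancel₀ _ (pauliPhase_ne_zero _), mul_assoc]

/-- Both orders give the same operator `X^(a+a') Z^(b+b')`, with signs `w.1 ⬝ᵥ v.2` and `v.1 ⬝ᵥ
w.2`; their quotient is the symplectic sign. -/
theorem pauli_mul_comm {n : ℕ} (v w : PauliVec n) :
    pauli v * pauli w = sgn (sympl v w) • (pauli w * pauli v) := by
  rw [pauli_eq, pauli_eq, Matrix.smul_mul, Matrix.mul_smul, pauliXZ_mul, Matrix.smul_mul,
    Matrix.mul_smul, pauliXZ_mul, add_comm w v]
  simp only [smul_smul]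
  congr 1
  rw [sympl, sub_eq_add_neg, neg_eq_self_zmod_two, sgn_add]
  linear_combination -pauliPhase v * pauliPhase w * sgn (w.1 ⬝ᵥ v.2) * sgn_mul_self (v.1 ⬝ᵥ w.2)

@[simp] theorem pauli_zero {n : ℕ} : pauli (0 : PauliVec n) = 1 := by
  simp [pauli]

/-- A nontrivial `X`-part leaves no diagonal entries; otherwise the trace is a character sum. -/
theorem trace_pauli {n : ℕ} (v : PauliVec n) :
    (pauli v).trace = if v = 0 then (2 : ℂ) ^ n else 0 := by
  split_ifs with h
  · subst h; simp [ZMod.card]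
  · rw [pauli_eq, Matrix.trace_smul, smul_eq_mul, mul_eq_zero]
    right
    rw [Matrix.trace]
    simp only [Matrix.diag_apply, mul_pauliZ_apply, pauliX_apply]
    by_cases ha : v.1 = 0
    · have hb : v.2 ≠ 0 := fun hb => h (Prod.ext ha hb)
      simp only [ha, add_zero, if_true, one_mul, dotProduct_comm v.2, sum_sgn_dotProduct, hb,
        if_false]
    · simp [ha]

theorem trace_pauli_mul_pauli {n : ℕ} (v w : PauliVec n) :
    (pauli v * pauli w).trace = if v = w then (2 : ℂ) ^ n else 0 := by
  split_ifs with h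
  · subst h; rw [pauli_mul_self]; simp [ZMod.card]
  · obtain ⟨c, -, hc⟩ := exists_pauli_mul_pauli v w
    have : v + w ≠ 0 := by
      intro h0
      apply h
      have h1 := congrArg (· + w) h0
      simpa [add_assoc, Prod.ext_iff, Qubits.add_self] using h1
    rw [hc, Matrix.trace_smul, trace_pauli, if_neg this, smul_zero]

theorem trace_pauli_sum_mul_pauli_sum {n : ℕ} (c d : PauliVec n → ℂ) :
    ((∑ v, c v • pauli v)ᴴ * ∑ v, d v • pauli v).trace = 2 ^ n * ∑ v, star (c v) * d v := by
  rw [Matrix.conjTranspose_sum, Finset.sum_mul, Matrix.trace_sum, Finset.mul_sum]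
  refine Finset.sum_congr rfl fun v _ => ?_
  rw [Finset.mul_sum, Matrix.trace_sum, Finset.sum_eq_single v]
  · rw [Matrix.conjTranspose_smul, pauli_conjTranspose, Matrix.smul_mul, Matrix.mul_smul,
      pauli_mul_self]
    simp [ZMod.card]; ring
  · intro w _ hw
    rw [Matrix.conjTranspose_smul, pauli_conjTranspose, Matrix.smul_mul, Matrix.mul_smul,
      Matrix.trace_smul, Matrix.trace_smul, trace_pauli_mul_pauli, if_neg hw.symm]
    simp
  · simp

theorem linearIndependent_pauli (n : ℕ) :
    LinearIndependent ℂ (pauli : PauliVec n → Op (Qubits n)) := by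
  rw [Fintype.linearIndependent_iff]
  intro g hg v
  have h := congrArg (fun M => (pauli v * M).trace) hg
  simp only [Finset.mul_sum, Matrix.trace_sum, Matrix.mul_smul, Matrix.trace_smul,
    trace_pauli_mul_pauli, Matrix.mul_zero, Matrix.trace_zero] at h
  simpa using h

/-- The Pauli operators are trace-orthogonal, hence independent, and there are `4^n` of them in a
space of that dimension. -/
theorem exists_eq_sum_pauli {n : ℕ} (E : Op (Qubits n)) :
    ∃ c : PauliVec n → ℂ, E = ∑ v, c v • pauli v := by
  have h := (linearIndependent_pauli n).span_eq_top_of_card_eq_finrank'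
    (by simp [Module.finrank_matrix, ZMod.card])
  have hE : E ∈ Submodule.span ℂ (Set.range (pauli : PauliVec n → Op (Qubits n))) := by
    rw [h]; trivial
  obtain ⟨c, hc⟩ := (Submodule.mem_span_range_iff_exists_fun ℂ).mp hE
  exact ⟨c, hc.symm⟩

/-! ### The quantum one-time pad -/

theorem pad_conjTranspose {m : ℕ} (x : PauliVec m) : (pad x)ᴴ = pauliX x.1 * pauliZ x.2 := by
  rw [pad, Matrix.conjTranspose_mul, pauliX_conjTranspose, pauliZ_conjTranspose]

theorem pad_conjTranspose_mul_pad {m : ℕ} (x : PauliVec m) : (pad x)ᴴ * pad x = 1 := by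
  rw [pad_conjTranspose, pad, Matrix.mul_assoc, ← Matrix.mul_assoc (pauliZ _), pauliZ_mul_pauliZ,
    Qubits.add_self, pauliZ_zero, Matrix.one_mul, pauliX_mul_pauliX, Qubits.add_self, pauliX_zero]

theorem pad_mul_pad_conjTranspose {m : ℕ} (x : PauliVec m) : pad x * (pad x)ᴴ = 1 :=
  mul_eq_one_comm.mp (pad_conjTranspose_mul_pad x)

/-- Averaging over the one-time pad yields the completely mixed state. -/
theorem sum_pad_conj {m : ℕ} (ρ : Op (Qubits m)) :
    ∑ x, pad x * ρ * (pad x)ᴴ = ((2 : ℂ) ^ m * ρ.trace) • 1 := by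
  ext u v
  -- At a given entry, the sum over `b` is a character sum that kills everything off the diagonal,
  -- and the sum over `a` then collects the trace.
  have h : ∀ a b : Qubits m, (pad (a, b) * ρ * (pad (a, b))ᴴ) u v =
      sgn (b ⬝ᵥ (u + v)) * ρ (u + a) (v + a) := by
    intro a b
    rw [pad_conjTranspose, pad, ← Matrix.mul_assoc, mul_pauliZ_apply, mul_pauliX_apply,
      Matrix.mul_assoc, pauliZ_mul_apply, pauliX_mul_apply, dotProduct_add, sgn_add]
    ring
  rw [Matrix.sum_apply, Fintype.sum_prod_type]
  simp only [h, ← Finset.sum_mul, sum_sgn_dotProduct]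
  have huv : u + v = 0 ↔ u = v := by
    rw [← Qubits.sub_eq, sub_eq_zero]
  by_cases hu : u = v
  · subst hu
    simp only [Qubits.add_self, if_true, ← Finset.mul_sum, Matrix.smul_apply, Matrix.one_apply_eq,
      smul_eq_mul, mul_one]
    congr 1
    exact Fintype.sum_equiv (Equiv.addLeft u) _ _ fun a => rfl
  · simp [huv, hu]

/-! ### Encodings -/

theorem list_prod_mul_eq_smul {α β : Type*} [Fintype α] [DecidableEq α] (M : Matrix α β ℂ) :
    ∀ {s : ℕ} (f : Fin s → Op α) (c : Fin s → ℂ), (∀ i, f i * M = c i • M) →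
      (List.ofFn f).prod * M = (∏ i, c i) • M
  | 0, _, _, _ => by simp
  | s + 1, f, c, h => by
    rw [List.ofFn_succ, List.prod_cons, Matrix.mul_assoc,
      list_prod_mul_eq_smul M (fun i => f i.succ) (fun i => c i.succ) fun i => h i.succ,
      Matrix.mul_smul, h 0, smul_smul, Fin.prod_univ_succ, mul_comm]

theorem sympl_add_left {n : ℕ} (v v' w : PauliVec n) :
    sympl (v + v') w = sympl v w + sympl v' w := by
  simp only [sympl, Prod.fst_add, Prod.snd_add, add_dotProduct, dotProduct_add]; ring

theorem sympl_smul_left {n : ℕ} (c : ZMod 2) (v w : PauliVec n) :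
    sympl (c • v) w = c * sympl v w := by
  simp only [sympl, Prod.smul_fst, Prod.smul_snd, smul_dotProduct, dotProduct_smul, smul_eq_mul]
  ring

@[simp] theorem sympl_zero_left {n : ℕ} (w : PauliVec n) : sympl 0 w = 0 := by
  simp [sympl]

/-! ### Encodings resolve the identity; action of Pauli errors on them. -/

namespace StabilizerCode

variable {m s : ℕ}

theorem mem_perp_of_gen {Q : StabilizerCode m s} {x : PauliVec (m + s)}
    (h : ∀ i, sympl (Q.gen i) x = 0) : x ∈ Q.perp := by
  intro z hz
  induction hz using Submodule.span_induction with
  | mem z hz => obtain ⟨i, rfl⟩ := hz; exact h i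
  | zero => simp
  | add z z' _ _ hz hz' => rw [sympl_add_left, hz, hz', add_zero]
  | smul c z _ hz => rw [sympl_smul_left, hz, mul_zero]

namespace Encoding

variable {Q : StabilizerCode m s} (V : Q.Encoding)

theorem conjTranspose_V_mul_pauli (y : Qubits s) (i : Fin s) :
    (V.V y)ᴴ * pauli (Q.gen i) = sgn (y i) • (V.V y)ᴴ := by
  have h := congrArg Matrix.conjTranspose (V.syndrome y i)
  rwa [Matrix.conjTranspose_mul, Matrix.conjTranspose_smul, pauli_conjTranspose, star_sgn] at h

/-- These are eigenspaces of a self-adjoint generator for different eigenvalues. -/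
theorem orthogonal {y y' : Qubits s} (h : y ≠ y') : (V.V y)ᴴ * V.V y' = 0 := by
  obtain ⟨i, hi⟩ := Function.ne_iff.mp h
  have h1 : sgn (y i) • ((V.V y)ᴴ * V.V y') = sgn (y' i) • ((V.V y)ᴴ * V.V y') := by
    rw [← Matrix.smul_mul, ← V.conjTranspose_V_mul_pauli, Matrix.mul_assoc, V.syndrome,
      Matrix.mul_smul]
  rw [← sub_eq_zero, ← sub_smul, smul_eq_zero] at h1
  exact h1.resolve_left fun h2 => hi (sgn_injective (sub_eq_zero.mp h2))

/-- Placed side by side, the isometries form a square matrix, because `2^s * 2^m = 2^(m+s)`. A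
square isometry is unitary, so the encodings exhaust the syndrome spaces. -/
theorem sum_V_mul_conjTranspose : ∑ y, V.V y * (V.V y)ᴴ = 1 := by
  let W : Matrix (Qubits (m + s)) (Qubits s × Qubits m) ℂ := Matrix.of fun u p => V.V p.1 u p.2
  have h1 : Wᴴ * W = 1 := by
    ext ⟨y, a⟩ ⟨y', a'⟩
    have h2 : (Wᴴ * W) (y, a) (y', a') = ((V.V y)ᴴ * V.V y') a a' := rfl
    rw [h2]
    by_cases hy : y = y'
    · subst hy; simp [V.isometry, Matrix.one_apply]
    · simp [V.orthogonal hy, hy]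
  have e : Qubits s × Qubits m ≃ Qubits (m + s) :=
    Fintype.equivOfCardEq (by simp [ZMod.card, pow_add, mul_comm])
  have h2 : W * Wᴴ = 1 := (Matrix.mul_eq_one_comm_of_equiv e).mp h1
  rw [← h2]
  ext u v
  simp [Matrix.sum_apply, Matrix.mul_apply, Fintype.sum_prod_type, W]

theorem syndromeProj_mul_V (y' y : Qubits s) :
    Q.syndromeProj y' * V.V y = if y' = y then V.V y else 0 := by
  have h : ∀ i, ((1 / 2 : ℂ) • (1 + sgn (y' i) • pauli (Q.gen i))) * V.V y =
      (if y' i = y i then (1 : ℂ) else 0) • V.V y := by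
    intro i
    rw [Matrix.smul_mul, Matrix.add_mul, Matrix.one_mul, Matrix.smul_mul, V.syndrome, smul_smul]
    nth_rewrite 1 [← one_smul ℂ (V.V y)]
    rw [← add_smul, smul_smul]
    congr 1
    rcases zmod_two_cases (y' i) with h | h <;> rcases zmod_two_cases (y i) with h' | h' <;>
      norm_num [h, h']
  rw [syndromeProj, list_prod_mul_eq_smul _ _ _ h]
  split_ifs with hy
  · simp [hy]
  · obtain ⟨i, hi⟩ := Function.ne_iff.mp hy
    rw [Finset.prod_eq_zero (Finset.mem_univ i) (if_neg hi), zero_smul]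

/-- The product of spectral projectors acts as 0 or 1 on the range of each `V.V y'`, and these
ranges span. Idempotence, self-adjointness and completeness of the measurement all follow from this
form. -/
theorem syndromeProj_eq (y : Qubits s) : Q.syndromeProj y = V.V y * (V.V y)ᴴ := by
  rw [← Matrix.mul_one (Q.syndromeProj y), ← V.sum_V_mul_conjTranspose, Matrix.mul_sum,
    Finset.sum_eq_single y]
  · rw [← Matrix.mul_assoc, V.syndromeProj_mul_V, if_pos rfl]
  · intro y' _ hy'
    rw [← Matrix.mul_assoc, V.syndromeProj_mul_V, if_neg hy'.symm, Matrix.zero_mul]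
  · simp

theorem conjTranspose_syndromeProj (V : Q.Encoding) (y : Qubits s) :
    (Q.syndromeProj y)ᴴ = Q.syndromeProj y := by
  rw [V.syndromeProj_eq, Matrix.conjTranspose_mul, Matrix.conjTranspose_conjTranspose]

theorem syndromeProj_mul_self (V : Q.Encoding) (y : Qubits s) :
    Q.syndromeProj y * Q.syndromeProj y = Q.syndromeProj y := by
  nth_rewrite 2 [V.syndromeProj_eq]
  rw [← Matrix.mul_assoc, V.syndromeProj_mul_V, if_pos rfl, V.syndromeProj_eq]

theorem sum_syndromeProj (V : Q.Encoding) : ∑ y, Q.syndromeProj y = 1 := by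
  simp_rw [V.syndromeProj_eq, V.sum_V_mul_conjTranspose]

theorem conjTranspose_V_mul_syndromeProj (y : Qubits s) :
    (V.V y)ᴴ * Q.syndromeProj y = (V.V y)ᴴ := by
  rw [V.syndromeProj_eq, ← Matrix.mul_assoc, V.isometry, Matrix.one_mul]

theorem decode_measured (y : Qubits s) (σ : Op (Qubits (m + s))) :
    (V.V y)ᴴ * (Q.syndromeProj y * σ * Q.syndromeProj y) * V.V y = (V.V y)ᴴ * σ * V.V y := by
  rw [← Matrix.mul_assoc, ← Matrix.mul_assoc, V.conjTranspose_V_mul_syndromeProj,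
    Matrix.mul_assoc _ _ (V.V y), V.syndromeProj_mul_V, if_pos rfl]

/-- Elements of `Q` act on the space with syndrome `y` as scalars. -/
theorem exists_pauli_mul_V {v : PauliVec (m + s)} (hv : v ∈ Q.space) (y : Qubits s) :
    ∃ c : ℂ, pauli v * V.V y = c • V.V y := by
  induction hv using Submodule.span_induction with
  | mem z hz => obtain ⟨i, rfl⟩ := hz; exact ⟨_, V.syndrome y i⟩
  | zero => exact ⟨1, by simp⟩
  | add z z' _ _ hz hz' =>
    obtain ⟨c, hc⟩ := hz
    obtain ⟨c', hc'⟩ := hz'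
    obtain ⟨d, hd, h⟩ := exists_pauli_mul_pauli z z'
    refine ⟨d⁻¹ * c' * c, ?_⟩
    rw [← inv_smul_smul₀ hd (pauli (z + z')), ← h, Matrix.smul_mul, Matrix.mul_assoc, hc',
      Matrix.mul_smul, hc, smul_smul, smul_smul]
  | smul c z _ hz =>
    rcases zmod_two_cases c with rfl | rfl
    · exact ⟨1, by simp⟩
    · simpa using hz

/-- Errors outside `Q^⊥` change the syndrome. -/
theorem conjTranspose_V_mul_pauli_mul_V {v : PauliVec (m + s)} (hv : v ∉ Q.perp) (y : Qubits s) :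
    (V.V y)ᴴ * pauli v * V.V y = 0 := by
  obtain ⟨i, hi⟩ : ∃ i, sympl (Q.gen i) v ≠ 0 := by
    by_contra! h
    exact hv (mem_perp_of_gen h)
  have hi1 := (zmod_two_cases _).resolve_left hi
  have h1 : sgn (y i) • ((V.V y)ᴴ * pauli v * V.V y) =
      -(sgn (y i) • ((V.V y)ᴴ * pauli v * V.V y)) := by
    -- The generator is absorbed on the left, or carried through the anticommuting error and
    -- absorbed on the right; the results differ by a sign.
    calc sgn (y i) • ((V.V y)ᴴ * pauli v * V.V y)
        = (V.V y)ᴴ * (pauli (Q.gen i) * pauli v) * V.V y := by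
          rw [← Matrix.mul_assoc, V.conjTranspose_V_mul_pauli, Matrix.smul_mul, Matrix.smul_mul]
      _ = -((V.V y)ᴴ * pauli v * (pauli (Q.gen i) * V.V y)) := by
          rw [pauli_mul_comm, hi1]
          simp [Matrix.mul_assoc]
      _ = _ := by rw [V.syndrome, Matrix.mul_smul]
  have h2 : (2 * sgn (y i)) • ((V.V y)ᴴ * pauli v * V.V y) = 0 := by
    rw [two_mul, add_smul]
    nth_rewrite 1 [h1]
    exact neg_add_cancel _
  exact (smul_eq_zero.mp h2).resolve_left (mul_ne_zero two_ne_zero (sgn_ne_zero _))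

end Encoding

end StabilizerCode

/-! ### The maps of the protocol are superoperators -/

theorem IsSuperoperator.of_fintype {α β ι : Type*} [Fintype α] [DecidableEq α] [Fintype β]
    [Fintype ι] {Φ : Op α → Op β} (E : ι → Matrix β α ℂ) (h1 : ∑ j, (E j)ᴴ * E j = 1)
    (h2 : ∀ ρ, Φ ρ = ∑ j, E j * ρ * (E j)ᴴ) : IsSuperoperator Φ := by
  let e := Fintype.equivFin ι
  refine ⟨Fintype.card ι, fun j => E (e.symm j), ?_, fun ρ => ?_⟩
  · rw [← h1]; exact e.symm.sum_comp fun j => (E j)ᴴ * E j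
  · rw [h2]; exact (e.symm.sum_comp fun j => E j * ρ * (E j)ᴴ).symm

/-- The operator `M ⊗ |χ⟩`. -/
def tensorVec {α β : Type*} (M : Matrix β α ℂ) (χ : ZMod 2 → ℂ) : Matrix (β × ZMod 2) α ℂ :=
  Matrix.of fun p u => M p.1 u * χ p.2

theorem tensorVec_conj {α β : Type*} [Fintype α] (M : Matrix β α ℂ) (χ : ZMod 2 → ℂ)
    (ρ : Op α) : tensorVec M χ * ρ * (tensorVec M χ)ᴴ = (M * ρ * Mᴴ) ⊗ₖ proj χ := by
  ext ⟨p, c⟩ ⟨q, d⟩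
  simp only [Matrix.mul_apply, tensorVec, Matrix.of_apply, Matrix.conjTranspose_apply,
    Matrix.kroneckerMap_apply, proj, Matrix.vecMulVec_apply, Finset.sum_mul, star_mul', Pi.star_apply]
  refine Finset.sum_congr rfl fun u _ => Finset.sum_congr rfl fun v _ => ?_
  ring

theorem tensorVec_conjTranspose_mul {α β : Type*} [Fintype α] [Fintype β] (M : Matrix β α ℂ)
    (c : ZMod 2) : (tensorVec M (Pi.single c 1))ᴴ * tensorVec M (Pi.single c 1) = Mᴴ * M := by
  ext u v
  simp only [Matrix.mul_apply, tensorVec, Matrix.of_apply, Matrix.conjTranspose_apply,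
    Fintype.sum_prod_type]
  refine Finset.sum_congr rfl fun p _ => ?_
  rw [Finset.sum_eq_single c] <;> simp +contextual

/-- The operators `|b⟩⟨row u|` are Kraus operators for projecting with `P` and then replacing the
state by `|b⟩`; they give the rejecting branch. -/
theorem sum_row_conj {α β : Type*} [Fintype α] [DecidableEq β] (b : β) (P ρ : Op α) :
    ∑ u, Matrix.vecMulVec (Pi.single b 1) (P.row u) * ρ * (Matrix.vecMulVec (Pi.single b 1) (P.row u))ᴴ =
      (P * ρ * Pᴴ).trace • proj (Pi.single b (1 : ℂ)) := by
  ext p q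
  simp only [Matrix.trace, Matrix.sum_apply, Matrix.smul_apply, Matrix.diag_apply, smul_eq_mul,
    Finset.sum_mul]
  refine Finset.sum_congr rfl fun u _ => ?_
  simp only [Matrix.mul_apply, Matrix.conjTranspose_apply, proj, Matrix.vecMulVec_apply,
    Finset.sum_mul, star_mul', Pi.star_apply, Matrix.row_apply]
  refine Finset.sum_congr rfl fun u _ => Finset.sum_congr rfl fun v _ => ?_
  ring

theorem sum_row_conjTranspose_mul {α β : Type*} [Fintype α] [Fintype β] [DecidableEq β] (b : β)
    (P : Op α) :
    ∑ u, (Matrix.vecMulVec (Pi.single b (1 : ℂ)) (P.row u))ᴴ * Matrix.vecMulVec (Pi.single b 1) (P.row u) =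
      Pᴴ * P := by
  ext p q
  simp only [Matrix.sum_apply, Matrix.mul_apply, Matrix.conjTranspose_apply,
    Matrix.vecMulVec_apply, Matrix.row_apply]
  refine Finset.sum_congr rfl fun u _ => ?_
  rw [Finset.sum_eq_single b] <;> simp +contextual

theorem protocol_isPhysical {K : Type*} {m s : ℕ} (Q : K → StabilizerCode m s)
    (V : ∀ k, (Q k).Encoding) : (protocol Q V).IsPhysical := by
  rintro ⟨k, x, y⟩
  constructor
  · refine IsSuperoperator.of_fintype (ι := Unit) (fun _ => (V k).V y * pad x) ?_ fun ρ => ?_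
    · rw [Fintype.sum_unique, Matrix.conjTranspose_mul, Matrix.mul_assoc,
        ← Matrix.mul_assoc _ _ (pad x), (V k).isometry, Matrix.one_mul, pad_conjTranspose_mul_pad]
    · simp [protocol, Matrix.conjTranspose_mul, Matrix.mul_assoc]
  -- One Kraus operator for acceptance; for rejection one for each wrong syndrome and each row of
  -- its projector. Their squares add up to the sum of all syndrome projectors.
  · refine IsSuperoperator.of_fintype
      (ι := Unit ⊕ ({y' // y' ∈ Finset.univ.erase y} × Qubits (m + s)))
      (Sum.elim (fun _ => tensorVec ((pad x)ᴴ * ((V k).V y)ᴴ) acc)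
        fun p => tensorVec (Matrix.vecMulVec (Pi.single 0 1)
          (((Q k).syndromeProj p.1).row p.2)) rej) ?_ fun σ => ?_
    · rw [Fintype.sum_sum_type, Fintype.sum_unique, Fintype.sum_prod_type]
      simp only [Sum.elim_inl, Sum.elim_inr, acc, rej, tensorVec_conjTranspose_mul,
        sum_row_conjTranspose_mul, Matrix.conjTranspose_mul, Matrix.conjTranspose_conjTranspose]
      rw [Matrix.mul_assoc, ← Matrix.mul_assoc (pad x), pad_mul_pad_conjTranspose, Matrix.one_mul,
        ← (V k).syndromeProj_eq]
      simp only [(V k).conjTranspose_syndromeProj, (V k).syndromeProj_mul_self]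
      rw [Finset.sum_coe_sort (Finset.univ.erase y) fun y' => (Q k).syndromeProj y',
        Finset.add_sum_erase _ _ (Finset.mem_univ y), (V k).sum_syndromeProj]
    · rw [Fintype.sum_sum_type, Fintype.sum_unique, Fintype.sum_prod_type]
      simp only [Sum.elim_inl, Sum.elim_inr, tensorVec_conj]
      have h : ∀ y', ∑ u, (Matrix.vecMulVec (Pi.single (0 : Qubits m) 1)
            (((Q k).syndromeProj y').row u) * σ * (Matrix.vecMulVec (Pi.single 0 1)
            (((Q k).syndromeProj y').row u))ᴴ) ⊗ₖ proj rej =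
          ((Q k).syndromeProj y' * σ * (Q k).syndromeProj y').trace •
            (proj (Pi.single (0 : Qubits m) 1) ⊗ₖ proj rej) := by
        intro y'
        have h' := sum_row_conj (0 : Qubits m) ((Q k).syndromeProj y') σ
        rw [(V k).conjTranspose_syndromeProj y'] at h'
        rw [← Matrix.smul_kronecker, ← h']
        ext p q
        simp [Matrix.sum_apply, Finset.sum_mul]
      simp only [h]
      rw [Finset.sum_coe_sort (Finset.univ.erase y) fun y' =>
        ((Q k).syndromeProj y' * σ * (Q k).syndromeProj y').trace •
            (proj (Pi.single (0 : Qubits m) 1) ⊗ₖ proj rej), ← Finset.sum_smul]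
      simp only [protocol]
      congr 2
      rw [(V k).decode_measured]
      simp only [Matrix.conjTranspose_mul, Matrix.conjTranspose_conjTranspose, Matrix.mul_assoc]

/-! ### Security of the protocol -/

theorem proj_conjTranspose {α : Type*} (ψ : α → ℂ) : (proj ψ)ᴴ = proj ψ := by
  ext u v; simp [proj, Matrix.vecMulVec_apply, mul_comm]

theorem proj_mul_proj {α : Type*} [Fintype α] {ψ : α → ℂ} (h : IsPureState ψ) :
    proj ψ * proj ψ = proj ψ := by
  have h1 : star ψ ⬝ᵥ ψ = 1 := by
    rw [IsPureState] at h
    have h2 := congrArg (fun x : ℝ => (x : ℂ)) h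
    push_cast at h2
    rw [← h2, dotProduct]
    exact Finset.sum_congr rfl fun a _ => by simp [Complex.conj_mul']
  rw [proj, Matrix.vecMulVec_mul_vecMulVec, h1, one_smul]

theorem trace_proj {α : Type*} [Fintype α] {ψ : α → ℂ} (h : IsPureState ψ) :
    (proj ψ).trace = 1 := by
  rw [IsPureState] at h
  have h2 := congrArg (fun x : ℝ => (x : ℂ)) h
  push_cast at h2
  rw [← h2, Matrix.trace]
  exact Finset.sum_congr rfl fun a _ => by simp [proj, Matrix.vecMulVec_apply, Complex.mul_conj']

theorem isPureState_single {α : Type*} [Fintype α] [DecidableEq α] (a : α) :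
    IsPureState (Pi.single a (1 : ℂ)) := by
  rw [IsPureState, Finset.sum_eq_single a] <;> simp +contextual

theorem trace_mul_conjTranspose_nonneg {α β : Type*} [Fintype α] [Fintype β]
    (M : Matrix α β ℂ) : 0 ≤ (M * Mᴴ).trace.re := by
  have h : ∀ z : ℂ, (z * star z).re = ‖z‖ ^ 2 := fun z => by
    rw [← starRingEnd_apply, Complex.mul_conj']; norm_cast
  simp only [Matrix.trace, Matrix.diag_apply, Matrix.mul_apply, Matrix.conjTranspose_apply,
    Complex.re_sum, h]
  positivity

/-- Conditioning on a projector does not increase the trace. -/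
theorem trace_mul_proj_mul_le {α β : Type*} [Fintype α] [Fintype β] [DecidableEq β]
    (M : Matrix α β ℂ) {P : Op β} (h1 : Pᴴ = P) (h2 : P * P = P) :
    (M * P * Mᴴ).trace.re ≤ (M * Mᴴ).trace.re := by
  have h := trace_mul_conjTranspose_nonneg (M * (1 - P))
  have h3 : (1 - P) * (1 - P) = 1 - P := by
    rw [mul_sub, sub_mul, sub_mul, h2]; simp
  rw [Matrix.conjTranspose_mul, Matrix.conjTranspose_sub, h1, Matrix.conjTranspose_one,
    Matrix.mul_assoc, ← Matrix.mul_assoc (1 - P), h3, Matrix.sub_mul, Matrix.mul_sub,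
    Matrix.one_mul, Matrix.trace_sub, Complex.sub_re] at h
  rw [Matrix.mul_assoc]
  linarith

/-- The probability that an operator `Y` moves the state `R` out of itself depends only on `Y` up
to a multiple of the identity, and is bounded by the norm of the result. -/
theorem trace_one_sub_proj_mul_le {α : Type*} [Fintype α] [DecidableEq α] {R : Op α}
    (h1 : Rᴴ = R) (h2 : R * R = R) (T : Op α) (c : ℂ) :
    ((1 - R) * ((c • 1 + T) * R * (c • 1 + T)ᴴ)).trace.re ≤ (T * R * Tᴴ).trace.re := by
  have h3 : (1 - R) * (1 - R) = 1 - R := by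
    rw [mul_sub, sub_mul, sub_mul, h2]; simp
  have h3' : (1 - R) * R = 0 := by rw [sub_mul, h2, one_mul, sub_self]
  have h4 : ∀ Y : Op α, ((1 - R) * (Y * R * Yᴴ)).trace =
      (((1 - R) * Y * R) * ((1 - R) * Y * R)ᴴ).trace := by
    intro Y
    have h5 : ∀ X, R * (R * X) = R * X := fun X => by rw [← Matrix.mul_assoc, h2]
    rw [Matrix.trace_mul_comm (1 - R)]
    simp only [Matrix.conjTranspose_mul, Matrix.conjTranspose_sub, h1, Matrix.conjTranspose_one,
      Matrix.mul_assoc, h5]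
    rw [Matrix.trace_mul_comm (1 - R)]
    simp only [Matrix.mul_assoc, h3]
  -- The multiple of the identity disappears because `(1 - R) * R = 0`.
  have h5 : (1 - R) * (c • 1 + T) * R = (1 - R) * T * R := by
    rw [Matrix.mul_add, Matrix.add_mul, Matrix.mul_smul, Matrix.mul_one, Matrix.smul_mul, h3',
      smul_zero, zero_add]
  rw [h4, h5, ← h4, Matrix.sub_mul, Matrix.one_mul, Matrix.trace_sub, Complex.sub_re]
  -- The part of `T` that stays inside `R` has nonnegative weight and is dropped.
  have h6 := trace_mul_conjTranspose_nonneg (R * T * R)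
  have h7 : ∀ X, R * (R * X) = R * X := fun X => by rw [← Matrix.mul_assoc, h2]
  simp only [Matrix.conjTranspose_mul, h1, Matrix.mul_assoc, h7] at h6
  rw [Matrix.trace_mul_comm R] at h6
  simp only [Matrix.mul_assoc, h2] at h6
  rw [Matrix.trace_mul_comm R]
  simp only [Matrix.mul_assoc]
  linarith

/-- By cyclicity the pad can be transferred from `T` to `R`, where summing over it gives a multiple
of the identity. -/
theorem sum_trace_pad_conj {m : ℕ} (T R : Op (Qubits m)) :
    ∑ x, (((pad x)ᴴ * T * pad x) * R * ((pad x)ᴴ * T * pad x)ᴴ).trace =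
      2 ^ m * R.trace * (T * Tᴴ).trace := by
  have h : ∀ x, (((pad x)ᴴ * T * pad x) * R * ((pad x)ᴴ * T * pad x)ᴴ).trace =
      (T * (pad x * R * (pad x)ᴴ) * Tᴴ).trace := by
    intro x
    simp only [Matrix.conjTranspose_mul, Matrix.conjTranspose_conjTranspose, Matrix.mul_assoc]
    rw [Matrix.trace_mul_comm]
    simp only [Matrix.mul_assoc, pad_mul_pad_conjTranspose, Matrix.mul_one]
  simp_rw [h]
  rw [← Matrix.trace_sum, ← Finset.sum_mul, ← Finset.mul_sum, sum_pad_conj, Matrix.mul_smul,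
    Matrix.mul_one, Matrix.smul_mul, Matrix.trace_smul, smul_eq_mul]

/-! ### Harmful Pauli components of an attack. -/

namespace StabilizerCode

variable {m s : ℕ}

/-- The component of an operator given by its Pauli coefficients that consists of the undetected
errors which act on the code nontrivially. -/
def undetected (Q : StabilizerCode m s) (c : PauliVec (m + s) → ℂ) (v : PauliVec (m + s)) : ℂ :=
  open scoped Classical in if v ∈ Q.perp ∧ v ∉ Q.space then c v else 0

/-- Errors in `Q` are scalars on each syndrome space and errors outside `Q^⊥` compress to 0, so
everything except `undetected` contributes only to `α`. -/
theorem Encoding.exists_compress_eq {Q : StabilizerCode m s} (V : Q.Encoding) (y : Qubits s)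
    (c : PauliVec (m + s) → ℂ) :
    ∃ α : ℂ, (V.V y)ᴴ * (∑ v, c v • pauli v) * V.V y =
      α • 1 + (V.V y)ᴴ * (∑ v, Q.undetected c v • pauli v) * V.V y := by
  classical
  have h : ∀ v, ∃ β : ℂ, (V.V y)ᴴ * ((c v - Q.undetected c v) • pauli v) * V.V y =
      β • (1 : Op (Qubits m)) := by
    intro v
    rw [undetected]
    split_ifs with hv
    · exact ⟨0, by simp⟩
    · by_cases hp : v ∈ Q.perp
      · have hs : v ∈ Q.space := by
          by_contra hs; exact hv ⟨hp, hs⟩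
        obtain ⟨d, hd⟩ := V.exists_pauli_mul_V hs y
        refine ⟨c v * d, ?_⟩
        rw [sub_zero, Matrix.mul_smul, Matrix.smul_mul, Matrix.mul_assoc, hd, Matrix.mul_smul,
          V.isometry, smul_smul]
      · refine ⟨0, ?_⟩
        rw [sub_zero, Matrix.mul_smul, Matrix.smul_mul, V.conjTranspose_V_mul_pauli_mul_V hp]
        simp
  choose β hβ using h
  refine ⟨∑ v, β v, ?_⟩
  rw [← sub_eq_iff_eq_add, ← Matrix.sub_mul, ← Matrix.mul_sub, ← Finset.sum_sub_distrib,
    Finset.sum_smul, Matrix.mul_sum, Matrix.sum_mul]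
  exact Finset.sum_congr rfl fun v _ => by rw [← sub_smul, hβ]

/-- Each compression contains the code projector twice: the inner copy is dropped at the cost of an
inequality, the outer copies sum to the identity. -/
theorem Encoding.sum_trace_compress_le {Q : StabilizerCode m s} (V : Q.Encoding)
    (D : Op (Qubits (m + s))) :
    ∑ y, (((V.V y)ᴴ * D * V.V y) * ((V.V y)ᴴ * D * V.V y)ᴴ).trace.re ≤ (Dᴴ * D).trace.re := by
  have h : ∀ y, (((V.V y)ᴴ * D * V.V y) * ((V.V y)ᴴ * D * V.V y)ᴴ).trace.re ≤
      (Dᴴ * (V.V y * (V.V y)ᴴ) * D).trace.re := by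
    intro y
    have h1 := trace_mul_proj_mul_le ((V.V y)ᴴ * D) (V.conjTranspose_syndromeProj y)
      (V.syndromeProj_mul_self y)
    rw [V.syndromeProj_eq] at h1
    simp only [Matrix.conjTranspose_mul, Matrix.conjTranspose_conjTranspose] at h1 ⊢
    rw [Matrix.trace_mul_comm ((V.V y)ᴴ * D)] at h1
    simp only [Matrix.mul_assoc] at h1 ⊢
    exact h1
  refine (Finset.sum_le_sum fun y _ => h y).trans_eq ?_
  rw [← Complex.re_sum, ← Matrix.trace_sum, ← Finset.sum_mul, ← Finset.mul_sum,
    V.sum_V_mul_conjTranspose, Matrix.mul_one]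

/-- The probability that an error operator corrupts the message undetectably, summed over all
one-time pads and syndromes. -/
theorem Encoding.sum_corrupt_le {Q : StabilizerCode m s} (V : Q.Encoding)
    {ψ : Qubits m → ℂ} (hψ : IsPureState ψ) (c : PauliVec (m + s) → ℂ) :
    ∑ x, ∑ y, ((1 - proj ψ) *
      (((pad x)ᴴ * ((V.V y)ᴴ * (∑ v, c v • pauli v) * V.V y) * pad x) * proj ψ *
        ((pad x)ᴴ * ((V.V y)ᴴ * (∑ v, c v • pauli v) * V.V y) * pad x)ᴴ)).trace.re ≤
      2 ^ m * (2 ^ (m + s) * ∑ v, ‖Q.undetected c v‖ ^ 2) := by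
  set D := ∑ v, Q.undetected c v • pauli v with hD
  have h : ∀ x y, ((1 - proj ψ) *
      (((pad x)ᴴ * ((V.V y)ᴴ * (∑ v, c v • pauli v) * V.V y) * pad x) * proj ψ *
        ((pad x)ᴴ * ((V.V y)ᴴ * (∑ v, c v • pauli v) * V.V y) * pad x)ᴴ)).trace.re ≤
      (((pad x)ᴴ * ((V.V y)ᴴ * D * V.V y) * pad x) * proj ψ *
        ((pad x)ᴴ * ((V.V y)ᴴ * D * V.V y) * pad x)ᴴ).trace.re := by
    intro x y
    obtain ⟨α, hα⟩ := V.exists_compress_eq y c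
    -- The scalar part commutes with the pad and so remains a scalar after decryption.
    have h1 : (pad x)ᴴ * ((V.V y)ᴴ * (∑ v, c v • pauli v) * V.V y) * pad x =
        α • 1 + (pad x)ᴴ * ((V.V y)ᴴ * D * V.V y) * pad x := by
      rw [hα, Matrix.mul_add, Matrix.add_mul, Matrix.mul_smul, Matrix.smul_mul, Matrix.mul_one,
        pad_conjTranspose_mul_pad]
    rw [h1]
    exact trace_one_sub_proj_mul_le (proj_conjTranspose ψ) (proj_mul_proj hψ) _ _
  refine (Finset.sum_le_sum fun x _ => Finset.sum_le_sum fun y _ => h x y).trans ?_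
  rw [Finset.sum_comm]
  have h2 : ∀ y, ∑ x, (((pad x)ᴴ * ((V.V y)ᴴ * D * V.V y) * pad x) * proj ψ *
        ((pad x)ᴴ * ((V.V y)ᴴ * D * V.V y) * pad x)ᴴ).trace.re =
      2 ^ m * (((V.V y)ᴴ * D * V.V y) * ((V.V y)ᴴ * D * V.V y)ᴴ).trace.re := by
    intro y
    rw [← Complex.re_sum, sum_trace_pad_conj, trace_proj hψ, mul_one]
    have : (2 : ℂ) ^ m = ((2 ^ m : ℝ) : ℂ) := by push_cast; rfl
    rw [this, Complex.re_ofReal_mul]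
  simp_rw [h2]
  rw [← Finset.mul_sum]
  refine mul_le_mul_of_nonneg_left ((V.sum_trace_compress_le D).trans_eq ?_) (by positivity)
  rw [hD, trace_pauli_sum_mul_pauli_sum]
  have h3 : ∀ v, star (Q.undetected c v) * Q.undetected c v =
      ((‖Q.undetected c v‖ ^ 2 : ℝ) : ℂ) := by
    intro v
    rw [← starRingEnd_apply, Complex.conj_mul']; push_cast; rfl
  simp_rw [h3]
  rw [← Complex.ofReal_sum]
  have : (2 : ℂ) ^ (m + s) = ((2 ^ (m + s) : ℝ) : ℂ) := by push_cast; rfl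
  rw [this, ← Complex.ofReal_mul, Complex.ofReal_re]

end StabilizerCode

theorem IsSuperoperator.trace_eq {α β : Type*} [Fintype α] [DecidableEq α] [Fintype β]
    {Φ : Op α → Op β} (h : IsSuperoperator Φ) (ρ : Op α) : (Φ ρ).trace = ρ.trace := by
  obtain ⟨N, E, h1, h2⟩ := h
  rw [h2, Matrix.trace_sum]
  simp_rw [Matrix.mul_assoc, Matrix.trace_mul_comm (E _), Matrix.mul_assoc]
  rw [← Matrix.trace_sum, ← Finset.mul_sum, h1, Matrix.mul_one]

/-- The complement of the test is the single bad event: acceptance with a state orthogonal to `ψ`.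
Soundness needs only a bound on it. -/
theorem testProj_eq {m : ℕ} (ψ : Qubits m → ℂ) :
    Scheme.testProj ψ = 1 - (1 - proj ψ) ⊗ₖ proj acc := by
  have h : proj acc + proj rej = 1 := by
    ext i j
    rcases zmod_two_cases i with rfl | rfl <;> rcases zmod_two_cases j with rfl | rfl <;>
      simp [proj, acc, rej, Matrix.vecMulVec_apply]
  rw [Scheme.testProj, ← h]
  ext ⟨p, i⟩ ⟨q, j⟩
  have h1 : (1 : Op (Qubits m × ZMod 2)) (p, i) (q, j) =
      (1 : Op (Qubits m)) p q * (proj acc + proj rej) i j := by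
    rw [h, ← Matrix.one_kronecker_one]; rfl
  simp only [Matrix.add_apply, Matrix.sub_apply, Matrix.kroneckerMap_apply, h1]
  ring

/-! ### Completeness, soundness and key length of the protocol. -/

section

variable {K : Type*} {m s : ℕ} (Q : K → StabilizerCode m s) (V : ∀ k, (Q k).Encoding)

theorem protocol_complete (ψ : Qubits m → ℂ) (κ : ProtocolKey K m s) :
    (protocol Q V).B κ ((protocol Q V).A κ (proj ψ)) = proj ψ ⊗ₖ proj acc := by
  obtain ⟨k, x, y⟩ := κ
  have h : ∀ y' ∈ Finset.univ.erase y, ((Q k).syndromeProj y' *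
      ((V k).V y * (pad x * proj ψ * (pad x)ᴴ) * ((V k).V y)ᴴ) * (Q k).syndromeProj y').trace =
        0 := by
    intro y' hy'
    rw [← Matrix.mul_assoc, ← Matrix.mul_assoc, (V k).syndromeProj_mul_V,
      if_neg (Finset.ne_of_mem_erase hy')]
    simp
  simp only [protocol]
  rw [Finset.sum_eq_zero h, zero_smul, add_zero, (V k).decode_measured]
  congr 1
  simp only [Matrix.mul_assoc, (V k).isometry, Matrix.mul_one]
  rw [← Matrix.mul_assoc _ ((V k).V y), (V k).isometry, Matrix.one_mul]
  simp only [pad_conjTranspose_mul_pad, Matrix.mul_one]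
  rw [← Matrix.mul_assoc, pad_conjTranspose_mul_pad, Matrix.one_mul]

theorem trace_testProj_mul_B {ψ : Qubits m → ℂ} (σ : Op (Qubits (m + s)))
    (k : K) (x : PauliVec m) (y : Qubits s) :
    (Scheme.testProj ψ * (protocol Q V).B (k, x, y) σ).trace =
      σ.trace - ((1 - proj ψ) * ((pad x)ᴴ * (((V k).V y)ᴴ * σ * (V k).V y) * pad x)).trace := by
  rw [testProj_eq, Matrix.sub_mul, Matrix.one_mul, Matrix.trace_sub,
    ((protocol_isPhysical Q V) (k, x, y)).2.trace_eq]
  congr 1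
  have h1 : proj acc * proj rej = 0 := by
    have h3 : star acc ⬝ᵥ rej = 0 := by simp [acc, rej]
    rw [proj, proj, Matrix.vecMulVec_mul_vecMulVec, h3, zero_smul, Matrix.vecMulVec_zero]
  have h2 : proj acc * proj acc = proj acc := proj_mul_proj (isPureState_single 1)
  simp only [protocol]
  rw [(V k).decode_measured, Matrix.mul_add, Matrix.mul_smul, ← Matrix.mul_kronecker_mul,
    ← Matrix.mul_kronecker_mul, h1, h2, Matrix.kronecker_zero, smul_zero, add_zero,
    Matrix.trace_kronecker, acc, trace_proj (isPureState_single 1), mul_one]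

theorem protocol_isSecure [Fintype K] [Nonempty K] {ε : ℝ} (hε : 0 ≤ ε)
    (hQ : IsPurityTestingCode Q ε) : (protocol Q V).IsSecure ε := by
  classical
  intro ψ hψ
  refine ⟨protocol_complete Q V ψ, fun O hO => ?_⟩
  obtain ⟨N, E, hE1, hE2⟩ := id hO
  choose c hc using fun j => exists_eq_sum_pauli (E j)
  -- Take traces in the trace-preservation identity: both sides carry the factor `2^(m+s)`, and
  -- orthogonality leaves no cross terms.
  have hcsum : ∑ j, ∑ v, ‖c j v‖ ^ 2 = 1 := by
    have h1 := congrArg Matrix.trace hE1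
    rw [Matrix.trace_sum] at h1
    simp_rw [hc, trace_pauli_sum_mul_pauli_sum] at h1
    have h3 : ∀ j v, star (c j v) * c j v = ((‖c j v‖ ^ 2 : ℝ) : ℂ) := by
      intro j v
      rw [← starRingEnd_apply, Complex.conj_mul']; push_cast; rfl
    simp_rw [h3] at h1
    rw [← Finset.mul_sum] at h1
    simp only [Matrix.trace_one, Fintype.card_pi, ZMod.card, Finset.prod_const, Finset.card_univ,
      Fintype.card_fin, Nat.cast_pow, Nat.cast_ofNat] at h1
    have h4 := mul_left_cancel₀ (pow_ne_zero _ two_ne_zero) (h1.trans (mul_one _).symm)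
    exact_mod_cast h4
  have key : ∑ κ : ProtocolKey K m s, ((1 - proj ψ) * ((pad κ.2.1)ᴴ *
      (((V κ.1).V κ.2.2)ᴴ * O ((protocol Q V).A κ (proj ψ)) * (V κ.1).V κ.2.2) *
        pad κ.2.1)).trace.re ≤ ε * Fintype.card (ProtocolKey K m s) := by
    have h1 : ∀ κ : ProtocolKey K m s, ((1 - proj ψ) * ((pad κ.2.1)ᴴ *
        (((V κ.1).V κ.2.2)ᴴ * O ((protocol Q V).A κ (proj ψ)) * (V κ.1).V κ.2.2) *
          pad κ.2.1)).trace.re = ∑ j, ((1 - proj ψ) *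
        (((pad κ.2.1)ᴴ * (((V κ.1).V κ.2.2)ᴴ * E j * (V κ.1).V κ.2.2) * pad κ.2.1) * proj ψ *
        ((pad κ.2.1)ᴴ * (((V κ.1).V κ.2.2)ᴴ * E j * (V κ.1).V κ.2.2) * pad κ.2.1)ᴴ)).trace.re := by
      rintro ⟨k, x, y⟩
      simp only [protocol, hE2]
      rw [← Complex.re_sum, ← Matrix.trace_sum, ← Finset.mul_sum]
      simp only [Matrix.mul_sum, Matrix.sum_mul, Matrix.conjTranspose_mul,
        Matrix.conjTranspose_conjTranspose, Matrix.mul_assoc]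
    simp_rw [h1]
    rw [Finset.sum_comm]
    have h2 : ∀ j, ∑ κ : ProtocolKey K m s, ((1 - proj ψ) *
        (((pad κ.2.1)ᴴ * (((V κ.1).V κ.2.2)ᴴ * E j * (V κ.1).V κ.2.2) * pad κ.2.1) * proj ψ *
        ((pad κ.2.1)ᴴ * (((V κ.1).V κ.2.2)ᴴ * E j * (V κ.1).V κ.2.2) * pad κ.2.1)ᴴ)).trace.re ≤
        2 ^ m * (2 ^ (m + s) * ∑ v, (ε * Fintype.card K) * ‖c j v‖ ^ 2) := by
      intro j
      rw [Fintype.sum_prod_type]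
      calc _ ≤ ∑ k, 2 ^ m * (2 ^ (m + s) * ∑ v, ‖(Q k).undetected (c j) v‖ ^ 2) := by
            refine Finset.sum_le_sum fun k _ => ?_
            rw [Fintype.sum_prod_type, hc j]
            exact (V k).sum_corrupt_le hψ (c j)
        -- With the order exchanged, each error `v` is faced with all codes at once, which is what
        -- purity testing controls.
        _ = 2 ^ m * (2 ^ (m + s) * ∑ v, ∑ k, ‖(Q k).undetected (c j) v‖ ^ 2) := by
            rw [← Finset.mul_sum, ← Finset.mul_sum, Finset.sum_comm]
        _ ≤ _ := by
            refine mul_le_mul_of_nonneg_left (mul_le_mul_of_nonneg_left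
              (Finset.sum_le_sum fun v _ => ?_) (by positivity)) (by positivity)
            have h3 : ∀ k, ‖(Q k).undetected (c j) v‖ ^ 2 =
                (if v ∈ (Q k).perp ∧ v ∉ (Q k).space then 1 else 0) * ‖c j v‖ ^ 2 := by
              intro k
              rw [StabilizerCode.undetected]
              split_ifs <;> simp
            simp_rw [h3]
            rw [← Finset.sum_mul]
            refine mul_le_mul_of_nonneg_right ?_ (by positivity)
            rw [Finset.sum_boole]
            -- Purity testing says nothing about the trivial error, but that error lies in every `Q`
            -- and is never counted.
            by_cases hv : v = 0
            · have : Finset.univ.filter (fun k => v ∈ (Q k).perp ∧ v ∉ (Q k).space) = ∅ := by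
                refine Finset.filter_eq_empty_iff.mpr fun k _ h => h.2 ?_
                rw [hv]; exact zero_mem _
              rw [this]
              simp only [Finset.card_empty, Nat.cast_zero]
              positivity
            · refine le_trans (le_of_eq ?_) (hQ v hv)
              rw [Set.ncard_eq_toFinset_card']
              congr 2
              ext k; simp
    refine (Finset.sum_le_sum fun j _ => h2 j).trans_eq ?_
    simp_rw [← Finset.mul_sum]
    rw [hcsum]
    simp only [Fintype.card_prod, Fintype.card_pi, ZMod.card, Finset.prod_const, Finset.card_univ,
      Fintype.card_fin]
    push_cast
    rw [pow_add]; ring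
  have hcard : (0 : ℝ) < Fintype.card (ProtocolKey K m s) := by
    exact_mod_cast Fintype.card_pos
  have htr : ∀ κ, (O ((protocol Q V).A κ (proj ψ))).trace = 1 := fun κ => by
    rw [hO.trace_eq, (protocol_isPhysical Q V κ).1.trace_eq, trace_proj hψ]
  have h5 : (Scheme.testProj ψ * (protocol Q V).rhoBob O ψ).trace =
      ((1 / Fintype.card (ProtocolKey K m s) : ℝ) : ℂ) * ∑ κ : ProtocolKey K m s,
        (1 - ((1 - proj ψ) * ((pad κ.2.1)ᴴ * (((V κ.1).V κ.2.2)ᴴ *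
          O ((protocol Q V).A κ (proj ψ)) * (V κ.1).V κ.2.2) * pad κ.2.1)).trace) := by
    rw [Scheme.rhoBob, Matrix.mul_smul, Matrix.trace_smul, Finset.mul_sum, Matrix.trace_sum]
    push_cast
    rw [smul_eq_mul]
    congr 1
    refine Finset.sum_congr rfl fun κ _ => ?_
    obtain ⟨k, x, y⟩ := κ
    rw [trace_testProj_mul_B, htr]
  rw [h5, Complex.re_ofReal_mul, Complex.re_sum]
  simp only [Complex.sub_re, Complex.one_re, Finset.sum_sub_distrib]
  rw [Finset.sum_const, Finset.card_univ, nsmul_eq_mul, mul_one, one_div, inv_mul_eq_div,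
    le_div_iff₀ hcard]
  linarith

theorem protocol_keyLength [Fintype K] [Nonempty K] :
    (protocol Q V).keyLength = 2 * m + s + Real.logb 2 (Fintype.card K) := by
  have h : (Fintype.card (ProtocolKey K m s) : ℝ) = Fintype.card K * 2 ^ (2 * m + s) := by
    simp only [Fintype.card_prod, Fintype.card_pi, ZMod.card, Finset.prod_const, Finset.card_univ,
      Fintype.card_fin]
    push_cast
    ring
  rw [Scheme.keyLength, h, Real.logb_mul (by positivity) (by positivity), Real.logb_pow,
    Real.logb_self_eq_one one_lt_two]
  push_cast; ring

end

/-! ### Symplectic bases -/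

theorem eq_zero_of_sympl_eq_zero {n : ℕ} {p : PauliVec n} (h : ∀ q, sympl p q = 0) : p = 0 := by
  refine Prod.ext (funext fun i => ?_) (funext fun i => ?_)
  · have := h (0, Pi.single i 1)
    simpa [sympl] using this
  · have := h (Pi.single i 1, 0)
    simpa [sympl] using this

theorem exists_sympl_eq {n : ℕ} (f : PauliVec n →ₗ[ZMod 2] ZMod 2) :
    ∃ p, ∀ q, sympl p q = f q := by
  refine ⟨(fun i => f (0, fun j => if i = j then 1 else 0),
    fun i => f (fun j => if i = j then 1 else 0, 0)), fun q => ?_⟩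
  have h : f q = f.comp (LinearMap.inl _ _ _) q.1 + f.comp (LinearMap.inr _ _ _) q.2 := by
    rw [LinearMap.comp_apply, LinearMap.comp_apply, ← map_add]
    congr 1; simp
  rw [h, LinearMap.pi_apply_eq_sum_univ, LinearMap.pi_apply_eq_sum_univ _ q.2, sympl,
    sub_eq_add_neg, neg_eq_self_zmod_two]
  simp [dotProduct, mul_comm]

section

variable {W : Type*} [AddCommGroup W] [Module (ZMod 2) W]
  (B : W →ₗ[ZMod 2] W →ₗ[ZMod 2] ZMod 2)

theorem alternating_comm (halt : ∀ x, B x x = 0) (x y : W) : B x y = B y x := by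
  have h := halt (x + y)
  simp only [map_add, LinearMap.add_apply, halt, zero_add, add_zero] at h
  rw [← neg_eq_self_zmod_two (B y x), eq_neg_iff_add_eq_zero, add_comm, h]

theorem injective_of_isometry {k : ℕ} {ψ : PauliVec k →ₗ[ZMod 2] W}
    (hψ : ∀ p q, B (ψ p) (ψ q) = sympl p q) : Function.Injective ψ := by
  refine (injective_iff_map_eq_zero ψ).mpr fun p hp => eq_zero_of_sympl_eq_zero fun q => ?_
  rw [← hψ, hp, map_zero, LinearMap.zero_apply]

/-- A symplectic basis is built one hyperbolic pair at a time, each pair taken orthogonal to the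
image constructed so far. -/
theorem exists_isometry [FiniteDimensional (ZMod 2) W] (halt : ∀ x, B x x = 0) (hnd : ∀ x, (∀ y, B x y = 0) → x = 0) {n : ℕ}
    (hn : Module.finrank (ZMod 2) W = 2 * n) : ∀ k ≤ n, ∃ ψ : PauliVec k →ₗ[ZMod 2] W,
      ∀ p q, B (ψ p) (ψ q) = sympl p q
  | 0, _ => ⟨0, fun p q => by simp [sympl]⟩
  | k + 1, hk => by
    obtain ⟨ψ, hψ⟩ := exists_isometry halt hnd hn k (by omega)
    -- Orthogonal projection onto the image exists because the form on it is the standard,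
    -- nondegenerate one.
    have hproj : ∀ v : W, ∃ p, ∀ q, B (v - ψ p) (ψ q) = 0 := by
      intro v
      obtain ⟨p, hp⟩ := exists_sympl_eq ((B v).comp ψ)
      refine ⟨p, fun q => ?_⟩
      rw [map_sub, LinearMap.sub_apply, hψ, hp, LinearMap.comp_apply, sub_self]
    obtain ⟨v, hv⟩ : ∃ v, v ∉ LinearMap.range ψ := by
      by_contra! h
      have h1 := LinearMap.finrank_range_of_inj (injective_of_isometry B hψ)
      rw [Submodule.eq_top_iff'.mpr h, finrank_top, hn, Module.finrank_prod,
        Module.finrank_fin_fun] at h1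
      omega
    obtain ⟨p, hp⟩ := hproj v
    set e := v - ψ p with he
    have he0 : e ≠ 0 := fun h => hv ⟨p, (sub_eq_zero.mp h).symm⟩
    obtain ⟨w, hw⟩ : ∃ w, B e w ≠ 0 := by
      by_contra! h
      exact he0 (hnd e h)
    obtain ⟨q, hq⟩ := hproj w
    set f := w - ψ q with hf
    -- Correcting `w` by an element of the image does not affect its pairing with `e`, which is
    -- orthogonal to the image.
    have hef : B e f = 1 := by
      rw [hf, map_sub, hp, sub_zero]
      exact (zmod_two_cases _).resolve_left hw
    have hfe : B f e = 1 := by rw [alternating_comm B halt, hef]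
    have hp' : ∀ q, B (ψ q) e = 0 := fun q => by rw [alternating_comm B halt, hp]
    have hq' : ∀ p, B (ψ p) f = 0 := fun p => by rw [alternating_comm B halt, hq]
    let ψ' : PauliVec (k + 1) →ₗ[ZMod 2] W :=
      { toFun := fun p => ψ (fun i => p.1 i.succ, fun i => p.2 i.succ) + (p.1 0 • e + p.2 0 • f)
        map_add' := fun p q => by
          have : ((fun i => (p + q).1 i.succ, fun i => (p + q).2 i.succ) : PauliVec k) =
            (fun i => p.1 i.succ, fun i => p.2 i.succ) +
              (fun i => q.1 i.succ, fun i => q.2 i.succ) := rfl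
          rw [this, map_add, Prod.fst_add, Prod.snd_add, Pi.add_apply, Pi.add_apply, add_smul,
            add_smul]
          abel
        map_smul' := fun c p => by
          have : ((fun i => (c • p).1 i.succ, fun i => (c • p).2 i.succ) : PauliVec k) =
            c • (fun i => p.1 i.succ, fun i => p.2 i.succ) := rfl
          rw [this, map_smul, Prod.smul_fst, Prod.smul_snd, Pi.smul_apply, Pi.smul_apply,
            smul_assoc, smul_assoc, RingHom.id_apply, smul_add, smul_add] }
    refine ⟨ψ', fun p q => ?_⟩
    have h1 : ∀ p, ψ' p =
      ψ (fun i => p.1 i.succ, fun i => p.2 i.succ) + (p.1 0 • e + p.2 0 • f) := fun _ => rfl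
    rw [h1, h1]
    simp only [map_add, LinearMap.add_apply, map_smul, LinearMap.smul_apply, hψ, hp, hq, hp', hq',
      hef, hfe, halt, sympl, dotProduct, Fin.sum_univ_succ, smul_eq_mul, sub_eq_add_neg,
      neg_eq_self_zmod_two]
    ring

theorem exists_symplectic_equiv [FiniteDimensional (ZMod 2) W] (halt : ∀ x, B x x = 0)
    (hnd : ∀ x, (∀ y, B x y = 0) → x = 0) {n : ℕ} (hn : Module.finrank (ZMod 2) W = 2 * n) :
    ∃ φ : W ≃ₗ[ZMod 2] PauliVec n, ∀ x y, sympl (φ x) (φ y) = B x y := by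
  obtain ⟨ψ, hψ⟩ := exists_isometry B halt hnd hn n le_rfl
  let e := LinearEquiv.ofInjectiveOfFinrankEq ψ (injective_of_isometry B hψ) (by
    rw [hn, Module.finrank_prod, Module.finrank_fin_fun]; omega)
  refine ⟨e.symm, fun x y => ?_⟩
  have h : ∀ x, ψ (e.symm x) = x := e.apply_symm_apply
  rw [← hψ, h, h]

end

/-! ### The trace form -/

section

variable {n : ℕ}

/-- The trace is a sum of `2 * n` Frobenius conjugates; the last `n` repeat the first `n`, and they
cancel in characteristic 2. -/
theorem trace_eq_zero_of_pow_eq (hn : n ≠ 0) {z : GaloisField 2 (2 * n)} (hz : z ^ 2 ^ n = z) :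
    Algebra.trace (ZMod 2) (GaloisField 2 (2 * n)) z = 0 := by
  apply (algebraMap (ZMod 2) (GaloisField 2 (2 * n))).injective
  rw [FiniteField.algebraMap_trace_eq_sum_pow, map_zero,
    GaloisField.finrank 2 (by omega : 2 * n ≠ 0), Nat.card_zmod,
    show Finset.range (2 * n) = Finset.range (n + n) by rw [two_mul], Finset.sum_range_add]
  simp_rw [pow_add, pow_mul, hz]
  exact CharTwo.add_self_eq_zero _

/-- The form `Tr (x y^(2^n))`. -/
def traceForm (n : ℕ) : GaloisField 2 (2 * n) →ₗ[ZMod 2] GaloisField 2 (2 * n) →ₗ[ZMod 2] ZMod 2 :=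
  (Algebra.traceForm (ZMod 2) (GaloisField 2 (2 * n))).compl₂
    ((iterateFrobenius (GaloisField 2 (2 * n)) 2 n).toAddMonoidHom.toZModLinearMap 2)

theorem traceForm_apply (x y : GaloisField 2 (2 * n)) :
    traceForm n x y = Algebra.trace (ZMod 2) _ (x * y ^ 2 ^ n) := rfl

theorem pow_pow_two_pow (hn : n ≠ 0) (x : GaloisField 2 (2 * n)) : (x ^ 2 ^ n) ^ 2 ^ n = x := by
  rw [← pow_mul, ← pow_add, ← two_mul, ← GaloisField.card 2 (2 * n) (by omega)]
  let := galoisFieldFintype (2 * n)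
  rw [Nat.card_eq_fintype_card, FiniteField.pow_card]

theorem pow_two_pow_norm (hn : n ≠ 0) (x : GaloisField 2 (2 * n)) :
    (x * x ^ 2 ^ n) ^ 2 ^ n = x * x ^ 2 ^ n := by
  rw [mul_pow, pow_pow_two_pow hn, mul_comm x]

theorem exists_trace_mul_ne_zero {y : GaloisField 2 (2 * n)} (hy : y ≠ 0) :
    ∃ x, Algebra.trace (ZMod 2) _ (x * y) ≠ 0 := by
  have : Algebra.IsSeparable (ZMod 2) (GaloisField 2 (2 * n)) :=
    Algebra.IsAlgebraic.isSeparable_of_perfectField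
  by_contra! h
  exact hy ((traceForm_nondegenerate (ZMod 2) (GaloisField 2 (2 * n))).1 y fun x => by
    rw [Algebra.traceForm_apply, mul_comm y, h])

/-- The form is alternating since `x * x ^ 2 ^ n` is fixed by the `n`-th Frobenius power, and
nondegenerate since this power is an involution, hence onto. -/
theorem exists_traceForm_equiv (hn : n ≠ 0) :
    ∃ φ : GaloisField 2 (2 * n) ≃ₗ[ZMod 2] PauliVec n, ∀ x y, sympl (φ x) (φ y) =
      Algebra.trace (ZMod 2) (GaloisField 2 (2 * n)) (x * y ^ 2 ^ n) := by
  refine exists_symplectic_equiv (traceForm n)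
    (fun x => trace_eq_zero_of_pow_eq hn (pow_two_pow_norm hn x)) (fun x h => ?_)
    (GaloisField.finrank 2 (by omega))
  by_contra hx
  obtain ⟨y, hy⟩ := exists_trace_mul_ne_zero hx
  apply hy
  rw [mul_comm y x, ← pow_pow_two_pow hn y]
  exact h _

end

/-! ### The codes given by the normal rational curve -/

section

variable {m s r : ℕ}

theorem card_galoisField (hs : s ≠ 0) : Fintype.card (GaloisField 2 s) = 2 ^ s := by
  rw [← Nat.card_eq_fintype_card, GaloisField.card 2 s hs]

theorem curvePoint_ne_zero {F : Type*} [Field F] (hr : 0 < r) (k : Option F) :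
    curvePoint r k ≠ 0 := by
  cases k with
  | some t => exact fun h => by simpa [curvePoint] using congrFun h ⟨0, by omega⟩
  | none =>
    intro h
    have := congrFun h ⟨2 * r - 1, by omega⟩
    simp only [curvePoint, Pi.zero_apply] at this
    rw [if_pos (by omega)] at this
    exact one_ne_zero this

/-- The product is `c * d` times `v * v ^ 2 ^ n` with `n = m + s`. Since `s` divides `n`, scalars of
`GF(2^s)` are fixed by the `2^n`-th power, and so is the whole product. -/
theorem trace_line_eq_zero (hs : 0 < s) (h : m + s = r * s)
    [Algebra (GaloisField 2 s) (GaloisField 2 (2 * (m + s)))] (v : GaloisField 2 (2 * (m + s)))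
    (c d : GaloisField 2 s) :
    Algebra.trace (ZMod 2) (GaloisField 2 (2 * (m + s))) (c • v * (d • v) ^ 2 ^ (m + s)) = 0 := by
  have hd : ∀ d : GaloisField 2 s, d ^ 2 ^ (m + s) = d := fun d => by
    have := FiniteField.pow_card_pow r d
    rwa [card_galoisField hs.ne', ← pow_mul, mul_comm s r, ← h] at this
  refine trace_eq_zero_of_pow_eq (by omega) ?_
  rw [smul_pow, hd, smul_mul_smul_comm, smul_pow, hd, pow_two_pow_norm (by omega)]

theorem exists_normalRationalCurveCode (hs : 0 < s) (h : m + s = r * s) :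
    ∃ Q : Option (GaloisField 2 s) → StabilizerCode m s, IsNormalRationalCurveCode r Q := by
  have hr : 0 < r := Nat.pos_of_ne_zero fun h0 => by subst h0; omega
  have hf1 := GaloisField.finrank 2 hs.ne'
  have hf2 := GaloisField.finrank 2 (n := 2 * (m + s)) (by omega)
  obtain ⟨f⟩ := FiniteField.nonempty_algHom_of_finrank_dvd (F := ZMod 2) (K := GaloisField 2 s)
    (L := GaloisField 2 (2 * (m + s))) (by rw [hf1, hf2, h]; exact ⟨2 * r, by ring⟩)
  let : Algebra (GaloisField 2 s) (GaloisField 2 (2 * (m + s))) := f.toRingHom.toAlgebra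
  have : IsScalarTower (ZMod 2) (GaloisField 2 s) (GaloisField 2 (2 * (m + s))) :=
    IsScalarTower.of_algebraMap_eq fun x => (f.commutes x).symm
  have hfr : Module.finrank (GaloisField 2 s) (GaloisField 2 (2 * (m + s))) = 2 * r := by
    have h1 := Module.finrank_mul_finrank (ZMod 2) (GaloisField 2 s) (GaloisField 2 (2 * (m + s)))
    rw [hf1, hf2] at h1
    exact Nat.eq_of_mul_eq_mul_left hs (h1.trans (by rw [h]; ring))
  let ω := (Module.finBasisOfFinrankEq (GaloisField 2 s) (GaloisField 2 (2 * (m + s))) hfr)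
  obtain ⟨φ, hφ⟩ := exists_traceForm_equiv (n := m + s) (by omega)
  let b := Module.finBasisOfFinrankEq (ZMod 2) (GaloisField 2 s) hf1
  let v : Option (GaloisField 2 s) → GaloisField 2 (2 * (m + s)) :=
    fun k => ∑ i, curvePoint r k i • ω i
  have hv : ∀ k, v k ≠ 0 := fun k h0 => curvePoint_ne_zero hr k <| funext fun i =>
    Fintype.linearIndependent_iff.mp ω.linearIndependent _ h0 i
  let line : Option (GaloisField 2 s) → GaloisField 2 s →ₗ[ZMod 2] PauliVec (m + s) := fun k =>
    φ.toLinearMap.comp ((LinearMap.toSpanSingleton (GaloisField 2 s) _ (v k)).restrictScalars _)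
  have hline : ∀ k c, line k c = φ (c • v k) := fun _ _ => rfl
  refine ⟨fun k => ⟨fun i => line k (b i), ?_, fun i j => ?_⟩, inferInstance, ω, φ, hφ, fun k => ?_⟩
  · refine b.linearIndependent.map' (line k) (LinearMap.ker_eq_bot.mpr fun c d hcd => ?_)
    rw [hline, hline] at hcd
    exact smul_left_injective _ (hv k) (φ.injective hcd)
  · rw [hline, hline, hφ, trace_line_eq_zero hs h]
  · have h1 : Set.range (fun i => line k (b i)) = line k '' Set.range b := Set.range_comp _ _
    rw [StabilizerCode.space, h1, Submodule.span_image, b.span_eq, Submodule.map_top]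
    rfl

/-- Codes whose line is orthogonal to the error correspond to points of the curve in a proper
subspace. A hyperplane containing it gives a polynomial in the curve parameter, and root counting
finishes. -/
theorem isPurityTestingCode_of_isNormalRationalCurveCode (hs : 0 < s) (h : m + s = r * s)
    {Q : Option (GaloisField 2 s) → StabilizerCode m s} (hQ : IsNormalRationalCurveCode r Q) :
    IsPurityTestingCode Q (2 * ((m + s : ℕ) : ℝ) / (s * (2 ^ s + 1))) := by
  classical
  have hr : 0 < r := Nat.pos_of_ne_zero fun h0 => by subst h0; omega
  obtain ⟨_, ω, φ, hφ, hspace⟩ := hQ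
  intro x hx
  obtain ⟨x, rfl⟩ := φ.surjective x
  have hx0 : x ^ 2 ^ (m + s) ≠ 0 := pow_ne_zero _ fun h0 => hx (by rw [h0, map_zero])
  -- Orthogonality of the entire line, not just of `v`, makes this a `GF(2^s)`-subspace although the
  -- form takes values in `Z_2`.
  let H : Submodule (GaloisField 2 s) (GaloisField 2 (2 * (m + s))) :=
    { carrier := {v | ∀ c : GaloisField 2 s, Algebra.trace (ZMod 2)
        (GaloisField 2 (2 * (m + s))) (c • v * x ^ 2 ^ (m + s)) = 0}
      add_mem' := fun {u v} hu hv c => by rw [smul_add, add_mul, map_add, hu, hv, add_zero]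
      zero_mem' := fun c => by rw [smul_zero, zero_mul, map_zero]
      smul_mem' := fun d v hv c => by rw [smul_smul]; exact hv _ }
  obtain ⟨w, hw⟩ := exists_trace_mul_ne_zero hx0
  have hwH : w ∉ H := fun hwH => hw (by simpa using hwH 1)
  obtain ⟨f, hfw, hfH⟩ := Submodule.exists_le_ker_of_notMem hwH
  -- Its value at `t` is `f` at the affine point with parameter `t`; its coefficients are the values
  -- of `f` on the basis, so it is nonzero.
  let p : Polynomial (GaloisField 2 s) :=
    ∑ i : Fin (2 * r), Polynomial.C (f (ω i)) * Polynomial.X ^ (i : ℕ)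
  have hp0 : p ≠ 0 := by
    intro h0
    apply hfw
    have h1 : f = 0 := ω.ext fun i => by
      have h2 := congrArg (Polynomial.coeff · (i : ℕ)) h0
      simpa [p, Polynomial.finsetSum_coeff, Polynomial.coeff_C_mul, Polynomial.coeff_X_pow,
        Fin.val_inj] using h2
    rw [h1, LinearMap.zero_apply]
  have hdeg : p.natDegree ≤ 2 * r - 1 := by
    refine Polynomial.natDegree_sum_le_of_forall_le _ _ fun i _ => ?_
    exact (Polynomial.natDegree_C_mul_X_pow_le _ _).trans (by omega)
  have hsub : {k | φ x ∈ (Q k).perp ∧ φ x ∉ (Q k).space} ⊆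
      insert none (some '' (p.roots.toFinset : Set (GaloisField 2 s))) := by
    rintro k ⟨hk, -⟩
    cases k with
    | none => exact Set.mem_insert _ _
    | some t =>
      refine Set.mem_insert_of_mem _ ⟨t, ?_, rfl⟩
      have h1 : ∑ i, curvePoint r (some t) i • ω i ∈ H := fun c => by
        rw [← hφ]
        refine hk _ ?_
        have h2 : φ (c • ∑ i, curvePoint r (some t) i • ω i) ∈
            ((Q (some t)).space : Set (PauliVec (m + s))) := by
          rw [hspace]; exact ⟨c, rfl⟩
        exact h2
      have h2 := LinearMap.mem_ker.mp (hfH h1)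
      simp only [Finset.mem_coe, Multiset.mem_toFinset, Polynomial.mem_roots hp0,
        Polynomial.IsRoot.def, p, Polynomial.eval_finsetSum, Polynomial.eval_mul,
        Polynomial.eval_C, Polynomial.eval_pow, Polynomial.eval_X]
      rw [← h2, map_sum]
      exact Finset.sum_congr rfl fun i _ => by rw [map_smul, smul_eq_mul, mul_comm]; rfl
  have hcard : ({k | φ x ∈ (Q k).perp ∧ φ x ∉ (Q k).space} : Set _).ncard ≤ 2 * r := by
    refine (Set.ncard_le_ncard hsub (Set.toFinite _)).trans ((Set.ncard_insert_le _ _).trans ?_)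
    rw [Set.ncard_image_of_injective _ (Option.some_injective _), Set.ncard_coe_finset]
    have := (Multiset.toFinset_card_le p.roots).trans (p.card_roots'.trans hdeg)
    -- At most `2 * r - 1` roots, plus the point at infinity, which is always counted.
    omega
  refine (Nat.cast_le.mpr hcard).trans (le_of_eq ?_)
  have hs0 : (s : ℝ) ≠ 0 := by exact_mod_cast hs.ne'
  rw [Fintype.card_option, card_galoisField hs.ne', h]
  push_cast
  field_simp

end

/-! ### Matrices of functions between basis states -/

/-- The operator `|u⟩ ↦ |f u⟩`. -/
def funMat {α β : Type*} [DecidableEq β] (f : α → β) : Matrix β α ℂ :=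
  Matrix.of fun v u => if v = f u then 1 else 0

section

variable {α β γ : Type*} [DecidableEq β]

theorem funMat_apply (f : α → β) (v : β) (u : α) : funMat f v u = if v = f u then 1 else 0 := rfl

theorem mul_funMat_apply [Fintype β] (M : Matrix γ β ℂ) (f : α → β) (v : γ) (u : α) :
    (M * funMat f) v u = M v (f u) := by
  simp [Matrix.mul_apply, funMat_apply]

theorem funMat_mul_funMat [Fintype β] [DecidableEq γ] (f : β → γ) (g : α → β) :
    funMat f * funMat g = funMat (f ∘ g) := by
  ext v u
  rw [mul_funMat_apply]; rfl

theorem funMat_id [DecidableEq α] : funMat (id : α → α) = 1 := by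
  ext v u; simp [funMat_apply, Matrix.one_apply]

theorem conjTranspose_funMat_mul_apply [Fintype β] (f : α → β) (M : Matrix β γ ℂ) (v : α) (u : γ) :
    ((funMat f)ᴴ * M) v u = M (f v) u := by
  simp [Matrix.mul_apply, funMat_apply, Matrix.conjTranspose_apply]

theorem funMat_conjTranspose_of_involutive [DecidableEq α] {f : α → α} (h : Function.Involutive f) :
    (funMat f)ᴴ = funMat f := by
  ext v u
  rw [Matrix.conjTranspose_apply, funMat_apply, funMat_apply]
  have h1 : u = f v ↔ v = f u := ⟨fun e => by rw [e, h], fun e => by rw [e, h]⟩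
  by_cases e : u = f v
  · rw [if_pos e, if_pos (h1.mp e), star_one]
  · rw [if_neg e, if_neg (mt h1.mpr e), star_zero]

theorem funMat_conj_apply [Fintype α] (f : α → β) (M : Op α) (u v : β) :
    (funMat f * M * (funMat f)ᴴ) u v = ∑ a, ∑ b, if u = f a ∧ v = f b then M a b else 0 := by
  simp only [Matrix.mul_apply, funMat_apply, Matrix.conjTranspose_apply, Finset.sum_mul]
  rw [Finset.sum_comm]
  refine Finset.sum_congr rfl fun a _ => Finset.sum_congr rfl fun b _ => ?_
  by_cases h1 : u = f a <;> by_cases h2 : v = f b <;> simp [h1, h2]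

end

theorem pauliX_eq_funMat {n : ℕ} (a : Qubits n) : pauliX a = funMat fun u => u + a := rfl

theorem diagonal_mul_funMat {α β : Type*} [Fintype α] [Fintype β] [DecidableEq α] [DecidableEq β]
    {f : α → β} {d : β → ℂ} {d' : α → ℂ} (h : ∀ u, d (f u) = d' u) :
    Matrix.diagonal d * funMat f = funMat f * Matrix.diagonal d' := by
  ext v u
  rw [Matrix.diagonal_mul, Matrix.mul_diagonal, funMat_apply]
  split_ifs with hv
  · rw [hv, h, mul_comm]
  · simp

/-! ### Gates -/

section

variable {w : ℕ}

theorem update_involutive {i : Fin w} {g : Qubits w → ZMod 2}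
    (hg : ∀ u x, g (Function.update u i x) = g u) :
    Function.Involutive fun u : Qubits w => Function.update u i (u i + g u) := by
  intro u
  simp only [hg, Function.update_self, Function.update_idem, add_assoc, add_self_zmod_two,
    add_zero, Function.update_eq_self]

theorem not_mat (i : Fin w) :
    (Gate.not i).mat = funMat fun u => Function.update u i (u i + 1) := rfl

theorem cnot_mat (i j : Fin w) (h : i ≠ j) :
    (Gate.cnot i j h).mat = funMat fun u => Function.update u j (u j + u i) := rfl

theorem toffoli_mat (i j l : Fin w) (hij : i ≠ j) (hil : i ≠ l) (hjl : j ≠ l) :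
    (Gate.toffoli i j l hij hil hjl).mat =
      funMat fun u => Function.update u l (u l + u i * u j) := rfl

theorem update_eq_add_single (u : Qubits w) (i : Fin w) (x : ZMod 2) :
    Function.update u i (u i + x) = u + Pi.single i x := by
  ext k
  by_cases hk : k = i
  · subst hk; simp
  · simp [hk]

theorem not_mat_eq_pauliX (i : Fin w) : (Gate.not i).mat = pauliX (Pi.single i 1) := by
  rw [not_mat, pauliX_eq_funMat]
  simp_rw [update_eq_add_single]

/-- The Hadamard gate is `(X + Z)/√2`; in this form its properties reduce to the Pauli relations. -/
theorem had_mat (i : Fin w) : (Gate.had i).mat =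
    (1 / (Real.sqrt 2 : ℂ)) • (pauliX (Pi.single i 1) + pauliZ (Pi.single i 1)) := by
  ext v u
  simp only [Gate.mat, Matrix.of_apply, Matrix.smul_apply, Matrix.add_apply, smul_eq_mul,
    pauliX_apply, pauliZ, Matrix.diagonal_apply, single_one_dotProduct]
  have hne : u ≠ u + Pi.single i 1 := fun h => by
    have := congrFun h i
    simp at this
  by_cases h : ∀ j, j ≠ i → v j = u j
  · rw [if_pos h]
    have hv : v = Function.update u i (u i + (v i + u i)) := by
      ext k
      by_cases hk : k = i
      · subst hk
        rw [Function.update_self, add_comm (v k), ← add_assoc, add_self_zmod_two, zero_add]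
      · rw [Function.update_of_ne hk, h k hk]
    rw [update_eq_add_single] at hv
    rcases zmod_two_cases (v i + u i) with h0 | h0 <;> rw [h0] at hv
    · rw [Pi.single_zero, add_zero] at hv
      subst hv
      rw [if_neg hne, if_pos rfl]
      have : v i * v i = v i := by
        rcases zmod_two_cases (v i) with h1 | h1 <;> simp [h1]
      rw [this]; ring
    · rw [if_pos hv, if_neg (by rw [hv]; exact hne.symm)]
      have : u i * v i = 0 := by
        rw [hv, Pi.add_apply, Pi.single_eq_same]
        rcases zmod_two_cases (u i) with h1 | h1 <;> simp [h1, add_self_zmod_two]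
      rw [this]; simp
  · rw [if_neg h, if_neg, if_neg]
    · simp
    · rintro rfl; exact h fun _ _ => rfl
    · rintro rfl
      exact h fun j hj => by simp [hj]

theorem had_mat_mul_self (i : Fin w) : (Gate.had i).mat * (Gate.had i).mat = 1 := by
  have h2 : (1 / (Real.sqrt 2 : ℂ)) * (1 / (Real.sqrt 2 : ℂ)) = 1 / 2 := by
    rw [div_mul_div_comm, one_mul, ← Complex.ofReal_mul, Real.mul_self_sqrt (by norm_num)]
    norm_num
  rw [had_mat, Matrix.smul_mul, Matrix.mul_smul, smul_smul, h2, add_mul, mul_add, mul_add,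
    pauliX_mul_pauliX, pauliZ_mul_pauliZ, pauliZ_mul_pauliX, Qubits.add_self, pauliX_zero,
    pauliZ_zero]
  simp only [single_one_dotProduct, Pi.single_eq_same, sgn_one]
  rw [show (1 : Op (Qubits w)) + pauliX (Pi.single i 1) * pauliZ (Pi.single i 1) +
    ((-1 : ℂ) • (pauliX (Pi.single i 1) * pauliZ (Pi.single i 1)) + 1) = (2 : ℂ) • 1 by
      rw [neg_one_smul, two_smul]; abel, smul_smul]
  norm_num

theorem had_mat_conjTranspose (i : Fin w) : (Gate.had i).matᴴ = (Gate.had i).mat := by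
  rw [had_mat, Matrix.conjTranspose_smul, Matrix.conjTranspose_add, pauliX_conjTranspose,
    pauliZ_conjTranspose]
  congr 1
  simp

theorem I_pow_val_mul (c : ZMod 2) : Complex.I ^ c.val * Complex.I ^ c.val = sgn c := by
  rcases zmod_two_cases c with rfl | rfl <;> simp [ZMod.val_one]

theorem phase_mat_mul_self (i : Fin w) :
    (Gate.phase i).mat * (Gate.phase i).mat = pauliZ (Pi.single i 1) := by
  simp only [Gate.mat, Matrix.diagonal_mul_diagonal, I_pow_val_mul, pauliZ, single_one_dotProduct]

theorem phase_mat_conjTranspose (i : Fin w) :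
    (Gate.phase i).matᴴ = (Gate.phase i).mat * (Gate.phase i).mat * (Gate.phase i).mat := by
  rw [phase_mat_mul_self]
  simp only [Gate.mat, pauliZ, Matrix.diagonal_mul_diagonal, Matrix.diagonal_conjTranspose,
    single_one_dotProduct]
  congr 1
  ext u
  rcases zmod_two_cases (u i) with h | h <;> simp [h, ZMod.val_one]

/-- The unitary performed by a list of gates, applied from left to right. -/
def gatesMat (L : List (Gate w)) : Op (Qubits w) := L.foldl (fun M g => g.mat * M) 1

theorem foldl_mat_eq (L : List (Gate w)) (M : Op (Qubits w)) :
    L.foldl (fun M g => g.mat * M) M = gatesMat L * M := by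
  induction L generalizing M with
  | nil => simp [gatesMat]
  | cons g L ih => rw [gatesMat, List.foldl_cons, List.foldl_cons, ih, ih (g.mat * 1)]; simp [mul_assoc]

@[simp] theorem gatesMat_nil : gatesMat ([] : List (Gate w)) = 1 := rfl

theorem gatesMat_cons (g : Gate w) (L : List (Gate w)) :
    gatesMat (g :: L) = gatesMat L * g.mat := by
  rw [gatesMat, List.foldl_cons, foldl_mat_eq, mul_one]

theorem gatesMat_append (L L' : List (Gate w)) :
    gatesMat (L ++ L') = gatesMat L' * gatesMat L := by
  induction L with
  | nil => simp
  | cons g L ih => rw [List.cons_append, gatesMat_cons, gatesMat_cons, ih, mul_assoc]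

@[simp] theorem gatesMat_singleton (g : Gate w) : gatesMat [g] = g.mat := by
  rw [gatesMat_cons, gatesMat_nil, one_mul]

/-- All gates are self-inverse except the phase gate, of order 4, whose inverse is its cube. This is
the source of the factor 3 in the size of inverse circuits. -/
theorem Gate.exists_inv (g : Gate w) : g.matᴴ * g.mat = 1 ∧
    ∃ L : List (Gate w), L.length ≤ 3 ∧ gatesMat L = g.matᴴ := by
  have hself : ∀ g : Gate w, g.matᴴ = g.mat → g.mat * g.mat = 1 → g.matᴴ * g.mat = 1 ∧
      ∃ L : List (Gate w), L.length ≤ 3 ∧ gatesMat L = g.matᴴ := fun g h1 h2 =>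
    ⟨by rw [h1, h2], [g], by simp, by rw [gatesMat_singleton, h1]⟩
  have hfun : ∀ f : Qubits w → Qubits w, Function.Involutive f → funMat f * funMat f = 1 :=
    fun f hf => by rw [funMat_mul_funMat, hf.comp_self, funMat_id]
  cases g with
  | not i =>
    have h := update_involutive (i := i) (g := fun _ => 1) fun _ _ => rfl
    exact hself _ (funMat_conjTranspose_of_involutive h) (hfun _ h)
  | had i => exact hself _ (had_mat_conjTranspose i) (had_mat_mul_self i)
  | phase i =>
    refine ⟨?_, [.phase i, .phase i, .phase i], le_rfl, ?_⟩
    · rw [phase_mat_conjTranspose, phase_mat_mul_self, mul_assoc, phase_mat_mul_self,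
        pauliZ_mul_pauliZ, Qubits.add_self, pauliZ_zero]
    · rw [phase_mat_conjTranspose, gatesMat_cons, gatesMat_cons, gatesMat_singleton]
  | cnot i j hij =>
    have h := update_involutive (i := j) (g := fun u => u i) fun u x => by simp [hij]
    exact hself _ (funMat_conjTranspose_of_involutive h) (hfun _ h)
  | toffoli i j l hij hil hjl =>
    have h := update_involutive (i := l) (g := fun u => u i * u j) fun u x => by simp [hil, hjl]
    exact hself _ (funMat_conjTranspose_of_involutive h) (hfun _ h)

theorem gatesMat_conjTranspose_mul (L : List (Gate w)) : (gatesMat L)ᴴ * gatesMat L = 1 := by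
  induction L with
  | nil => simp
  | cons g L ih =>
    rw [gatesMat_cons, Matrix.conjTranspose_mul, mul_assoc, ← mul_assoc _ (gatesMat L), ih,
      one_mul, g.exists_inv.1]

theorem exists_gatesMat_eq_conjTranspose (L : List (Gate w)) :
    ∃ L' : List (Gate w), L'.length ≤ 3 * L.length ∧ gatesMat L' = (gatesMat L)ᴴ := by
  induction L with
  | nil => exact ⟨[], by simp, by simp⟩
  | cons g L ih =>
    obtain ⟨L', h1, h2⟩ := ih
    obtain ⟨-, L'', h3, h4⟩ := g.exists_inv
    refine ⟨L' ++ L'', ?_, ?_⟩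
    · rw [List.length_append, List.length_cons]; omega
    · rw [gatesMat_append, gatesMat_cons, Matrix.conjTranspose_mul, h2, h4]

/-- A multiplicative family of operators indexed by bit vectors is performed by circuits if its
members supported on one wire are. -/
theorem exists_gatesMat_of_single (M : Qubits w → Op (Qubits w)) (h0 : M 0 = 1)
    (hadd : ∀ a b, M a * M b = M (a + b)) (k : ℕ)
    (h1 : ∀ i, ∃ L : List (Gate w), L.length ≤ k ∧ gatesMat L = M (Pi.single i 1))
    (a : Qubits w) : ∃ L : List (Gate w), L.length ≤ k * w ∧ gatesMat L = M a := by
  have key : ∀ S : Finset (Fin w), ∃ L : List (Gate w), L.length ≤ k * S.card ∧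
      gatesMat L = M (∑ i ∈ S, Pi.single i (a i)) := by
    intro S
    induction S using Finset.induction_on with
    | empty => exact ⟨[], by simp, by simp [h0]⟩
    | insert i S hi ih =>
      obtain ⟨L, hL, hM⟩ := ih
      rw [Finset.sum_insert hi, Finset.card_insert_of_notMem hi]
      rcases zmod_two_cases (a i) with ha | ha
      · refine ⟨L, hL.trans (Nat.mul_le_mul_left _ (Nat.le_succ _)), ?_⟩
        rw [ha, Pi.single_zero, zero_add, hM]
      · obtain ⟨L', hL', hM'⟩ := h1 i
        refine ⟨L ++ L', ?_, ?_⟩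
        · rw [List.length_append, mul_add, mul_one]; omega
        · rw [gatesMat_append, hM, hM', hadd, ha]
  obtain ⟨L, hL, hM⟩ := key Finset.univ
  refine ⟨L, by simpa using hL, ?_⟩
  rw [hM, Finset.univ_sum_single]

theorem exists_gatesMat_eq_pauliX (a : Qubits w) :
    ∃ L : List (Gate w), L.length ≤ w ∧ gatesMat L = pauliX a := by
  simpa using exists_gatesMat_of_single pauliX pauliX_zero pauliX_mul_pauliX 1
    (fun i => ⟨[.not i], le_rfl, by rw [gatesMat_singleton, not_mat_eq_pauliX]⟩) a

theorem exists_gatesMat_eq_pauliZ (b : Qubits w) :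
    ∃ L : List (Gate w), L.length ≤ 2 * w ∧ gatesMat L = pauliZ b :=
  exists_gatesMat_of_single pauliZ pauliZ_zero pauliZ_mul_pauliZ 2
    (fun i => ⟨[.phase i, .phase i], le_rfl, by
      rw [gatesMat_cons, gatesMat_singleton, phase_mat_mul_self]⟩) b

end

/-! ### Clifford circuits acting on Pauli operators -/

section

variable {n : ℕ}

/-- The gates which map Pauli operators to Pauli operators. -/
def Gate.IsClifford : Gate n → Prop
  | .toffoli .. => False
  | _ => True

/-- The action of a Clifford gate on the labels of Pauli operators. -/
def Gate.conj : Gate n → PauliVec n → PauliVec n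
  | .had i, v => (Function.update v.1 i (v.2 i), Function.update v.2 i (v.1 i))
  | .phase i, v => (v.1, Function.update v.2 i (v.2 i + v.1 i))
  | .cnot i j _, v =>
    (Function.update v.1 j (v.1 j + v.1 i), Function.update v.2 i (v.2 i + v.2 j))
  -- This covers NOT, which changes only signs, and Toffoli, where the value is immaterial because
  -- `Gate.IsClifford` excludes it.
  | _, v => v

theorem Gate.conj_add (g : Gate n) (v w : PauliVec n) : g.conj (v + w) = g.conj v + g.conj w := by
  cases g <;> simp only [Gate.conj] <;> refine Prod.ext (funext fun k => ?_) (funext fun k => ?_) <;>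
    simp only [Prod.fst_add, Prod.snd_add, Pi.add_apply, Function.update_apply] <;>
    split_ifs <;> ring

theorem sgn_smul_exists_of_mul_self {c : ℂ} (h : c * c = 1) : ∃ t, c = sgn t := by
  rcases mul_self_eq_one_iff.mp h with rfl | rfl
  · exact ⟨0, by simp⟩
  · exact ⟨1, by simp⟩

theorem ne_zero_of_conjTranspose_mul_eq_one {α : Type*} [Fintype α] [DecidableEq α] [Nonempty α]
    {U : Op α} (h : Uᴴ * U = 1) : U ≠ 0 := by
  rintro rfl
  rw [mul_zero] at h
  exact zero_ne_one h

/-- The scalar relating self-adjoint Pauli operators must square to 1, as both are involutions.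
Hence the phases in the gate rules need not be tracked. -/
theorem exists_sgn_of_conj {U : Op (Qubits n)} (hU : Uᴴ * U = 1) {v w : PauliVec n} {c : ℂ}
    (h : U * (pauliX v.1 * pauliZ v.2) = c • ((pauliX w.1 * pauliZ w.2) * U)) :
    ∃ t, U * pauli v = sgn t • (pauli w * U) := by
  obtain ⟨d, hd⟩ : ∃ d : ℂ, U * pauli v = d • (pauli w * U) := by
    refine ⟨pauliPhase v * c / pauliPhase w, ?_⟩
    rw [pauli_eq, pauli_eq, Matrix.mul_smul, h, Matrix.smul_mul, smul_smul, smul_smul,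
      div_mul_cancel₀ _ (pauliPhase_ne_zero w)]
  have h1 : U = (d * d) • U := by
    calc U = U * pauli v * pauli v := by rw [mul_assoc, pauli_mul_self, mul_one]
      _ = _ := by
        rw [hd, Matrix.smul_mul, mul_assoc, hd, Matrix.mul_smul, ← mul_assoc, pauli_mul_self,
          one_mul, smul_smul]
  have h2 : (d * d - 1) • U = 0 := by rw [sub_smul, ← h1, one_smul, sub_self]
  have h3 := (smul_eq_zero.mp h2).resolve_right (ne_zero_of_conjTranspose_mul_eq_one hU)
  obtain ⟨t, rfl⟩ := sgn_smul_exists_of_mul_self (sub_eq_zero.mp h3)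
  exact ⟨t, hd⟩

theorem had_mul_pauliXZ (i : Fin n) (v : PauliVec n) :
    ∃ c : ℂ, (Gate.had i).mat * (pauliX v.1 * pauliZ v.2) =
      c • ((pauliX ((Gate.had i).conj v).1 * pauliZ ((Gate.had i).conj v).2) *
        (Gate.had i).mat) := by
  have hX : pauliX (Pi.single i 1 : Qubits n) =
      pauliX ((Pi.single i 1, 0) : PauliVec n).1 * pauliZ ((Pi.single i 1, 0) : PauliVec n).2 := by
    simp
  have hZ : pauliZ (Pi.single i 1 : Qubits n) =
      pauliX ((0, Pi.single i 1) : PauliVec n).1 * pauliZ ((0, Pi.single i 1) : PauliVec n).2 := by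
    simp
  -- If wire `i` carries `I` or `XZ`, swapping `X` and `Z` keeps the label and costs at most a sign;
  -- otherwise both bits flip.
  by_cases h : v.1 i = v.2 i
  · have hv : (Gate.had i).conj v = v := by
      simp only [Gate.conj, ← h]
      rw [Function.update_eq_self, h, Function.update_eq_self]
    refine ⟨sgn (v.1 i), ?_⟩
    rw [hv, had_mat, Matrix.smul_mul, Matrix.mul_smul, smul_comm, hX, hZ, add_mul, mul_add,
      pauliXZ_mul, pauliXZ_mul, pauliXZ_mul, pauliXZ_mul, smul_add, smul_smul, smul_smul,
      add_comm v, add_comm v]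
    simp only [dotProduct_zero, single_one_dotProduct, dotProduct_single_one, zero_dotProduct,
      sgn_zero, ← h, mul_one, smul_add, smul_smul]
    rw [sgn_mul_self, mul_one]
  · have hv : (Gate.had i).conj v = v + (Pi.single i 1, Pi.single i 1) := by
      have h2 : v.2 i = v.1 i + 1 := by
        revert h; generalize v.1 i = a; generalize v.2 i = b; revert a b; decide
      have h1 : v.1 i = v.2 i + 1 := by rw [h2, add_assoc, add_self_zmod_two, add_zero]
      refine Prod.ext ?_ ?_
      · rw [Prod.fst_add, ← update_eq_add_single, ← h2]; rfl
      · rw [Prod.snd_add, ← update_eq_add_single, ← h1]; rfl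
    refine ⟨1, ?_⟩
    have h2 : sgn (v.1 i) = sgn (v.2 i + 1) := by
      congr 1
      revert h; generalize v.1 i = a; generalize v.2 i = b; revert a b; decide
    rw [hv, had_mat, Matrix.smul_mul, Matrix.mul_smul, one_smul, hX, hZ, add_mul, mul_add,
      pauliXZ_mul, pauliXZ_mul, pauliXZ_mul, pauliXZ_mul]
    have e1 : v + (Pi.single i 1, Pi.single i 1) + (Pi.single i 1, 0) =
        ((0, Pi.single i 1) : PauliVec n) + v := by
      refine Prod.ext ?_ ?_
      · simp only [Prod.fst_add, add_assoc, Qubits.add_self, add_zero, zero_add]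
      · simp only [Prod.snd_add, add_zero, add_comm]
    have e2 : v + (Pi.single i 1, Pi.single i 1) + (0, Pi.single i 1) =
        ((Pi.single i 1, 0) : PauliVec n) + v := by
      refine Prod.ext ?_ ?_
      · simp only [Prod.fst_add, add_zero, add_comm]
      · simp only [Prod.snd_add, add_assoc, Qubits.add_self, add_zero, zero_add]
    rw [e1, e2]
    simp only [dotProduct_zero, single_one_dotProduct, dotProduct_single_one, zero_dotProduct,
      sgn_zero, Prod.snd_add, Pi.add_apply, Pi.single_eq_same, h2]
    rw [add_comm]

theorem phase_mul_pauliXZ (i : Fin n) (v : PauliVec n) :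
    ∃ c : ℂ, (Gate.phase i).mat * (pauliX v.1 * pauliZ v.2) =
      c • ((pauliX ((Gate.phase i).conj v).1 * pauliZ ((Gate.phase i).conj v).2) *
        (Gate.phase i).mat) := by
  refine ⟨Complex.I ^ (v.1 i).val, ?_⟩
  ext x u
  simp only [Gate.conj, update_eq_add_single, Gate.mat, Matrix.diagonal_mul, Matrix.smul_apply,
    Matrix.mul_diagonal, mul_pauliZ_apply, pauliX_apply, add_dotProduct, sgn_add,
    single_dotProduct, smul_eq_mul]
  split_ifs with hx
  · rw [hx, Pi.add_apply]
    -- `c ↦ I ^ c.val` is not additive on `ZMod 2`; the correcting sign is the `Z` that the phase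
    -- gate adds wherever there is an `X`.
    have h : Complex.I ^ (u i + v.1 i).val =
        Complex.I ^ (v.1 i).val * sgn (v.1 i * u i) * Complex.I ^ (u i).val := by
      have h11 : (1 + 1 : ZMod 2) = 0 := by decide
      rcases zmod_two_cases (u i) with h1 | h1 <;> rcases zmod_two_cases (v.1 i) with h2 | h2 <;>
        simp [h1, h2, ZMod.val_one, h11]
    rw [h]; ring
  · simp

theorem cnot_mul_pauliXZ (i j : Fin n) (hij : i ≠ j) (v : PauliVec n) :
    (Gate.cnot i j hij).mat * (pauliX v.1 * pauliZ v.2) =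
      (pauliX ((Gate.cnot i j hij).conj v).1 * pauliZ ((Gate.cnot i j hij).conj v).2) *
        (Gate.cnot i j hij).mat := by
  have h1 : (Gate.cnot i j hij).mat * pauliX v.1 =
      pauliX ((Gate.cnot i j hij).conj v).1 * (Gate.cnot i j hij).mat := by
    rw [cnot_mat, pauliX_eq_funMat, pauliX_eq_funMat, funMat_mul_funMat, funMat_mul_funMat]
    congr 1
    ext u k
    simp only [Gate.conj, Function.comp_apply, update_eq_add_single, Pi.add_apply,
      Pi.single_add]
    ring
  have h2 : pauliZ ((Gate.cnot i j hij).conj v).2 * (Gate.cnot i j hij).mat =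
      (Gate.cnot i j hij).mat * pauliZ v.2 := by
    rw [cnot_mat, pauliZ, pauliZ]
    refine diagonal_mul_funMat fun u => ?_
    congr 1
    simp only [Gate.conj, update_eq_add_single, add_dotProduct, dotProduct_add, single_dotProduct,
      dotProduct_single, Pi.add_apply, Pi.single_eq_of_ne hij.symm, add_zero]
    rw [add_assoc, add_self_zmod_two, add_zero]
  rw [← mul_assoc, h1, mul_assoc, ← h2, mul_assoc]

theorem Gate.exists_sgn_conj {g : Gate n} (hg : g.IsClifford) (v : PauliVec n) :
    ∃ t, g.mat * pauli v = sgn t • (pauli (g.conj v) * g.mat) := by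
  cases g with
  | not i =>
    refine exists_sgn_of_conj (Gate.exists_inv _).1 (c := sgn (v.2 i)) ?_
    have hX : pauliX (Pi.single i 1 : Qubits n) =
      pauliX ((Pi.single i 1, 0) : PauliVec n).1 * pauliZ ((Pi.single i 1, 0) : PauliVec n).2 := by
      simp
    have hc : (Gate.not i).conj v = v := rfl
    rw [hc, not_mat_eq_pauliX, hX, pauliXZ_mul, pauliXZ_mul, smul_smul, add_comm v]
    simp only [dotProduct_zero, sgn_zero, single_one_dotProduct, sgn_mul_self]
  | had i =>
    obtain ⟨c, hc⟩ := had_mul_pauliXZ i v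
    exact exists_sgn_of_conj (Gate.exists_inv _).1 hc
  | phase i =>
    obtain ⟨c, hc⟩ := phase_mul_pauliXZ i v
    exact exists_sgn_of_conj (Gate.exists_inv _).1 hc
  | cnot i j hij =>
    refine exists_sgn_of_conj (Gate.exists_inv _).1 (c := 1) ?_
    rw [one_smul, cnot_mul_pauliXZ]
  | toffoli => exact hg.elim

/-- The action of a list of Clifford gates on the labels of Pauli operators. -/
def conjList : List (Gate n) → PauliVec n →+ PauliVec n
  | [] => AddMonoidHom.id _
  | g :: L => (conjList L).comp ⟨⟨g.conj, by
      have h := g.conj_add 0 0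
      rwa [add_zero, left_eq_add] at h⟩, g.conj_add⟩

@[simp] theorem conjList_nil (v : PauliVec n) : conjList [] v = v := rfl

@[simp] theorem conjList_cons (g : Gate n) (L : List (Gate n)) (v : PauliVec n) :
    conjList (g :: L) v = conjList L (g.conj v) := rfl

theorem conjList_append (L L' : List (Gate n)) (v : PauliVec n) :
    conjList (L ++ L') v = conjList L' (conjList L v) := by
  induction L generalizing v with
  | nil => rfl
  | cons g L ih => rw [List.cons_append, conjList_cons, conjList_cons, ih]

theorem exists_sgn_conjList {L : List (Gate n)} (hL : ∀ g ∈ L, g.IsClifford) (v : PauliVec n) :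
    ∃ t, gatesMat L * pauli v = sgn t • (pauli (conjList L v) * gatesMat L) := by
  induction L generalizing v with
  | nil => exact ⟨0, by simp⟩
  | cons g L ih =>
    obtain ⟨t, ht⟩ := Gate.exists_sgn_conj (hL g List.mem_cons_self) v
    obtain ⟨t', ht'⟩ := ih (fun g hg => hL g (List.mem_cons_of_mem _ hg)) (g.conj v)
    refine ⟨t + t', ?_⟩
    rw [gatesMat_cons, mul_assoc, ht, Matrix.mul_smul, ← mul_assoc, ht', Matrix.smul_mul,
      smul_smul, sgn_add, mul_assoc, conjList_cons]

/-- The symplectic form is the commutation sign of Pauli operators, and conjugation by a unitary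
preserves commutation relations. -/
theorem sympl_conjList {L : List (Gate n)} (hL : ∀ g ∈ L, g.IsClifford) (v w : PauliVec n) :
    sympl (conjList L v) (conjList L w) = sympl v w := by
  obtain ⟨t, ht⟩ := exists_sgn_conjList hL v
  obtain ⟨t', ht'⟩ := exists_sgn_conjList hL w
  set U := gatesMat L
  have hU : Uᴴ * U = 1 := gatesMat_conjTranspose_mul L
  have key : ∀ {v w : PauliVec n} {t t'}, U * pauli v = sgn t • (pauli (conjList L v) * U) →
      U * pauli w = sgn t' • (pauli (conjList L w) * U) → U * (pauli v * pauli w) =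
        (sgn t * sgn t') • (pauli (conjList L v) * pauli (conjList L w) * U) := by
    intro v w t t' h h'
    rw [← mul_assoc, h, Matrix.smul_mul, mul_assoc, h', Matrix.mul_smul, smul_smul, mul_assoc]
  have h1 := key ht ht'
  rw [pauli_mul_comm v w, pauli_mul_comm (conjList L v), Matrix.mul_smul, key ht' ht,
    Matrix.smul_mul, smul_smul, smul_smul, ← sub_eq_zero, ← sub_smul] at h1
  have h2 : pauli (conjList L w) * pauli (conjList L v) * U ≠ 0 := by
    intro h0
    refine ne_zero_of_conjTranspose_mul_eq_one hU ?_
    have h3 := congrArg (fun M => pauli (conjList L v) * (pauli (conjList L w) * M)) h0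
    simp only [mul_zero] at h3
    rwa [mul_assoc, ← mul_assoc (pauli (conjList L w)), pauli_mul_self, one_mul, ← mul_assoc,
      pauli_mul_self, one_mul] at h3
  have h3 := (smul_eq_zero.mp h1).resolve_right h2
  refine (sgn_injective ?_).symm
  have h4 : sgn t * sgn t' ≠ 0 := mul_ne_zero (sgn_ne_zero _) (sgn_ne_zero _)
  apply mul_right_cancel₀ h4
  linear_combination h3

theorem conjList_injective {L : List (Gate n)} (hL : ∀ g ∈ L, g.IsClifford) :
    Function.Injective (conjList L) := by
  refine (injective_iff_map_eq_zero _).mpr fun v hv => eq_zero_of_sympl_eq_zero fun w => ?_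
  rw [← sympl_conjList hL, hv, sympl_zero_left]

/-! ### Synthesis of Clifford circuits -/

/-- The label of the operator `Z` on one wire. -/
def zVec (p : Fin n) : PauliVec n := (0, Pi.single p 1)

theorem pauli_zVec (p : Fin n) : pauli (zVec p) = pauliZ (Pi.single p 1) := by
  simp [pauli, zVec]

/-- `w` is obtained from `v` by at most `k` Clifford gates which fix `Z` on the wires in `F`. -/
def Reach (F : Finset (Fin n)) (k : ℕ) (v w : PauliVec n) : Prop :=
  ∃ L : List (Gate n), (∀ g ∈ L, g.IsClifford) ∧ L.length ≤ k ∧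
    (∀ f ∈ F, conjList L (zVec f) = zVec f) ∧ conjList L v = w

theorem Reach.refl (F : Finset (Fin n)) (k : ℕ) (v : PauliVec n) : Reach F k v v :=
  ⟨[], by simp, by simp, fun _ _ => rfl, rfl⟩

theorem Reach.trans {F : Finset (Fin n)} {k l : ℕ} {u v w : PauliVec n} (h : Reach F k u v)
    (h' : Reach F l v w) : Reach F (k + l) u w := by
  obtain ⟨L, h1, h2, h3, rfl⟩ := h
  obtain ⟨L', h1', h2', h3', rfl⟩ := h'
  refine ⟨L ++ L', fun g hg => ?_, ?_, fun f hf => ?_, conjList_append L L' u⟩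
  · exact (List.mem_append.mp hg).elim (h1 g) (h1' g)
  · rw [List.length_append]; omega
  · rw [conjList_append, h3 f hf, h3' f hf]

theorem Reach.mono {F : Finset (Fin n)} {k l : ℕ} {v w : PauliVec n} (h : Reach F k v w)
    (hkl : k ≤ l) : Reach F l v w := by
  obtain ⟨L, h1, h2, h3⟩ := h
  exact ⟨L, h1, h2.trans hkl, h3⟩

theorem Reach.gate {F : Finset (Fin n)} {v w : PauliVec n} (g : Gate n) (hg : g.IsClifford)
    (hF : ∀ f ∈ F, g.conj (zVec f) = zVec f) (hv : g.conj v = w) : Reach F 1 v w :=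
  ⟨[g], by simpa using hg, le_rfl, hF, hv⟩

theorem had_conj_zVec {i f : Fin n} (h : f ≠ i) : (Gate.had i).conj (zVec f) = zVec f := by
  simp [Gate.conj, zVec, h.symm]

theorem phase_conj_zVec (i f : Fin n) : (Gate.phase i).conj (zVec f) = zVec f := by
  simp [Gate.conj, zVec]

theorem cnot_conj_zVec {i j f : Fin n} (hij : i ≠ j) (h : f ≠ j) :
    (Gate.cnot i j hij).conj (zVec f) = zVec f := by
  simp [Gate.conj, zVec, h.symm]

/-- One-qubit gates turn a Pauli operator into a product of `X`s on a set of wires. -/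
theorem exists_reach_snd_eq_zero {F : Finset (Fin n)} (v : PauliVec n) (S : Finset (Fin n))
    (hS : Disjoint S F) : ∃ w, Reach F S.card v w ∧ (∀ q ∈ S, w.2 q = 0) ∧
      (∀ q, q ∉ S → w.1 q = v.1 q ∧ w.2 q = v.2 q) ∧
      ∀ q ∈ S, w.1 q = 0 → v.1 q = 0 ∧ v.2 q = 0 := by
  induction S using Finset.induction_on with
  | empty => exact ⟨v, Reach.refl _ _ _, by simp⟩
  | insert i S hi ih =>
    rw [Finset.disjoint_insert_left] at hS
    obtain ⟨w, h1, h2, h3, h4⟩ := ih hS.2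
    rw [Finset.card_insert_of_notMem hi]
    have hiF : ∀ f ∈ F, f ≠ i := fun f hf h => hS.1 (h ▸ hf)
    have hi3 := h3 i hi
    have hne : ∀ {q}, q ∈ S → q ≠ i := fun hq h => hi (h ▸ hq)
    rcases zmod_two_cases (w.2 i) with hw2 | hw2
    · refine ⟨w, h1.mono (Nat.le_succ _), ?_, fun q hq => ?_, ?_⟩
      · simpa [hw2] using h2
      · exact h3 q fun h => hq (Finset.mem_insert_of_mem h)
      · intro q hq hq0
        rcases Finset.mem_insert.mp hq with rfl | hq
        · exact ⟨hi3.1 ▸ hq0, hi3.2 ▸ hw2⟩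
        · exact h4 q hq hq0
    · rcases zmod_two_cases (w.1 i) with hw1 | hw1
      · refine ⟨_, h1.trans (Reach.gate (.had i) trivial
          (fun f hf => had_conj_zVec (hiF f hf)) rfl), ?_, fun q hq => ?_, ?_⟩
        · intro q hq
          rcases Finset.mem_insert.mp hq with rfl | hq
          · simp [Gate.conj, hw1]
          · simp [Gate.conj, hne hq, h2 q hq]
        · rw [Finset.mem_insert, not_or] at hq
          simpa [Gate.conj, hq.1] using h3 q hq.2
        · intro q hq
          rcases Finset.mem_insert.mp hq with rfl | hq
          · simp [Gate.conj, hw2]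
          · simpa [Gate.conj, hne hq] using h4 q hq
      · refine ⟨_, h1.trans (Reach.gate (.phase i) trivial
          (fun f hf => phase_conj_zVec i f) rfl), ?_, fun q hq => ?_, ?_⟩
        · intro q hq
          rcases Finset.mem_insert.mp hq with rfl | hq
          · simp [Gate.conj, hw1, hw2, add_self_zmod_two]
          · simp [Gate.conj, hne hq, h2 q hq]
        · rw [Finset.mem_insert, not_or] at hq
          simpa [Gate.conj, hq.1] using h3 q hq.2
        · intro q hq
          rcases Finset.mem_insert.mp hq with rfl | hq
          · simp [Gate.conj, hw1]
          · simpa [Gate.conj, hne hq] using h4 q hq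

/-- CNOT gates controlled by `p` clear the `X`-part on other wires. -/
theorem reach_clear_fst {F : Finset (Fin n)} {a b : Qubits n} {p : Fin n} (hp : a p = 1)
    (hb : ∀ q, q ∉ F → b q = 0) (S : Finset (Fin n)) (hS : Disjoint S F) (hpS : p ∉ S) :
    Reach F S.card (a, b) (fun q => if q ∈ S then 0 else a q, b) := by
  induction S using Finset.induction_on with
  | empty => simpa using Reach.refl F 0 (a, b)
  | insert i S hi ih =>
    rw [Finset.disjoint_insert_left] at hS
    rw [Finset.mem_insert, not_or] at hpS
    rw [Finset.card_insert_of_notMem hi]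
    have h1 := ih hS.2 hpS.2
    rcases zmod_two_cases (a i) with ha | ha
    · have e : (fun q => if q ∈ insert i S then 0 else a q) = fun q => if q ∈ S then 0 else a q := by
        ext q
        by_cases hq : q = i
        · subst hq; simp [hi, ha]
        · simp [hq]
      rw [e]
      exact h1.mono (Nat.le_succ _)
    · refine h1.trans (Reach.gate (.cnot p i hpS.1) trivial
        (fun f hf => cnot_conj_zVec _ fun h => hS.1 (h ▸ hf)) (Prod.ext (funext fun q => ?_) ?_))
      · by_cases hq : q = i
        · subst hq; simp [Gate.conj, hi, hpS.2, ha, hp, add_self_zmod_two]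
        · simp [Gate.conj, hq]
      · simp [Gate.conj, hb i hS.1]

/-- CNOT gates with target `p` clear the `Z`-part on other wires. -/
theorem reach_clear_snd {F : Finset (Fin n)} {b : Qubits n} {p : Fin n} (hp : b p = 1)
    (hpF : p ∉ F) (S : Finset (Fin n)) (hpS : p ∉ S) :
    Reach F S.card (0, b) (0, fun q => if q ∈ S then 0 else b q) := by
  induction S using Finset.induction_on with
  | empty => simpa using Reach.refl F 0 (0, b)
  | insert i S hi ih =>
    rw [Finset.mem_insert, not_or] at hpS
    rw [Finset.card_insert_of_notMem hi]
    have h1 := ih hpS.2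
    rcases zmod_two_cases (b i) with hb | hb
    · have e : (fun q => if q ∈ insert i S then 0 else b q) = fun q => if q ∈ S then 0 else b q := by
        ext q
        by_cases hq : q = i
        · subst hq; simp [hi, hb]
        · simp [hq]
      rw [e]
      exact h1.mono (Nat.le_succ _)
    · refine h1.trans (Reach.gate (.cnot i p (Ne.symm hpS.1)) trivial
        (fun f hf => cnot_conj_zVec _ fun h => hpF (h ▸ hf)) (Prod.ext ?_ (funext fun q => ?_)))
      · simp [Gate.conj]
      · by_cases hq : q = i
        · subst hq; simp [Gate.conj, hi, hpS.2, hb, hp, add_self_zmod_two]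
        · simp [Gate.conj, hq]

/-- Outside `F`, turn the label into `X`s, bring an `X` to wire `p`, use it to clear the others and
turn it into `Z` by a Hadamard gate. No gate other than a phase gate acts on wires of `F` except as
a CNOT control, so `Z` there is preserved. -/
theorem reach_zVec {F : Finset (Fin n)} {p : Fin n} (hp : p ∉ F) {v : PauliVec n}
    (hF : ∀ f ∈ F, v.1 f = 0) (hv : ∃ q, q ∉ F ∧ ¬(v.1 q = 0 ∧ v.2 q = 0)) :
    Reach F (3 * n + 2) v (zVec p) := by
  obtain ⟨⟨a, b⟩, h1, h2, h3, h4⟩ := exists_reach_snd_eq_zero v Fᶜ disjoint_compl_left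
  simp only [Finset.mem_compl, not_not] at h2 h3 h4
  obtain ⟨q, hq, hvq⟩ := hv
  have haq : a q = 1 := (zmod_two_cases _).resolve_left fun h => hvq (h4 q hq h)
  have haF : ∀ f ∈ F, a f = 0 := fun f hf => (h3 f hf).1.trans (hF f hf)
  obtain ⟨a', h5, ha'p, ha'F⟩ : ∃ a', Reach F 1 (a, b) (a', b) ∧ a' p = 1 ∧ ∀ f ∈ F, a' f = 0 := by
    rcases zmod_two_cases (a p) with hap | hap
    · have hqp : q ≠ p := fun h => by rw [h, hap] at haq; exact zero_ne_one haq
      refine ⟨Function.update a p 1, Reach.gate (.cnot q p hqp) trivial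
        (fun f hf => cnot_conj_zVec _ fun h => hp (h ▸ hf)) ?_, by simp, fun f hf => ?_⟩
      · simp [Gate.conj, hap, haq, h2 p hp]
      · have hfp : f ≠ p := fun h => hp (h ▸ hf)
        rw [Function.update_of_ne hfp, haF f hf]
    · exact ⟨a, Reach.refl _ _ _, hap, haF⟩
  have h6 := reach_clear_fst ha'p h2 (Fᶜ.erase p)
    (disjoint_compl_left.mono_left (Finset.erase_subset _ _)) (Finset.notMem_erase _ _)
  have e6 : (fun q => if q ∈ Fᶜ.erase p then 0 else a' q) = Pi.single p 1 := by
    ext q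
    by_cases hq : q = p
    · subst hq; simp [ha'p]
    · by_cases hqF : q ∈ F <;> simp [hq, hqF, ha'F]
  rw [e6] at h6
  have h7 : Reach F 1 (Pi.single p 1, b) (0, Function.update b p 1) :=
    Reach.gate (.had p) trivial (fun f hf => had_conj_zVec fun h => hp (h ▸ hf))
      (Prod.ext (funext fun q => by
        by_cases hq : q = p
        · subst hq; simp [Gate.conj, h2 q hp]
        · simp [Gate.conj, hq]) (by simp [Gate.conj]))
  -- Only `Z`s are left; those on `F` are cleared by CNOTs controlled in `F` with target `p`, which
  -- fix `Z` on `F`.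
  have h8 := reach_clear_snd (F := F) (b := Function.update b p 1) (by simp) hp F hp
  have e8 : ((0, fun q => if q ∈ F then 0 else Function.update b p 1 q) : PauliVec n) = zVec p := by
    refine Prod.ext rfl (funext fun q => ?_)
    by_cases hq : q = p
    · subst hq; simp [hp, zVec]
    · by_cases hqF : q ∈ F <;> simp [zVec, hq, hqF, h2]
  rw [e8] at h8
  refine ((((h1.trans h5).trans h6).trans h7).trans h8).mono ?_
  have c1 : Fᶜ.card ≤ n := (Finset.card_le_univ _).trans_eq (Fintype.card_fin n)
  have c2 : F.card ≤ n := (Finset.card_le_univ _).trans_eq (Fintype.card_fin n)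
  have c3 : (Fᶜ.erase p).card ≤ Fᶜ.card := Finset.card_le_card (Finset.erase_subset _ _)
  omega

end

theorem conjList_sum_smul {n : ℕ} (L : List (Gate n)) {ι : Type*} (S : Finset ι) (c : ι → ZMod 2)
    (v : ι → PauliVec n) : conjList L (∑ i ∈ S, c i • v i) = ∑ i ∈ S, c i • conjList L (v i) := by
  rw [map_sum]
  exact Finset.sum_congr rfl fun i _ => ZMod.map_smul (conjList L) (c i) (v i)

theorem eq_sum_zVec {n : ℕ} {v : PauliVec n} {F : Finset (Fin n)} (h1 : v.1 = 0)
    (h2 : ∀ q, q ∉ F → v.2 q = 0) : v = ∑ f ∈ F, v.2 f • zVec f := by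
  refine Prod.ext ?_ (funext fun q => ?_)
  · rw [Prod.fst_sum, h1]; simp [zVec]
  · rw [Prod.snd_sum, Finset.sum_apply]
    by_cases hq : q ∈ F
    · rw [Finset.sum_eq_single q] <;> simp +contextual [zVec, hq, eq_comm]
    · rw [h2 q hq, Finset.sum_eq_zero]
      intro f hf
      have : q ≠ f := fun h => hq (h ▸ hf)
      simp [zVec, this]

/-! ### Taking the generators of a code to single-wire `Z` operators. -/

namespace StabilizerCode

variable {m s : ℕ}

/-- The wires which carry the first `j` bits of the syndrome. -/
def syndromeWires (m s j : ℕ) : Finset (Fin (m + s)) :=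
  (Finset.univ.filter fun i : Fin s => (i : ℕ) < j).map (Fin.natAddEmb m)

/-- Induction on the generators: isotropy and independence supply the two hypotheses of
`reach_zVec`, and the wires already treated are protected. -/
theorem exists_clifford_of_le (Q : StabilizerCode m s) : ∀ j ≤ s, ∃ L : List (Gate (m + s)),
    (∀ g ∈ L, g.IsClifford) ∧ L.length ≤ j * (3 * (m + s) + 2) ∧
      ∀ i : Fin s, (i : ℕ) < j → conjList L (Q.gen i) = zVec (Fin.natAdd m i)
  | 0, _ => ⟨[], by simp⟩
  | j + 1, hj => by
    obtain ⟨L, h1, h2, h3⟩ := exists_clifford_of_le Q j (by omega)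
    let j' : Fin s := ⟨j, hj⟩
    set v := conjList L (Q.gen j') with hv
    have hmem : ∀ f ∈ syndromeWires m s j, ∃ i : Fin s, (i : ℕ) < j ∧ f = Fin.natAdd m i := by
      intro f hf
      obtain ⟨i, hi, rfl⟩ := Finset.mem_map.mp hf
      exact ⟨i, (Finset.mem_filter.mp hi).2, rfl⟩
    -- Commuting with `Z` on a wire means having no `X`-part there.
    have hF : ∀ f ∈ syndromeWires m s j, v.1 f = 0 := by
      intro f hf
      obtain ⟨i, hi, rfl⟩ := hmem f hf
      have h4 := sympl_conjList h1 (Q.gen i) (Q.gen j')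
      rw [Q.comm, h3 i hi, ← hv] at h4
      simpa [sympl, zVec] using h4
    have hp : Fin.natAdd m j' ∉ syndromeWires m s j := by
      intro h
      obtain ⟨i, hi, h5⟩ := hmem _ h
      rw [← Fin.natAdd_injective s m h5] at hi
      exact lt_irrefl _ hi
    -- Otherwise the image would be a product of `Z`s on the wires already treated, making this
    -- generator a combination of earlier ones.
    have hex : ∃ q, q ∉ syndromeWires m s j ∧ ¬(v.1 q = 0 ∧ v.2 q = 0) := by
      by_contra! h0
      have hv1 : v.1 = 0 := funext fun q => by
        by_cases hq : q ∈ syndromeWires m s j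
        · exact hF q hq
        · exact (h0 q hq).1
      have h4 := eq_sum_zVec hv1 fun q hq => (h0 q hq).2
      rw [syndromeWires, Finset.sum_map] at h4
      have h5 : v = conjList L (∑ i ∈ Finset.univ.filter fun i : Fin s => (i : ℕ) < j,
          v.2 (Fin.natAdd m i) • Q.gen i) := by
        rw [conjList_sum_smul]
        refine h4.trans (Finset.sum_congr rfl fun i hi => ?_)
        rw [h3 i (Finset.mem_filter.mp hi).2]
        rfl
      have h6 := conjList_injective h1 h5
      have h7 : j' ∉ Finset.univ.filter fun i : Fin s => (i : ℕ) < j := by simp [j']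
      refine (linearIndependent_iff_notMem_span.mp Q.indep) j' ?_
      rw [h6]
      refine Submodule.sum_mem _ fun i hi => Submodule.smul_mem _ _ (Submodule.subset_span ?_)
      exact ⟨i, ⟨Set.mem_univ _, fun h => h7 (Set.mem_singleton_iff.mp h ▸ hi)⟩, rfl⟩
    obtain ⟨L', h1', h2', h3', h4'⟩ := reach_zVec hp hF hex
    refine ⟨L ++ L', fun g hg => (List.mem_append.mp hg).elim (h1 g) (h1' g), ?_, fun i hi => ?_⟩
    · rw [List.length_append, add_mul, one_mul]; omega
    · rw [conjList_append]
      rcases Nat.lt_succ_iff_lt_or_eq.mp hi with hi | hi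
      · rw [h3 i hi]
        exact h3' _ (Finset.mem_map_of_mem _ (Finset.mem_filter.mpr ⟨Finset.mem_univ _, hi⟩))
      · have : i = j' := Fin.ext hi
        rw [this]; exact h4'

/-- A circuit of quadratic size takes the generators of a stabilizer code to `Z` operators on the
last wires. -/
theorem exists_clifford (Q : StabilizerCode m s) : ∃ (L : List (Gate (m + s))) (c : Qubits s),
    L.length ≤ s * (3 * (m + s) + 2) ∧ ∀ i, gatesMat L * pauli (Q.gen i) =
      sgn (c i) • (pauliZ (Pi.single (Fin.natAdd m i) 1) * gatesMat L) := by
  obtain ⟨L, h1, h2, h3⟩ := Q.exists_clifford_of_le s le_rfl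
  choose c hc using fun i => exists_sgn_conjList h1 (Q.gen i)
  refine ⟨L, c, h2, fun i => ?_⟩
  rw [hc, h3 i i.2, pauli_zVec]

end StabilizerCode

/-! ### Registers composed of two parts -/

section

variable {m s : ℕ}

theorem append_add_append (a a' : Qubits m) (z z' : Qubits s) :
    (Fin.append a z + Fin.append a' z' : Qubits (m + s)) = Fin.append (a + a') (z + z') := by
  ext i
  refine Fin.addCases (fun i => ?_) (fun i => ?_) i <;> simp

theorem append_eq_append_iff {a a' : Qubits m} {z z' : Qubits s} :
    Fin.append a z = Fin.append a' z' ↔ a = a' ∧ z = z' := by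
  refine ⟨fun h => ⟨funext fun i => ?_, funext fun i => ?_⟩, fun h => by rw [h.1, h.2]⟩
  · simpa using congrFun h (Fin.castAdd s i)
  · simpa using congrFun h (Fin.natAdd m i)

theorem append_dotProduct_append (a a' : Qubits m) (z z' : Qubits s) :
    Fin.append a z ⬝ᵥ Fin.append a' z' = a ⬝ᵥ a' + z ⬝ᵥ z' := by
  simp [dotProduct, Fin.sum_univ_add]

theorem exists_eq_append (u : Qubits (m + s)) : ∃ a z, u = Fin.append a z :=
  ⟨fun i => u (Fin.castAdd s i), fun i => u (Fin.natAdd m i), by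
    ext i
    refine Fin.addCases (fun i => ?_) (fun i => ?_) i <;> simp⟩

theorem sum_append {M : Type*} [AddCommMonoid M] (f : Qubits (m + s) → M) :
    ∑ u, f u = ∑ a : Qubits m, ∑ z : Qubits s, f (Fin.append a z) := by
  rw [← Fintype.sum_prod_type' (f := fun a z => f (Fin.append a z))]
  exact (Fintype.sum_equiv (Fin.appendEquiv m s) _ _ fun p => rfl).symm

theorem update_append_castAdd (a : Qubits m) (z : Qubits s) (i : Fin m) (x : ZMod 2) :
    Function.update (Fin.append a z) (Fin.castAdd s i) x = Fin.append (Function.update a i x) z := by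
  ext k
  refine Fin.addCases (fun k => ?_) (fun k => ?_) k
  · by_cases hk : k = i
    · subst hk; simp
    · have : Fin.castAdd s k ≠ Fin.castAdd s i := fun h => hk (Fin.castAdd_injective m s h)
      simp [hk]
  · have : Fin.natAdd m k ≠ Fin.castAdd s i := by
      rw [ne_eq, Fin.ext_iff]; simp; omega
    simp [Function.update_of_ne this]

theorem update_append_natAdd (a : Qubits m) (z : Qubits s) (i : Fin s) (x : ZMod 2) :
    Function.update (Fin.append a z) (Fin.natAdd m i) x = Fin.append a (Function.update z i x) := by
  ext k
  refine Fin.addCases (fun k => ?_) (fun k => ?_) k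
  · have : Fin.castAdd s k ≠ Fin.natAdd m i := by
      rw [ne_eq, Fin.ext_iff]; simp; omega
    simp [Function.update_of_ne this]
  · by_cases hk : k = i
    · subst hk; simp
    · have : Fin.natAdd m k ≠ Fin.natAdd m i := fun h => hk (Fin.natAdd_injective s m h)
      simp [hk]

/-- The isometry `|a⟩ ↦ |a, z⟩`. -/
def appendMat (m : ℕ) (z : Qubits s) : Matrix (Qubits (m + s)) (Qubits m) ℂ :=
  funMat fun a => Fin.append a z

theorem appendMat_isometry (z : Qubits s) : (appendMat m z)ᴴ * appendMat m z = 1 := by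
  ext a a'
  rw [appendMat, conjTranspose_funMat_mul_apply, funMat_apply, Matrix.one_apply]
  simp [append_eq_append_iff]

theorem pauliX_mul_appendMat (a : Qubits m) (z z' : Qubits s) :
    pauliX (Fin.append a z) * appendMat m z' = appendMat m (z' + z) * pauliX a := by
  rw [appendMat, appendMat, pauliX_eq_funMat, pauliX_eq_funMat, funMat_mul_funMat,
    funMat_mul_funMat]
  congr 1
  ext u
  simp only [Function.comp_apply, append_add_append]

theorem pauliZ_mul_appendMat (b : Qubits m) (z : Qubits s) :
    pauliZ (Fin.append b (0 : Qubits s)) * appendMat m z = appendMat m z * pauliZ b :=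
  diagonal_mul_funMat fun u => by rw [append_dotProduct_append, zero_dotProduct, add_zero]

theorem pauliZ_natAdd_mul_appendMat (i : Fin s) (z : Qubits s) :
    pauliZ (Pi.single (Fin.natAdd m i) 1) * appendMat m z = sgn (z i) • appendMat m z := by
  ext v u
  rw [pauliZ_mul_apply, Matrix.smul_apply, appendMat, funMat_apply, single_one_dotProduct]
  split_ifs with h
  · rw [h, Fin.append_right]; rfl
  · simp

/-- The one-time pad and a choice of the syndrome, performed before encoding. -/
theorem pad_mul_appendMat (x : PauliVec m) (z z' : Qubits s) :
    pauliZ (Fin.append x.2 (0 : Qubits s)) * pauliX (Fin.append x.1 z) * appendMat m z' =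
      appendMat m (z' + z) * pad x := by
  rw [Matrix.mul_assoc, pauliX_mul_appendMat, ← Matrix.mul_assoc, pauliZ_mul_appendMat,
    Matrix.mul_assoc, pad]

/-! ### Encodings by Clifford circuits -/

/-- The encoding given by a circuit which takes the generators to `Z` operators on the last
wires. -/
def cliffordEncoding {Q : StabilizerCode m s} {L : List (Gate (m + s))} {c : Qubits s}
    (h : ∀ i, gatesMat L * pauli (Q.gen i) =
      sgn (c i) • (pauliZ (Pi.single (Fin.natAdd m i) 1) * gatesMat L)) : Q.Encoding where
  -- The shift by `c` compensates the signs with which the circuit takes generators to `Z`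
  -- operators.
  V y := (gatesMat L)ᴴ * appendMat m (y + c)
  isometry y := by
    rw [Matrix.conjTranspose_mul, Matrix.conjTranspose_conjTranspose, Matrix.mul_assoc,
      ← Matrix.mul_assoc (gatesMat L), mul_eq_one_comm.mp (gatesMat_conjTranspose_mul L),
      Matrix.one_mul, appendMat_isometry]
  syndrome y i := by
    have h1 := congrArg Matrix.conjTranspose (h i)
    rw [Matrix.conjTranspose_mul, Matrix.conjTranspose_smul, Matrix.conjTranspose_mul,
      pauli_conjTranspose, pauliZ_conjTranspose, star_sgn] at h1
    rw [← Matrix.mul_assoc, h1, Matrix.smul_mul, Matrix.mul_assoc, pauliZ_natAdd_mul_appendMat,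
      Matrix.mul_smul, smul_smul, ← sgn_add, Pi.add_apply, add_left_comm, add_self_zmod_two,
      add_zero]

end

/-! ### Circuits -/

section

variable {n k : ℕ}

/-- A gate on the first wires of a larger register. -/
def Gate.lift (k : ℕ) : Gate n → Gate (n + k)
  | .not i => .not (Fin.castAdd k i)
  | .had i => .had (Fin.castAdd k i)
  | .phase i => .phase (Fin.castAdd k i)
  | .cnot i j h => .cnot (Fin.castAdd k i) (Fin.castAdd k j) ((Fin.castAdd_injective n k).ne h)
  | .toffoli i j l hij hil hjl =>
    .toffoli (Fin.castAdd k i) (Fin.castAdd k j) (Fin.castAdd k l)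
      ((Fin.castAdd_injective n k).ne hij) ((Fin.castAdd_injective n k).ne hil)
      ((Fin.castAdd_injective n k).ne hjl)

theorem single_castAdd (i : Fin n) (x : ZMod 2) :
    (Pi.single (Fin.castAdd k i) x : Qubits (n + k)) = Fin.append (Pi.single i x) (0 : Qubits k) := by
  have h : (0 : Qubits (n + k)) = Fin.append 0 0 := by
    ext i
    refine Fin.addCases (fun i => ?_) (fun i => ?_) i <;> simp
  rw [Pi.single, h, update_append_castAdd]
  rfl

/-- Gates on the first wires pass through the preparation of the ancillas, so circuits built for `n`
wires can be reused on the larger register. -/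
theorem Gate.lift_mat_mul (g : Gate n) (z : Qubits k) :
    (g.lift k).mat * appendMat n z = appendMat n z * g.mat := by
  cases g with
  | not i =>
    rw [Gate.lift, not_mat_eq_pauliX, not_mat_eq_pauliX, single_castAdd, pauliX_mul_appendMat,
      add_zero]
  | had i =>
    rw [Gate.lift, had_mat, had_mat, single_castAdd, Matrix.smul_mul, Matrix.mul_smul,
      Matrix.add_mul, Matrix.mul_add, pauliX_mul_appendMat, pauliZ_mul_appendMat, add_zero]
  | phase i =>
    exact diagonal_mul_funMat fun u => by rw [Fin.append_left]
  | cnot i j h =>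
    rw [Gate.lift, cnot_mat, cnot_mat, appendMat, funMat_mul_funMat, funMat_mul_funMat]
    congr 1
    ext u : 1
    simp only [Function.comp_apply, update_append_castAdd, Fin.append_left]
  | toffoli i j l hij hil hjl =>
    rw [Gate.lift, toffoli_mat, toffoli_mat, appendMat, funMat_mul_funMat, funMat_mul_funMat]
    congr 1
    ext u : 1
    simp only [Function.comp_apply, update_append_castAdd, Fin.append_left]

theorem gatesMat_map_lift_mul (L : List (Gate n)) (z : Qubits k) :
    gatesMat (L.map (Gate.lift k)) * appendMat n z = appendMat n z * gatesMat L := by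
  induction L with
  | nil => simp
  | cons g L ih =>
    rw [List.map_cons, gatesMat_cons, gatesMat_cons, Matrix.mul_assoc, g.lift_mat_mul,
      ← Matrix.mul_assoc, ih, Matrix.mul_assoc]

theorem prepare_eq {b : ℕ} (out : Fin b ↪ Fin (n + k)) (L : List (Gate (n + k)))
    (ρ : Op (Qubits n)) : (⟨n + k, Fin.castAddEmb k, out, L⟩ : Circuit n b).prepare ρ =
      appendMat n (0 : Qubits k) * ρ * (appendMat n (0 : Qubits k))ᴴ := by
  ext u v
  obtain ⟨a, z, rfl⟩ := exists_eq_append u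
  obtain ⟨a', z', rfl⟩ := exists_eq_append v
  rw [appendMat, funMat_conj_apply]
  simp only [Circuit.prepare, Matrix.of_apply, append_eq_append_iff]
  have h1 : (Fin.append a z ∘ (Fin.castAddEmb k : Fin n ↪ Fin (n + k))) = a := by ext i; simp
  have h2 : (Fin.append a' z' ∘ (Fin.castAddEmb k : Fin n ↪ Fin (n + k))) = a' := by ext i; simp
  have h3 : (∀ i, i ∉ Set.range (Fin.castAddEmb k : Fin n ↪ Fin (n + k)) →
      Fin.append a z i = 0 ∧ Fin.append a' z' i = 0) ↔ z = 0 ∧ z' = 0 := by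
    constructor
    · intro h
      have h4 : ∀ i : Fin k, Fin.natAdd n i ∉ Set.range (Fin.castAddEmb k : Fin n ↪ Fin (n + k)) := by
        rintro i ⟨j, hj⟩
        rw [Fin.ext_iff] at hj
        simp at hj; omega
      exact ⟨funext fun i => by simpa using (h _ (h4 i)).1,
        funext fun i => by simpa using (h _ (h4 i)).2⟩
    · rintro ⟨rfl, rfl⟩ i hi
      revert hi
      refine Fin.addCases (fun i => ?_) (fun i => ?_) i
      · intro hi; exact (hi ⟨i, rfl⟩).elim
      · intro _; simp
  rw [h1, h2]
  simp only [h3]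
  by_cases hz : z = 0 ∧ z' = 0
  · rw [if_pos hz, Finset.sum_eq_single a, Finset.sum_eq_single a'] <;> simp +contextual [hz, eq_comm]
  · rw [if_neg hz, Finset.sum_eq_zero]
    intro b _
    refine Finset.sum_eq_zero fun b' _ => if_neg fun h => hz ⟨h.1.2, h.2.2⟩

theorem run_eq {b : ℕ} (out : Fin b ↪ Fin (n + k)) (L : List (Gate (n + k)))
    (ρ : Op (Qubits n)) : (⟨n + k, Fin.castAddEmb k, out, L⟩ : Circuit n b).run ρ =
      (⟨n + k, Fin.castAddEmb k, out, L⟩ : Circuit n b).discard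
        ((gatesMat L * appendMat n (0 : Qubits k)) * ρ *
          (gatesMat L * appendMat n (0 : Qubits k))ᴴ) := by
  rw [Circuit.run, prepare_eq]
  have h : (⟨n + k, Fin.castAddEmb k, out, L⟩ : Circuit n b).unitary = gatesMat L := rfl
  rw [h]
  simp only [Matrix.conjTranspose_mul, Matrix.mul_assoc]

theorem discard_of_out_eq_refl {a : ℕ} (inp : Fin a ↪ Fin n) (L : List (Gate n))
    (σ : Op (Qubits n)) :
    (⟨n, inp, Function.Embedding.refl _, L⟩ : Circuit a n).discard σ = σ := by
  ext p q
  have h : ∀ u v : Qubits n, (u ∘ (Function.Embedding.refl (Fin n)) = p ∧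
      v ∘ (Function.Embedding.refl (Fin n)) = q ∧
      ∀ i, i ∉ Set.range (Function.Embedding.refl (Fin n)) → u i = v i) ↔ (u = p ∧ v = q) := by
    intro u v
    simp only [Function.Embedding.coe_refl, Function.comp_id, Set.range_id, Set.mem_univ,
      not_true_eq_false, false_imp_iff, implies_true, and_true]
  simp only [Circuit.discard, Matrix.of_apply, h]
  rw [Finset.sum_eq_single p, Finset.sum_eq_single q] <;> simp +contextual

/-- Exactly one pair of values belongs to each pair of arguments, so the outer sums collapse,
whether or not `f` is injective. -/
theorem sum_ite_sum_graph {α β : Type*} [Fintype α] [Fintype β] [DecidableEq β] (f : α → β)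
    (P : β → β → Prop) [∀ u v, Decidable (P u v)] (M : Op α) :
    (∑ u, ∑ v, if P u v then ∑ a, ∑ b, (if u = f a ∧ v = f b then M a b else 0) else 0) =
      ∑ a, ∑ b, if P (f a) (f b) then M a b else 0 := by
  have h1 : (∑ u, ∑ v, if P u v then ∑ a, ∑ b, (if u = f a ∧ v = f b then M a b else 0) else 0) =
      ∑ p : β × β, ∑ q : α × α,
        if p = (f q.1, f q.2) then (if P (f q.1) (f q.2) then M q.1 q.2 else 0) else 0 := by
    rw [Fintype.sum_prod_type]
    refine Finset.sum_congr rfl fun u _ => Finset.sum_congr rfl fun v _ => ?_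
    rw [Fintype.sum_prod_type]
    split_ifs with h
    · refine Finset.sum_congr rfl fun a _ => Finset.sum_congr rfl fun b _ => ?_
      by_cases hu : u = f a ∧ v = f b
      · rw [if_pos hu, if_pos (Prod.ext hu.1 hu.2), if_pos (hu.1 ▸ hu.2 ▸ h)]
      · rw [if_neg hu, if_neg fun e => hu (Prod.ext_iff.mp e)]
    · symm
      refine Finset.sum_eq_zero fun a _ => Finset.sum_eq_zero fun b _ => ?_
      by_cases hu : u = f a ∧ v = f b
      · have h' : ¬P (f a) (f b) := hu.1 ▸ hu.2 ▸ h
        rw [if_neg h', ite_self]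
      · rw [if_neg fun e => hu (Prod.ext_iff.mp e)]
  rw [h1, Finset.sum_comm, Fintype.sum_prod_type]
  refine Finset.sum_congr rfl fun a _ => Finset.sum_congr rfl fun b _ => ?_
  rw [Finset.sum_ite_eq' Finset.univ, if_pos (Finset.mem_univ _)]

theorem discard_funMat_conj {a b : ℕ} {α : Type*} [Fintype α] (C : Circuit a b)
    (f : α → Qubits C.wires) (M : Op α) (p q : Qubits b) :
    open scoped Classical in
    C.discard (funMat f * M * (funMat f)ᴴ) p q = ∑ u, ∑ v,
      if f u ∘ C.out = p ∧ f v ∘ C.out = q ∧ ∀ i, i ∉ Set.range C.out → f u i = f v i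
        then M u v else 0 := by
  classical
  rw [← sum_ite_sum_graph f (fun u v => u ∘ C.out = p ∧ v ∘ C.out = q ∧
    ∀ i, i ∉ Set.range C.out → u i = v i) M]
  simp only [Circuit.discard, Matrix.of_apply, funMat_conj_apply]

/-! ### The sender's circuit -/

end

section

variable {m s : ℕ}

/-- The pad and the syndrome bits form one Pauli operator applied before the inverse Clifford
circuit: `n = m + s` wires, `n` NOTs, `2n` phase gates and `3 * L.length` gates for the inverse. -/
theorem exists_sender_circuit {Q : StabilizerCode m s} {L : List (Gate (m + s))} {c : Qubits s}
    (h : ∀ i, gatesMat L * pauli (Q.gen i) =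
      sgn (c i) • (pauliZ (Pi.single (Fin.natAdd m i) 1) * gatesMat L))
    (x : PauliVec m) (y : Qubits s) :
    ∃ C : Circuit m (m + s), C.size ≤ 4 * (m + s) + 3 * L.length ∧ ∀ ρ,
      (cliffordEncoding h).V y * (pad x * ρ * (pad x)ᴴ) * ((cliffordEncoding h).V y)ᴴ =
        C.run ρ := by
  obtain ⟨LX, hLX, hX⟩ := exists_gatesMat_eq_pauliX (Fin.append x.1 (y + c))
  obtain ⟨LZ, hLZ, hZ⟩ := exists_gatesMat_eq_pauliZ (Fin.append x.2 (0 : Qubits s))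
  obtain ⟨L', hL', hinv⟩ := exists_gatesMat_eq_conjTranspose L
  refine ⟨⟨m + s, Fin.castAddEmb s, Function.Embedding.refl _, LX ++ LZ ++ L'⟩, ?_, fun ρ => ?_⟩
  · simp only [Circuit.size, List.length_append]; omega
  · rw [run_eq, discard_of_out_eq_refl, gatesMat_append, gatesMat_append, hX, hZ, hinv,
      Matrix.mul_assoc _ _ (appendMat m 0), pad_mul_appendMat, zero_add]
    simp only [cliffordEncoding, Matrix.conjTranspose_mul, Matrix.mul_assoc]

end

/-! ### The receiver's circuit -/

section

variable {m s : ℕ}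

/-- The bits of the message part of a register. -/
def msgBits (u : Qubits (m + s)) : Qubits m := fun i => u (Fin.castAdd s i)

/-- The bits of the syndrome part of a register. -/
def synBits (u : Qubits (m + s)) : Qubits s := fun i => u (Fin.natAdd m i)

@[simp] theorem msgBits_append (a : Qubits m) (z : Qubits s) : msgBits (Fin.append a z) = a := by
  ext i; simp [msgBits]

@[simp] theorem synBits_append (a : Qubits m) (z : Qubits s) : synBits (Fin.append a z) = z := by
  ext i; simp [synBits]

/-- Whether the first `k` bits of `z` are all `1`. -/
def allOne (k : ℕ) (z : Qubits s) : ZMod 2 := if ∀ j : Fin s, (j : ℕ) < k → z j = 1 then 1 else 0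

theorem allOne_zero (z : Qubits s) : allOne 0 z = 1 := by simp [allOne]

theorem allOne_succ (z : Qubits s) (k : Fin s) :
    allOne (k + 1) z = allOne k z * z k := by
  have h : (∀ j : Fin s, (j : ℕ) < k + 1 → z j = 1) ↔
      (∀ j : Fin s, (j : ℕ) < k → z j = 1) ∧ z k = 1 := by
    refine ⟨fun h => ⟨fun j hj => h j (by omega), h k (by omega)⟩, fun h j hj => ?_⟩
    rcases Nat.lt_succ_iff_lt_or_eq.mp hj with hj | hj
    · exact h.1 j hj
    · rw [Fin.ext hj]; exact h.2
  simp only [allOne, h]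
  rcases zmod_two_cases (z k) with hz | hz
  · simp [hz]
  · simp [hz]

theorem allOne_self (z : Qubits s) : allOne s z = if z = 1 then 1 else 0 := by
  have h : (∀ j : Fin s, (j : ℕ) < s → z j = 1) ↔ z = 1 :=
    ⟨fun h => funext fun j => h j j.2, fun h j _ => by rw [h]; rfl⟩
  simp only [allOne, h]

/-- The contents of the ancillas that hold `allOne i z` for `i ≤ k`. -/
def chain (k : ℕ) (z : Qubits s) : Qubits (s + 1) :=
  fun i => if (i : ℕ) ≤ k then allOne i z else 0

/-- Each further conjunction of syndrome bits costs one Toffoli gate into a fresh ancilla. -/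
theorem chain_succ (z : Qubits s) (k : Fin s) : chain (k + 1) z =
    Function.update (chain k z) k.succ (chain k z k.succ + chain k z k.castSucc * z k) := by
  ext i
  by_cases hi : i = k.succ
  · subst hi
    simp [chain, allOne_succ]
  · have h1 : (i : ℕ) ≤ k + 1 ↔ (i : ℕ) ≤ k := by
      have : (i : ℕ) ≠ k + 1 := fun h => hi (Fin.ext h)
      omega
    simp [chain, hi, h1]

theorem chain_zero (z : Qubits s) : chain 0 z = Function.update (0 : Qubits (s + 1)) 0 1 := by
  ext i
  by_cases hi : i = 0
  · subst hi; simp [chain, allOne_zero]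
  · have : ¬(i : ℕ) = 0 := fun h => hi (Fin.ext h)
    simp [chain, hi]

theorem chain_last (z : Qubits s) : chain s z (Fin.last s) = allOne s z := by
  simp [chain]

/-- A basis state of the receiver's register: the received qubits `u`, the ancillas `c` and the
output `o`. -/
def recvState (u : Qubits (m + s)) (c : Qubits (s + 1)) (o : Qubits m) :
    Qubits (m + s + (s + 1 + m)) :=
  Fin.append u (Fin.append c o)

/-- The wires of the receiver's register. -/
def msgWire (m s : ℕ) (i : Fin m) : Fin (m + s + (s + 1 + m)) := Fin.castAdd _ (Fin.castAdd s i)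

/-- See `msgWire`. -/
def synWire (m s : ℕ) (i : Fin s) : Fin (m + s + (s + 1 + m)) := Fin.castAdd _ (Fin.natAdd m i)

/-- See `msgWire`. -/
def chainWire (m s : ℕ) (i : Fin (s + 1)) : Fin (m + s + (s + 1 + m)) :=
  Fin.natAdd _ (Fin.castAdd m i)

/-- See `msgWire`. -/
def outWire (m s : ℕ) (i : Fin m) : Fin (m + s + (s + 1 + m)) := Fin.natAdd _ (Fin.natAdd _ i)

section

variable (u : Qubits (m + s)) (c : Qubits (s + 1)) (o : Qubits m)

theorem recvState_msgWire (i : Fin m) : recvState u c o (msgWire m s i) = msgBits u i := by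
  simp [recvState, msgWire, msgBits]

theorem recvState_synWire (i : Fin s) : recvState u c o (synWire m s i) = synBits u i := by
  simp [recvState, synWire, synBits]

theorem recvState_chainWire (i : Fin (s + 1)) : recvState u c o (chainWire m s i) = c i := by
  simp [recvState, chainWire]

theorem recvState_outWire (i : Fin m) : recvState u c o (outWire m s i) = o i := by
  simp [recvState, outWire]

theorem update_recvState_msgWire (i : Fin m) (x : ZMod 2) :
    Function.update (recvState u c o) (msgWire m s i) x =
      recvState (Function.update u (Fin.castAdd s i) x) c o :=
  update_append_castAdd _ _ _ _

theorem update_recvState_chainWire (i : Fin (s + 1)) (x : ZMod 2) :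
    Function.update (recvState u c o) (chainWire m s i) x =
      recvState u (Function.update c i x) o := by
  rw [recvState, chainWire, update_append_natAdd, update_append_castAdd]; rfl

theorem update_recvState_outWire (i : Fin m) (x : ZMod 2) :
    Function.update (recvState u c o) (outWire m s i) x =
      recvState u c (Function.update o i x) := by
  rw [recvState, outWire, update_append_natAdd, update_append_natAdd]; rfl

end

/-- At most `k` gates take the received basis state `u` to `f u`. -/
def Computes (k : ℕ) (f : Qubits (m + s) → Qubits (m + s + (s + 1 + m))) : Prop :=
  ∃ L : List (Gate (m + s + (s + 1 + m))), L.length ≤ k ∧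
    gatesMat L * appendMat (m + s) (0 : Qubits (s + 1 + m)) = funMat f

theorem Computes.gate {k : ℕ} {f f' : Qubits (m + s) → Qubits (m + s + (s + 1 + m))}
    (hf : Computes k f) (g : Gate (m + s + (s + 1 + m)))
    {h : Qubits (m + s + (s + 1 + m)) → Qubits (m + s + (s + 1 + m))} (hg : g.mat = funMat h)
    (hf' : ∀ u, h (f u) = f' u) : Computes (k + 1) f' := by
  obtain ⟨L, hL, hM⟩ := hf
  refine ⟨L ++ [g], by simpa using hL, ?_⟩
  rw [gatesMat_append, Matrix.mul_assoc, hM, gatesMat_singleton, hg, funMat_mul_funMat]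
  congr 1
  ext u : 1
  exact hf' u

theorem computes_recvState : Computes 0 fun u : Qubits (m + s) => recvState u 0 0 := by
  refine ⟨[], le_rfl, ?_⟩
  rw [gatesMat_nil, Matrix.one_mul, appendMat]
  congr 1
  ext u : 1
  rw [recvState]
  congr 1
  ext i
  refine Fin.addCases (fun i => ?_) (fun i => ?_) i <;> simp

theorem computes_chain : ∀ k ≤ s,
    Computes (1 + k) fun u : Qubits (m + s) => recvState u (chain k (synBits u)) 0
  | 0, _ => computes_recvState.gate (.not (chainWire m s 0)) (not_mat _) fun u => by
      rw [update_recvState_chainWire, recvState_chainWire, chain_zero]; simp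
  | k + 1, hk => by
    let k' : Fin s := ⟨k, hk⟩
    have h1 : chainWire m s k'.castSucc ≠ synWire m s k' := by
      simp [chainWire, synWire, Fin.ext_iff]; omega
    have h2 : chainWire m s k'.castSucc ≠ chainWire m s k'.succ := by
      simp [chainWire, Fin.ext_iff]
    have h3 : synWire m s k' ≠ chainWire m s k'.succ := by
      simp [chainWire, synWire, Fin.ext_iff]; omega
    refine (computes_chain k (by omega)).gate (.toffoli _ _ _ h1 h2 h3) (toffoli_mat _ _ _ _ _ _)
      fun u => ?_
    rw [update_recvState_chainWire, recvState_chainWire, recvState_chainWire, recvState_synWire,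
      ← chain_succ (synBits u) k']

theorem computes_out : ∀ k ≤ m, Computes (1 + s + k) fun u : Qubits (m + s) =>
    recvState u (chain s (synBits u))
      fun i => if (i : ℕ) < k then allOne s (synBits u) * msgBits u i else 0
  | 0, _ => by simpa using! computes_chain (m := m) (s := s) s le_rfl
  | k + 1, hk => by
    let k' : Fin m := ⟨k, hk⟩
    have h1 : chainWire m s (Fin.last s) ≠ msgWire m s k' := by
      simp [chainWire, msgWire, Fin.ext_iff]; omega
    have h2 : chainWire m s (Fin.last s) ≠ outWire m s k' := by
      simp [chainWire, outWire, Fin.ext_iff]; omega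
    have h3 : msgWire m s k' ≠ outWire m s k' := by
      simp [msgWire, outWire, Fin.ext_iff]; omega
    refine (computes_out k (by omega)).gate (.toffoli _ _ _ h1 h2 h3) (toffoli_mat _ _ _ _ _ _)
      fun u => ?_
    rw [update_recvState_outWire, recvState_outWire, recvState_chainWire, recvState_msgWire,
      chain_last]
    congr 1
    ext i
    by_cases hi : i = k'
    · subst hi; simp [k']
    · have h4 : (i : ℕ) < k + 1 ↔ (i : ℕ) < k := by
        have : (i : ℕ) ≠ k := fun h => hi (Fin.ext h)
        omega
      simp [hi, h4]

/-- `computes_out` leaves a second copy of the message on wires to be discarded; adding the output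
back under control of the verdict erases it on acceptance. -/
theorem computes_clear : ∀ k ≤ m, Computes (1 + s + m + k) fun u : Qubits (m + s) =>
    recvState (Fin.append (fun i => if (i : ℕ) < k then
        msgBits u i + allOne s (synBits u) * msgBits u i else msgBits u i) (synBits u))
      (chain s (synBits u)) fun i => allOne s (synBits u) * msgBits u i
  | 0, _ => by
    have h : ∀ u : Qubits (m + s), Fin.append (msgBits u) (synBits u) = u := fun u => by
      obtain ⟨a, z, rfl⟩ := exists_eq_append u
      simp
    simpa [h] using! computes_out (m := m) (s := s) m le_rfl
  | k + 1, hk => by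
    let k' : Fin m := ⟨k, hk⟩
    have h1 : chainWire m s (Fin.last s) ≠ outWire m s k' := by
      simp [chainWire, outWire, Fin.ext_iff]; omega
    have h2 : chainWire m s (Fin.last s) ≠ msgWire m s k' := by
      simp [chainWire, msgWire, Fin.ext_iff]; omega
    have h3 : outWire m s k' ≠ msgWire m s k' := by
      simp [msgWire, outWire, Fin.ext_iff]; omega
    refine (computes_clear k (by omega)).gate (.toffoli _ _ _ h1 h2 h3) (toffoli_mat _ _ _ _ _ _)
      fun u => ?_
    rw [update_recvState_msgWire, recvState_outWire, recvState_chainWire, recvState_msgWire,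
      chain_last, update_append_castAdd, msgBits_append]
    congr 2
    ext i
    have hv : allOne s (synBits u) * allOne s (synBits u) = allOne s (synBits u) := by
      rcases zmod_two_cases (allOne s (synBits u)) with h | h <;> simp [h]
    by_cases hi : i = k'
    · subst hi; simp [k', ← mul_assoc, hv]
    · have h4 : (i : ℕ) < k + 1 ↔ (i : ℕ) < k := by
        have : (i : ℕ) ≠ k := fun h => hi (Fin.ext h)
        omega
      simp [hi, h4]

/-- The effect of the receiver's circuit on basis states: if the syndrome is `1⋯1`, the message is
moved to the output. -/
def recvFun (u : Qubits (m + s)) : Qubits (m + s + (s + 1 + m)) :=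
  recvState (Fin.append (if synBits u = 1 then 0 else msgBits u) (synBits u)) (chain s (synBits u))
    (if synBits u = 1 then msgBits u else 0)

theorem computes_recvFun : Computes (1 + s + m + m) (recvFun : Qubits (m + s) → _) := by
  have h := computes_clear (m := m) (s := s) m le_rfl
  have e : (recvFun : Qubits (m + s) → _) = fun u => recvState (Fin.append (fun i : Fin m =>
      if (i : ℕ) < m then msgBits u i + allOne s (synBits u) * msgBits u i else msgBits u i)
        (synBits u)) (chain s (synBits u)) fun i => allOne s (synBits u) * msgBits u i := by
    ext u : 1
    rw [recvFun, allOne_self]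
    split_ifs with hu
    · congr 2 <;> ext i <;> simp [add_self_zmod_two]
    · congr 2 <;> ext i <;> simp
  rw [e]
  exact h

/-- The output wires of the receiver: the message and the verdict. -/
def recvOut (m s : ℕ) : Fin (m + 1) ↪ Fin (m + s + (s + 1 + m)) :=
  ⟨Fin.snoc (α := fun _ => Fin (m + s + (s + 1 + m))) (outWire m s) (chainWire m s (Fin.last s)), by
    refine Fin.snoc_injective_of_injective (fun i j h => ?_) ?_
    · simpa [outWire, Fin.ext_iff] using h
    · rintro ⟨i, hi⟩
      simp [outWire, chainWire, Fin.ext_iff] at hi; omega⟩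

theorem recvFun_comp_recvOut (a : Qubits m) (z : Qubits s) :
    recvFun (Fin.append a z) ∘ recvOut m s =
      if z = 1 then Fin.snoc (α := fun _ => ZMod 2) a 1
        else Fin.snoc (α := fun _ => ZMod 2) (0 : Qubits m) 0 := by
  have h : recvFun (Fin.append a z) ∘ recvOut m s =
      Fin.snoc (α := fun _ => ZMod 2) (if z = 1 then a else 0) (if z = 1 then 1 else 0) := by
    rw [recvOut, Function.Embedding.coeFn_mk, Fin.comp_snoc]
    congr 1
    · ext i
      simp [recvFun, recvState_outWire]
    · rw [recvFun, recvState_chainWire, chain_last, synBits_append, allOne_self]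
  rw [h]
  split_ifs <;> rfl

/-- The discarded wires always record the syndrome but record the message only on rejection. Tracing
them out thus measures the syndrome, keeps an accepted message coherent and destroys a rejected one.
-/
theorem recvFun_discarded_eq_iff (a a' : Qubits m) (z z' : Qubits s) :
    (∀ i, i ∉ Set.range (recvOut m s) →
      recvFun (Fin.append a z) i = recvFun (Fin.append a' z') i) ↔
      z = z' ∧ (z = 1 ∨ a = a') := by
  have hout : ∀ i : Fin (m + s), Fin.castAdd (s + 1 + m) i ∉ Set.range (recvOut m s) := by
    rintro i ⟨j, hj⟩
    revert hj
    refine Fin.lastCases ?_ (fun j => ?_) j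
    · simp [recvOut, chainWire, Fin.ext_iff]; omega
    · simp [recvOut, outWire, Fin.ext_iff]; omega
  constructor
  · intro h
    have h1 : (Fin.append (if z = 1 then 0 else a) z : Qubits (m + s)) =
        Fin.append (if z' = 1 then 0 else a') z' := by
      ext i
      simpa [recvFun, recvState] using h _ (hout i)
    obtain ⟨h2, rfl⟩ := append_eq_append_iff.mp h1
    refine ⟨rfl, ?_⟩
    by_cases hz : z = 1
    · exact Or.inl hz
    · rw [if_neg hz, if_neg hz] at h2
      exact Or.inr h2
  · rintro ⟨rfl, h⟩ i hi
    have h1 : (if z = 1 then 0 else a) = if z = 1 then 0 else a' := by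
      rcases h with h | h <;> simp [h]
    revert hi
    refine Fin.addCases (fun i => ?_) (fun i => ?_) i
    · intro _
      simp [recvFun, recvState, h1]
    · refine Fin.addCases (fun i => ?_) (fun i => ?_) i
      · intro _
        simp [recvFun, recvState]
      · intro hi
        refine (hi ⟨i.castSucc, ?_⟩).elim
        simp [recvOut, outWire]

/-- On syndrome `1` the full block of `M` survives; on any other syndrome only diagonal entries do,
and they sum to the weight of the fixed rejecting output. -/
theorem sum_recvFun (M : Op (Qubits (m + s))) (p q : Qubits m) (i j : ZMod 2) :
    open scoped Classical in
    (∑ u, ∑ v, if recvFun u ∘ recvOut m s = Fin.snoc (α := fun _ => ZMod 2) p i ∧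
        recvFun v ∘ recvOut m s = Fin.snoc (α := fun _ => ZMod 2) q j ∧
        ∀ l, l ∉ Set.range (recvOut m s) → recvFun u l = recvFun v l then M u v else 0) =
      M (Fin.append p 1) (Fin.append q 1) * proj acc i j +
        (∑ z ∈ Finset.univ.erase (1 : Qubits s), ∑ a, M (Fin.append a z) (Fin.append a z)) *
          (proj (Pi.single (0 : Qubits m) 1) p q * proj rej i j) := by
  classical
  rw [sum_append, Finset.sum_comm]
  have h1 : ∀ (z : Qubits s) (a : Qubits m), (∑ v, if recvFun (Fin.append a z) ∘ recvOut m s =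
        Fin.snoc (α := fun _ => ZMod 2) p i ∧
        recvFun v ∘ recvOut m s = Fin.snoc (α := fun _ => ZMod 2) q j ∧
        ∀ l, l ∉ Set.range (recvOut m s) → recvFun (Fin.append a z) l = recvFun v l
        then M (Fin.append a z) v else 0) =
      ∑ a', if recvFun (Fin.append a z) ∘ recvOut m s = Fin.snoc (α := fun _ => ZMod 2) p i ∧
        recvFun (Fin.append a' z) ∘ recvOut m s = Fin.snoc (α := fun _ => ZMod 2) q j ∧
        (z = 1 ∨ a = a') then M (Fin.append a z) (Fin.append a' z) else 0 := by
    intro z a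
    rw [sum_append]
    refine Finset.sum_congr rfl fun a' _ => ?_
    simp only [recvFun_discarded_eq_iff]
    rw [Finset.sum_eq_single z]
    · simp only [true_and]
    · intro z' _ hz'
      rw [if_neg fun h => hz' h.2.2.1.symm]
    · simp
  rw [Finset.sum_congr rfl fun z _ => Finset.sum_congr rfl fun a _ => h1 z a]
  simp only [recvFun_comp_recvOut]
  rw [← Finset.add_sum_erase _ _ (Finset.mem_univ (1 : Qubits s))]
  congr 1
  · simp only [if_true, true_or, and_true, Fin.snoc_inj]
    rw [Finset.sum_eq_single p, Finset.sum_eq_single q]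
    · by_cases hi : i = 1 <;> by_cases hj : j = 1 <;>
        simp [hi, hj, eq_comm, proj, acc, Matrix.vecMulVec_apply]
    · intro a' _ ha'
      rw [if_neg fun h => ha' h.2.1]
    · simp
    · intro a _ ha
      exact Finset.sum_eq_zero fun a' _ => if_neg fun h => ha h.1.1
    · simp
  · rw [Finset.sum_mul]
    refine Finset.sum_congr rfl fun z hz => ?_
    have hz1 : z ≠ 1 := Finset.ne_of_mem_erase hz
    simp only [hz1, if_false, false_or, Fin.snoc_inj]
    rw [Finset.sum_mul]
    refine Finset.sum_congr rfl fun a _ => ?_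
    rw [Finset.sum_eq_single a]
    · by_cases hp : p = 0 <;> by_cases hq : q = 0 <;> by_cases hi : i = 0 <;>
        by_cases hj : j = 0 <;>
        simp [hp, hq, hi, hj, eq_comm, proj, rej, Matrix.vecMulVec_apply]
    · intro a' _ ha'
      rw [if_neg fun h => ha' h.2.2.symm]
    · simp

end

/-! ### The receiver's circuit performs the protocol. -/

section

variable {K : Type*} {m s : ℕ} {Q : K → StabilizerCode m s} {L : K → List (Gate (m + s))}
  {c : K → Qubits s} (h : ∀ k i, gatesMat (L k) * pauli ((Q k).gen i) =
    sgn (c k i) • (pauliZ (Pi.single (Fin.natAdd m i) 1) * gatesMat (L k)))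

/-- The shift by `y + 1 + c k`, merged with the decryption, moves the expected syndrome `y` to all
ones, where a conjunction tests it. -/
theorem pad_conjTranspose_mul_decode (k : K) (x : PauliVec m) (y y' : Qubits s) :
    (pad x)ᴴ * ((cliffordEncoding (h k)).V y')ᴴ = (appendMat m (y' + (y + 1)))ᴴ *
      (pauliX (Fin.append x.1 (y + 1 + c k)) * (pauliZ (Fin.append x.2 (0 : Qubits s)) *
        gatesMat (L k))) := by
  have h1 := congrArg Matrix.conjTranspose (pad_mul_appendMat x (y + 1 + c k) (y' + (y + 1)))
  have h2 : y' + (y + 1) + (y + 1 + c k) = y' + c k := by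
    rw [add_assoc, ← add_assoc (y + 1), Qubits.add_self, zero_add]
  rw [h2, Matrix.conjTranspose_mul, Matrix.conjTranspose_mul, Matrix.conjTranspose_mul,
    pauliX_conjTranspose, pauliZ_conjTranspose] at h1
  simp only [cliffordEncoding, Matrix.conjTranspose_mul, Matrix.conjTranspose_conjTranspose]
  rw [← Matrix.mul_assoc, ← h1]
  simp only [Matrix.mul_assoc]

theorem exists_receiver_circuit (k : K) (x : PauliVec m) (y : Qubits s) :
    ∃ C : Circuit (m + s) (m + 1), C.size ≤ 7 * (m + s) + 2 + (L k).length ∧ ∀ σ,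
      (protocol Q fun k => cliffordEncoding (h k)).B (k, x, y) σ =
        (C.run σ).submatrix (fun p => Fin.snoc (α := fun _ => ZMod 2) p.1 p.2)
          (fun p => Fin.snoc (α := fun _ => ZMod 2) p.1 p.2) := by
  obtain ⟨LX, hLX, hX⟩ := exists_gatesMat_eq_pauliX (Fin.append x.1 (y + 1 + c k))
  obtain ⟨LZ, hLZ, hZ⟩ := exists_gatesMat_eq_pauliZ (Fin.append x.2 (0 : Qubits s))
  obtain ⟨LC, hLC, hC⟩ := computes_recvFun (m := m) (s := s)
  refine ⟨⟨m + s + (s + 1 + m), Fin.castAddEmb _, recvOut m s,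
    (L k ++ LZ ++ LX).map (Gate.lift _) ++ LC⟩, ?_, fun σ => ?_⟩
  · simp only [Circuit.size, List.length_append, List.length_map]; omega
  set G := pauliX (Fin.append x.1 (y + 1 + c k)) * (pauliZ (Fin.append x.2 (0 : Qubits s)) *
    gatesMat (L k)) with hG
  have hrun : gatesMat ((L k ++ LZ ++ LX).map (Gate.lift (s + 1 + m)) ++ LC) *
      appendMat (m + s) (0 : Qubits (s + 1 + m)) = funMat (recvFun (m := m) (s := s)) * G := by
    rw [gatesMat_append, Matrix.mul_assoc, gatesMat_map_lift_mul, ← Matrix.mul_assoc, hC,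
      gatesMat_append, gatesMat_append, hX, hZ, hG]
  have hconj : ∀ y', (pad x)ᴴ * (((cliffordEncoding (h k)).V y')ᴴ * σ *
      (cliffordEncoding (h k)).V y') * pad x =
      (appendMat m (y' + (y + 1)))ᴴ * (G * σ * Gᴴ) * appendMat m (y' + (y + 1)) := by
    intro y'
    have h1 := pad_conjTranspose_mul_decode h k x y y'
    have h2 := congrArg Matrix.conjTranspose h1
    rw [← hG] at h1 h2
    rw [Matrix.conjTranspose_mul, Matrix.conjTranspose_mul, Matrix.conjTranspose_conjTranspose,
      Matrix.conjTranspose_conjTranspose, Matrix.conjTranspose_conjTranspose] at h2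
    calc _ = ((pad x)ᴴ * ((cliffordEncoding (h k)).V y')ᴴ) * σ *
          ((cliffordEncoding (h k)).V y' * pad x) := by simp only [Matrix.mul_assoc]
      _ = _ := by rw [h1, h2]; simp only [Matrix.mul_assoc]
  have hentry : ∀ (z : Qubits s) a a', ((appendMat m z)ᴴ * (G * σ * Gᴴ) * appendMat m z) a a' =
      (G * σ * Gᴴ) (Fin.append a z) (Fin.append a' z) := by
    intro z a a'
    rw [appendMat, mul_funMat_apply, conjTranspose_funMat_mul_apply]
  have htrace : ∀ y', ((Q k).syndromeProj y' * σ * (Q k).syndromeProj y').trace =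
      ∑ a, (G * σ * Gᴴ) (Fin.append a (y' + (y + 1))) (Fin.append a (y' + (y + 1))) := by
    intro y'
    -- The probability of an outcome is the trace of its decoded block, and decryption is unitary,
    -- so it can be inserted for the wrong syndromes too.
    have h1 : ((Q k).syndromeProj y' * σ * (Q k).syndromeProj y').trace = ((pad x)ᴴ *
        (((cliffordEncoding (h k)).V y')ᴴ * σ * (cliffordEncoding (h k)).V y') * pad x).trace := by
      rw [Matrix.trace_mul_comm _ (pad x), ← Matrix.mul_assoc, pad_mul_pad_conjTranspose,
        Matrix.one_mul, Matrix.trace_mul_comm, ← Matrix.mul_assoc,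
        (cliffordEncoding (h k)).syndromeProj_mul_self, Matrix.trace_mul_comm,
        (cliffordEncoding (h k)).syndromeProj_eq, ← Matrix.mul_assoc, Matrix.trace_mul_comm,
        Matrix.mul_assoc]
    rw [h1, hconj, Matrix.trace]
    exact Finset.sum_congr rfl fun a _ => hentry _ a a
  have hy1 : y + (y + 1) = 1 := by rw [← add_assoc, Qubits.add_self, zero_add]
  have hsum : ∑ y' ∈ Finset.univ.erase y, ((Q k).syndromeProj y' * σ *
      (Q k).syndromeProj y').trace = ∑ z ∈ Finset.univ.erase (1 : Qubits s),
        ∑ a, (G * σ * Gᴴ) (Fin.append a z) (Fin.append a z) := by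
    refine Finset.sum_equiv (Equiv.addRight (y + 1)) (fun y' => ?_) fun y' _ => htrace y'
    simp only [Finset.mem_erase, Finset.mem_univ, and_true, Equiv.coe_addRight, not_iff_not, ne_eq]
    constructor
    · rintro rfl; exact hy1
    · intro h2; exact add_right_cancel (h2.trans hy1.symm)
  rw [run_eq, hrun]
  have hassoc : funMat (recvFun (m := m) (s := s)) * G * σ *
      (funMat (recvFun (m := m) (s := s)) * G)ᴴ = funMat (recvFun (m := m) (s := s)) *
        (G * σ * Gᴴ) * (funMat (recvFun (m := m) (s := s)))ᴴ := by
    simp only [Matrix.conjTranspose_mul, Matrix.mul_assoc]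
  rw [hassoc]
  ext ⟨p, i⟩ ⟨q, j⟩
  rw [Matrix.submatrix_apply, discard_funMat_conj]
  refine Eq.trans ?_ (sum_recvFun (G * σ * Gᴴ) p q i j).symm
  simp only [protocol]
  rw [(cliffordEncoding (h k)).decode_measured, hconj, hsum, hy1, Matrix.add_apply,
    Matrix.smul_apply, Matrix.kroneckerMap_apply, Matrix.kroneckerMap_apply, hentry, smul_eq_mul]

theorem protocol_hasCircuitsOfSize (N : ℕ)
    (hN : ∀ k, 7 * (m + s) + 2 + 3 * (L k).length ≤ N) :
    (protocol Q fun k => cliffordEncoding (h k)).HasCircuitsOfSize N := by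
  rintro ⟨k, x, y⟩
  obtain ⟨C, hC, hrun⟩ := exists_sender_circuit (h k) x y
  obtain ⟨C', hC', hrun'⟩ := exists_receiver_circuit h k x y
  have := hN k
  exact ⟨⟨C, by omega, hrun⟩, ⟨C', by omega, hrun'⟩⟩

end

end QAuth

end

/-! ### The main theorem. -/

open QAuth in
theorem mainTheorem1 :
    (∃ (c : ℝ) (p : Polynomial ℕ), ∀ (m s : ℕ) (K : Type*) [Fintype K] [Nonempty K]
        (Q : K → StabilizerCode m s),
      (∀ V : ∀ k, (Q k).Encoding,
        (protocol Q V).IsPhysical ∧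
        (protocol Q V).keyLength ≤ c * (((m + s : ℕ) : ℝ) + Real.logb 2 (Fintype.card K)) ∧
        ∀ ε : ℝ, 0 ≤ ε → IsPurityTestingCode Q ε → (protocol Q V).IsSecure ε) ∧
      ∃ V : ∀ k, (Q k).Encoding, (protocol Q V).HasCircuitsOfSize (p.eval (m + s))) ∧
    ∀ m s r : ℕ, 0 < s → m + s = r * s →
      (∃ Q : Option (GaloisField 2 s) → StabilizerCode m s, IsNormalRationalCurveCode r Q) ∧
      ∀ Q : Option (GaloisField 2 s) → StabilizerCode m s, IsNormalRationalCurveCode r Q →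
        IsPurityTestingCode Q (2 * ((m + s : ℕ) : ℝ) / (s * (2 ^ s + 1))) ∧
        ∀ V : ∀ k, (Q k).Encoding,
          (protocol Q V).IsSecure (2 * ((m + s : ℕ) : ℝ) / (s * (2 ^ s + 1))) ∧
          (protocol Q V).keyLength = 2 * m + s + Real.logb 2 (2 ^ s + 1) ∧
          (protocol Q V).keyLength ≤ 2 * ((m + s : ℕ) : ℝ) + 1 := by
  -- With `n = m + s` and a Clifford circuit of at most `n * (3 * n + 2)` gates, `7 * n + 2 + 3 * n
  -- * (3 * n + 2)` is the chosen polynomial.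
  refine ⟨⟨2, 9 * Polynomial.X ^ 2 + 13 * Polynomial.X + 2, fun m s K _ _ Q => ⟨fun V => ?_, ?_⟩⟩,
    fun m s r hs h => ⟨exists_normalRationalCurveCode hs h, fun Q hQ => ?_⟩⟩
  · refine ⟨protocol_isPhysical Q V, ?_, fun ε hε hQ => protocol_isSecure Q V hε hQ⟩
    have hK : 0 ≤ Real.logb 2 (Fintype.card K) :=
      Real.logb_nonneg one_lt_two (by exact_mod_cast Fintype.card_pos)
    rw [protocol_keyLength]
    push_cast
    linarith [(Nat.cast_nonneg s : (0 : ℝ) ≤ s)]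
  · choose L c hL h using fun k => (Q k).exists_clifford
    refine ⟨fun k => cliffordEncoding (h k), protocol_hasCircuitsOfSize h _ fun k => ?_⟩
    simp only [Polynomial.eval_add, Polynomial.eval_mul, Polynomial.eval_pow, Polynomial.eval_X,
      Polynomial.eval_ofNat]
    have h1 : s * (3 * (m + s) + 2) ≤ (m + s) * (3 * (m + s) + 2) :=
      Nat.mul_le_mul_right _ (Nat.le_add_left s m)
    have h2 := hL k
    nlinarith
  · have hpur := isPurityTestingCode_of_isNormalRationalCurveCode hs h hQ
    refine ⟨hpur, fun V => ⟨protocol_isSecure Q V (by positivity) hpur, ?_⟩⟩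
    have hcard : ((Fintype.card (Option (GaloisField 2 s)) : ℕ) : ℝ) = 2 ^ s + 1 := by
      rw [Fintype.card_option, card_galoisField hs.ne']
      push_cast
      rfl
    -- `2^s + 1 ≤ 2^(s+1)` costs one bit, the `+ 1` in the bound on the key length.
    have hlog : Real.logb 2 ((2 : ℝ) ^ s + 1) ≤ s + 1 := by
      rw [Real.logb_le_iff_le_rpow one_lt_two (by positivity)]
      have h1 : (1 : ℝ) ≤ 2 ^ s := one_le_pow₀ one_le_two
      have h2 : (2 : ℝ) ^ ((s : ℝ) + 1) = 2 ^ s * 2 := by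
        rw [Real.rpow_add two_pos, Real.rpow_natCast, Real.rpow_one]
      rw [h2]
      linarith
    rw [protocol_keyLength, hcard]
    refine ⟨rfl, ?_⟩
    push_cast
    linarith
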